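/- Setting. Let $N\ge 2$, let $\Omega\subset\mathbb R^N$ be open with finite Lebesgue measure, and let $X=(X_1,\dots,X_m)$ be locally Lipschitz vector fields on $\mathbb R^N$; for smooth $u$ write $Xu=(X_1u,\dots,X_mu)$. An absolutely continuous path $\gamma$ on $[0,T]$ is $X$-subunit if for a.e. $t$ one has $\dot\gamma(t)=\sum_j\theta_j(t)X_j(\gamma(t))$ with $\sum_j\theta_j(t)^2\le1$. Assume that any two points of $\Omega$ are joined by an $X$-subunit path in $\Omega$, and for $x,y\in\Omega$ let $d_X(x,y)$ be the infimum of the $T>0$ for which some $X$-subunit path $\gamma:[0,T]\to\mathbb R^N$ joins $x$ to $y$. Let $B_r=B_r(x)=\{y\in\Omega: d_X(x,y)<r\}$, $x\in\Omega$, $r>0$, be the balls of $(\Omega,d_X)$. Assume: - for $x\in\Omega$, $d_X(x,y)\to0$ as $y\to x$ in $\Omega$ (in the Euclidean sense); - there is $Q>2$ with $0<|B_{2r}|\le 2^Q|B_r|$ for all balls; - there are $C_P,\nu>0$ such that $\frac1{|B_r|}\int_{B_r}|u-u_{B_r}|\,dx\le \frac{C_P\,r}{|B_{\nu r}|}\int_{B_{\nu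 r}}|Xu|\,dx$ for all balls and all $u\in C^1(\overline{B_{\nu r}})$, where $u_{B_r}=\frac1{|B_r|}\int_{B_r}u\,dx$. Let $W^{1,p}_0(\Omega,X)$ be the closure of $C^\infty_c(\Omega)$ with respect to $\|u\|_{W^{1,p}_0(\Omega,X)}=\|Xu\|_{L^p(\Omega)}$; for $u$ in this space, $Xu$ is the $L^p$-limit of the gradients $X\varphi_n$ of an approximating sequence $\varphi_n\in C_c^\infty(\Omega)$. For $1\le p<\infty$ let $M^p(\Omega)$ be the Marcinkiewicz space of measurable $w$ with $|\{|w|\ge t\}|\le C_w t^{-p}$ for all $t>0$, normed by $\|w\|_{M^p}=C_w^{1/p}$ with the optimal $C_w$. Put $2_*=\frac{2Q}{Q+2}$, $p^*=\frac{pQ}{Q-p}$, $p^{**}=\frac{pQ}{Q-2p}$. For a measurable matrix function $A:\Omega\to\mathbb R^{m\times m}$ and $\alpha>0$, suppose that for some $\beta>\alpha$, for a.e. $x\in\Omega$, $\alpha|\eta|^2\le A(x)\eta\cdot\eta\le\beta|\eta|^2$ for all $\eta\in\mathbb R^m$, and consider $$X^*(A(x)Xu)=f\ \text{ in }\Omega,\qquad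 u=0\ \text{ on }\partial\Omega.\tag{1}$$ For $f\in L^{2_*}(\Omega)$, a weak solution of (1) is a $u\in W^{1,2}_0(\Omega,X)$ such that for all $\varphi\in W^{1,2}_0(\Omega,X)$ the function $AXu\cdot X\varphi$ is integrable and $\int_\Omega AXu\cdot X\varphi=\int_\Omega f\varphi$. For $f\in L^1(\Omega)$, a solution of (1) found by approximation is an $L^1(\Omega)$-limit of weak solutions $u_n$ with data $f_n\in L^{2_*}(\Omega)$ such that $f_n\to f$ in $L^1(\Omega)$. For a datum $f\in L^p(\Omega)$, "solution" means weak solution if $p\ge 2_*$, and solution found by approximation if $1\le p<2_*$. Corollary 7.1 (Stability). Let $1\le p\le\infty$ and $\alpha>0$. There is a constant $C$, depending only on $p$, $\alpha$ and the geometric data ($\Omega$, $X$, $Q$), such that for every $A$ as above (with any $\beta>\alpha$), all $f,g\in L^p(\Omega)$, and corresponding solutions $u,v$ of (1) with data $f$ and $g$: - if $p>\frac Q2$, then $u-v\in L^\infty(\Omega)\cap W^{1,2}_0(\Omega,X)$, $\|u-v\|_{L^\infty}\le C\|f-g\|_{L^p}$ and $\|u-v\|_{W^{1,2}_0(\Omega,X)}\le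 C\|f-g\|_{L^p}$; - if $\frac{2Q}{Q+2}\le p<\frac Q2$, then $u-v\in L^{p^{**}}(\Omega)\cap W^{1,2}_0(\Omega,X)$, $\|u-v\|_{L^{p^{**}}}\le C\|f-g\|_{L^p}$ and $\|u-v\|_{W^{1,2}_0(\Omega,X)}\le C\|f-g\|_{L^p}$; - if $1<p<\frac{2Q}{Q+2}$, then $u-v\in W^{1,p^*}_0(\Omega,X)$ and $\|u-v\|_{W^{1,p^*}_0(\Omega,X)}\le C\|f-g\|_{L^p}$; - if $p=1$, then $u,v\in W^{1,1}_0(\Omega,X)$, $\|u-v\|_{M^{Q/(Q-2)}}\le C\|f-g\|_{L^1}$ and $\|Xu-Xv\|_{M^{Q/(Q-1)}}\le C\|f-g\|_{L^1}$. -/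

import Mathlib

open MeasureTheory Filter Topology Set
open scoped ENNReal NNReal ContDiff Matrix

namespace XElliptic

/-- `ℝᴺ` with its Euclidean norm and Lebesgue measure. -/
abbrev E (N : ℕ) : Type := EuclideanSpace ℝ (Fin N)

variable {N m : ℕ}

/-- The `X`-gradient `X u = (X₁ u, …, Xₘ u)` of a differentiable function `u`, for the family of
vector fields `X₁, …, Xₘ` (`X j x` is the coordinate vector of `X_j` at `x`). -/
noncomputable def xGrad (X : Fin m → E N → E N) (u : E N → ℝ) (x : E N) : E m :=
  WithLp.toLp 2 fun j => fderiv ℝ u x (X j x)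

/-- `γ : [0, T] → S` is an `X`-subunit path: it is absolutely continuous and, for almost every
time, `γ' = ∑ θ_j X_j(γ)` with `∑ θ_j² ≤ 1`. -/
def IsSubunitPath (X : Fin m → E N → E N) (S : Set (E N)) (T : ℝ) (γ : ℝ → E N) : Prop :=
  AbsolutelyContinuousOnInterval γ 0 T ∧ (∀ t ∈ Icc 0 T, γ t ∈ S) ∧
    ∀ᵐ t ∂(volume.restrict (Icc 0 T)), ∃ θ : Fin m → ℝ,
      ∑ j, θ j ^ 2 ≤ 1 ∧ HasDerivAt γ (∑ j, θ j • X j (γ t)) t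

/-- `Ω` is `X`-connected: any two of its points are joined by a subunit path inside `Ω`. -/
def IsXConnected (X : Fin m → E N → E N) (Ω : Set (E N)) : Prop :=
  ∀ x ∈ Ω, ∀ y ∈ Ω, ∃ T : ℝ, 0 < T ∧ ∃ γ : ℝ → E N,
    IsSubunitPath X Ω T γ ∧ γ 0 = x ∧ γ T = y

/-- The control (Carnot–Carathéodory) distance. It is only used between points of an
`X`-connected set, so that the infimum is over a nonempty set. -/
noncomputable def ccDist (X : Fin m → E N → E N) (x y : E N) : ℝ :=
  sInf {T : ℝ | 0 < T ∧ ∃ γ : ℝ → E N, IsSubunitPath X univ T γ ∧ γ 0 = x ∧ γ T = y}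

/-- The ball of centre `x` and radius `r` of the metric space `(Ω, d_X)`. -/
def ccBall (X : Fin m → E N → E N) (Ω : Set (E N)) (x : E N) (r : ℝ) : Set (E N) :=
  {y | y ∈ Ω ∧ ccDist X x y < r}

/-- `(Ω, d_X, Lebesgue measure)` is a doubling space with doubling constant `2 ^ Q`. -/
def IsDoubling (X : Fin m → E N → E N) (Ω : Set (E N)) (Q : ℝ) : Prop :=
  ∀ x ∈ Ω, ∀ r : ℝ, 0 < r →
    0 < volume (ccBall X Ω x (2 * r)) ∧
      volume (ccBall X Ω x (2 * r)) ≤ ENNReal.ofReal (2 ^ Q) * volume (ccBall X Ω x r)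

/-- The Poincaré inequality on all `d_X`-balls with constants `C_P` and `ν`. The functions that are
`C¹` up to the closure of a ball are represented by the `C¹` functions on `ℝᴺ` with compact support
(every element of `C¹(K)`, `K` compact, is the restriction of one of these). -/
def PoincareInequality (X : Fin m → E N → E N) (Ω : Set (E N)) (CP ν : ℝ) : Prop :=
  ∀ x ∈ Ω, ∀ r : ℝ, 0 < r → ∀ u : E N → ℝ, ContDiff ℝ 1 u → HasCompactSupport u →
    (⨍ y in ccBall X Ω x r, |u y - ⨍ z in ccBall X Ω x r, u z|) ≤
      CP * r * ⨍ y in ccBall X Ω x (ν * r), ‖xGrad X u y‖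

/-- The standing assumptions on the open set `Ω`, the vector fields `X` and the exponent `Q`. -/
structure IsAdmissible (X : Fin m → E N → E N) (Ω : Set (E N)) (Q : ℝ) : Prop where
  isOpen : IsOpen Ω
  volume_lt_top : volume Ω < (⊤ : ℝ≥0∞)
  locallyLipschitz : ∀ j, LocallyLipschitz (X j)
  connected : IsXConnected X Ω
  /-- `|y - x| → 0` implies `d_X(x, y) → 0`. -/
  tendsto_ccDist : ∀ x ∈ Ω, Tendsto (fun y => ccDist X x y) (𝓝[Ω] x) (𝓝 0)
  two_lt : 2 < Q
  doubling : IsDoubling X Ω Q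
  poincare : ∃ CP ν : ℝ, 0 < CP ∧ 0 < ν ∧ PoincareInequality X Ω CP ν

/-- `u` belongs to `W₀^{1,p}(Ω, X)` and `G = X u` is its `X`-gradient: `(u, G)` is a limit in `L^p`
of pairs `(φₙ, X φₙ)` with `φₙ ∈ C_c^∞(Ω)`. The norm of `u` in `W₀^{1,p}(Ω, X)` is the `L^p` norm
of `G`. -/
def MemW0 (X : Fin m → E N → E N) (Ω : Set (E N)) (p : ℝ≥0∞) (u : E N → ℝ) (G : E N → E m) :
    Prop :=
  MemLp u p (volume.restrict Ω) ∧ MemLp G p (volume.restrict Ω) ∧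
    ∃ φ : ℕ → E N → ℝ,
      (∀ n, ContDiff ℝ ∞ (φ n) ∧ HasCompactSupport (φ n) ∧ tsupport (φ n) ⊆ Ω) ∧
      Tendsto (fun n => eLpNorm (φ n - u) p (volume.restrict Ω)) atTop (𝓝 0) ∧
      Tendsto (fun n => eLpNorm (xGrad X (φ n) - G) p (volume.restrict Ω)) atTop (𝓝 0)

/-- `A` is a measurable matrix-valued function on `Ω` such that, for some `β > α`,
`α |η|² ≤ A(x) η · η ≤ β |η|²` for all `η`. -/
def IsElliptic (Ω : Set (E N)) (α : ℝ) (A : E N → Matrix (Fin m) (Fin m) ℝ) : Prop :=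
  (∀ i j, AEMeasurable (fun x => A x i j) (volume.restrict Ω)) ∧
    ∃ β : ℝ, α < β ∧ ∀ᵐ x ∂(volume.restrict Ω), ∀ η : Fin m → ℝ,
      α * (η ⬝ᵥ η) ≤ (A x *ᵥ η) ⬝ᵥ η ∧ (A x *ᵥ η) ⬝ᵥ η ≤ β * (η ⬝ᵥ η)

/-- `u ∈ W₀^{1,2}(Ω, X)` is a weak solution of `X^*(A X u) = f` in `Ω`, `u = 0` on `∂Ω`:
`∫ A X u · X v = ∫ f v` for all `v ∈ W₀^{1,2}(Ω, X)`, where the left-hand side is required to be an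
honest integral (which is automatic when `A` is bounded, in particular when it is symmetric). -/
def IsWeakSolution (X : Fin m → E N → E N) (Ω : Set (E N)) (A : E N → Matrix (Fin m) (Fin m) ℝ)
    (f u : E N → ℝ) : Prop :=
  ∃ U : E N → E m, MemW0 X Ω 2 u U ∧ ∀ (v : E N → ℝ) (V : E N → E m), MemW0 X Ω 2 v V →
    Integrable (fun x => (A x *ᵥ (U x).ofLp) ⬝ᵥ (V x).ofLp) (volume.restrict Ω) ∧
      ∫ x in Ω, (A x *ᵥ (U x).ofLp) ⬝ᵥ (V x).ofLp = ∫ x in Ω, f x * v x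

/-- The exponent `2_* = 2Q / (Q + 2)`. -/
noncomputable def twoLowerStar (Q : ℝ) : ℝ := 2 * Q / (Q + 2)

/-- The exponent `p^* = pQ / (Q - p)`. -/
noncomputable def star (Q p : ℝ) : ℝ := p * Q / (Q - p)

/-- The exponent `p^{**} = pQ / (Q - 2p)`. -/
noncomputable def starStar (Q p : ℝ) : ℝ := p * Q / (Q - 2 * p)

/-- `u` is a solution found by approximation of `X^*(A X u) = f` in `Ω`, `u = 0` on `∂Ω`, for
`f ∈ L¹(Ω)`: it is the limit in `L¹(Ω)` of weak solutions `uₙ` whose data `fₙ ∈ L^{2_*}(Ω)`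
converge to `f` in `L¹(Ω)`. -/
def IsApproxSolution (X : Fin m → E N → E N) (Ω : Set (E N)) (Q : ℝ)
    (A : E N → Matrix (Fin m) (Fin m) ℝ) (f u : E N → ℝ) : Prop :=
  MemLp u 1 (volume.restrict Ω) ∧ ∃ fn un : ℕ → E N → ℝ,
    (∀ n, MemLp (fn n) (ENNReal.ofReal (twoLowerStar Q)) (volume.restrict Ω) ∧
      IsWeakSolution X Ω A (fn n) (un n)) ∧
    Tendsto (fun n => eLpNorm (fn n - f) 1 (volume.restrict Ω)) atTop (𝓝 0) ∧
    Tendsto (fun n => eLpNorm (un n - u) 1 (volume.restrict Ω)) atTop (𝓝 0)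

/-- `u` is the solution with datum `f ∈ L^p(Ω)`: in the weak sense if `p ≥ 2_*`, and found by
approximation if `p < 2_*`. -/
def IsSolution (X : Fin m → E N → E N) (Ω : Set (E N)) (Q : ℝ)
    (A : E N → Matrix (Fin m) (Fin m) ℝ) (p : ℝ≥0∞) (f u : E N → ℝ) : Prop :=
  (ENNReal.ofReal (twoLowerStar Q) ≤ p → IsWeakSolution X Ω A f u) ∧
    (p < ENNReal.ofReal (twoLowerStar Q) → IsApproxSolution X Ω Q A f u)

/-- The norm `C_w ^ (1 / p)` of the Marcinkiewicz space `M^p(Ω)`, where `C_w` is the optimal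
constant in `|{|w| ≥ t}| ≤ C_w / t ^ p` for all `t > 0` (and the value is `∞` if there is none). -/
noncomputable def marcinkiewiczNorm {F : Type*} [Norm F] (Ω : Set (E N)) (p : ℝ) (w : E N → F) :
    ℝ≥0∞ :=
  (sInf {C : ℝ≥0∞ | ∀ t : ℝ, 0 < t →
    (volume.restrict Ω) {x | t ≤ ‖w x‖} ≤ C / ENNReal.ofReal (t ^ p)}) ^ (1 / p)

end XElliptic

/-! The equation is linear, so w = u - v solves it with datum h = f - g, and everything reduces to a
priori bounds for w and its gradient W in terms of h. Let b ≥ 0 be continuous with primitive B, and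
let T_k be truncation at level k. Testing with B(T_k w) gives α ∫_{|w|<k} b(w)|W|² ≤ ∫ |h| |B(T_k
w)|. Combined with the Sobolev inequality, it also bounds the L^{2Q/(Q-2)} norm of the primitive of
√b at T_k w. These two families of inequalities are the content of `EnergyEstimate`. They see A only
through α, so no constant depends on β. They survive a.e. convergence of solutions and gradients
with L¹ convergence of data (`EnergyEstimate.of_tendsto`), hence hold for solutions found by
approximation; they also scale, so the datum may be normalised.

The bounds come from choices of b. The constant 1 gives both Marcinkiewicz estimates. The power
(1+|s|)^{2γ-2}, with γ tuned to p, gives L^{p**}, and by Hölder the L^{p*} norm of the gradient; γ =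
1 is the energy bound. The function (|s|-k)₊² gives a decay of level sets to which Stampacchia's
lemma applies, hence L^∞.

The Sobolev inequality has to be derived from doubling and Poincaré. Telescoping averages over
dyadic balls around x, together with |B_r| ≥ c r^Q, bounds u - u_Ω pointwise; a Vitali covering
turns this into a weak type inequality (`exists_weak_sobolev_smooth`), and Maz'ya's dyadic
truncation makes it strong (`exists_sobolev`).

The delicate point is the mean u_Ω, which must be controlled by Xu for u compactly supported in Ω
although nothing is assumed about the boundary (`exists_lintegral_le`). If control fails, there are
functions almost constant on Ω, zero outside, with negligible X-gradient. Then no flow of a field ∑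
θ_j X_j can carry positive measure from the complement into Ω, so the essential complement F of Ω is
tangent to these fields, and by Grönwall the distance to F grows at most exponentially along subunit
paths. A d_X-ball of fixed radius, centred in Ω near a point of F ∩ closure Ω, is then confined to a
thin layer of Ω next to F. The measure of the layer tends to 0, against |B_r| ≥ c r^Q.

Below 2_*, the L¹ gradient bound makes the gradients of the approximations Cauchy, and membership in
W₀^{1,p*} is recovered through smooth-edged truncations (`MemW0.of_energyEstimate`). -/

/-! ### Absolutely continuous functions and Grönwall's inequality -/

/-- Precomposition with a monotone or antitone `1`-Lipschitz map preserves absolute continuity. -/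
theorem AbsolutelyContinuousOnInterval.comp_monotone_or_antitone {F : Type*} [PseudoMetricSpace F]
    {f : ℝ → F} {φ : ℝ → ℝ} {a b c d : ℝ} (hf : AbsolutelyContinuousOnInterval f c d)
    (hφ : Monotone φ ∨ Antitone φ) (hL : LipschitzWith 1 φ)
    (hmaps : MapsTo φ (uIcc a b) (uIcc c d)) :
    AbsolutelyContinuousOnInterval (f ∘ φ) a b := by
  rw [absolutelyContinuousOnInterval_iff] at hf ⊢
  intro ε hε
  obtain ⟨δ, hδ, h⟩ := hf ε hε
  refine ⟨δ, hδ, fun E hE hsum => ?_⟩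
  have := h (E.1, fun i => (φ (E.2 i).1, φ (E.2 i).2)) ?_ ?_
  · simpa using this
  · refine ⟨fun i hi => ⟨hmaps (hE.1 i hi).1, hmaps (hE.1 i hi).2⟩, ?_⟩
    intro i hi j hj hij
    have hd := hE.2 hi hj hij
    simp only [Function.onFun, uIoc, Set.disjoint_left, mem_Ioc] at hd ⊢
    set a1 := (E.2 i).1
    set b1 := (E.2 i).2
    set a2 := (E.2 j).1
    set b2 := (E.2 j).2
    intro x hx hx'
    -- Disjoint half-open intervals are ordered unless one of them is empty; φ preserves or reverses
    -- the order, so the images are again ordered or empty.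
    have hle : max a1 b1 ≤ min a2 b2 ∨ max a2 b2 ≤ min a1 b1 ∨ a1 = b1 ∨ a2 = b2 := by
      by_contra! hcon
      obtain ⟨h1, h2, h3, h4⟩ := hcon
      have h3' : min a1 b1 < max a1 b1 := by
        rcases lt_or_gt_of_ne h3 with h | h <;> simp [h]
      have h4' : min a2 b2 < max a2 b2 := by
        rcases lt_or_gt_of_ne h4 with h | h <;> simp [h]
      refine hd (a := min (max a1 b1) (max a2 b2)) ⟨?_, min_le_left _ _⟩ ⟨?_, min_le_right _ _⟩
      · exact lt_min h3' h2
      · exact lt_min h1 h4'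
    rcases hle with h | h | h | h
    · rcases hφ with hm | hm
      · have := hm h
        rw [hm.map_max, hm.map_min] at this
        linarith [hx.2, hx'.1]
      · have := hm h
        rw [hm.map_max, hm.map_min] at this
        linarith [hx.1, hx'.2]
    · rcases hφ with hm | hm
      · have := hm h
        rw [hm.map_max, hm.map_min] at this
        linarith [hx.1, hx'.2]
      · have := hm h
        rw [hm.map_max, hm.map_min] at this
        linarith [hx.2, hx'.1]
    · rw [h] at hx
      simp at hx
      linarith [hx.1, hx.2]
    · rw [h] at hx'
      simp at hx'
      linarith [hx'.1, hx'.2]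
  · refine lt_of_le_of_lt (Finset.sum_le_sum fun i _ => ?_) hsum
    simpa using hL.dist_le_mul (E.2 i).1 (E.2 i).2

/-- Postcomposition with a Lipschitz map preserves absolute continuity. -/
theorem LipschitzWith.comp_absolutelyContinuousOnInterval {F G : Type*} [PseudoMetricSpace F]
    [PseudoMetricSpace G] {f : ℝ → F} {g : F → G} {a b : ℝ} {K : ℝ≥0} (hg : LipschitzWith K g)
    (hf : AbsolutelyContinuousOnInterval f a b) :
    AbsolutelyContinuousOnInterval (g ∘ f) a b := by
  rw [absolutelyContinuousOnInterval_iff] at hf ⊢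
  intro ε hε
  obtain ⟨δ, hδ, h⟩ := hf (ε / (K + 1)) (by positivity)
  refine ⟨δ, hδ, fun E hE hsum => ?_⟩
  have h1 := h E hE hsum
  rw [lt_div_iff₀ (by positivity)] at h1
  refine lt_of_le_of_lt ?_ h1
  rw [Finset.sum_mul]
  refine Finset.sum_le_sum fun i _ => (hg.dist_le_mul _ _).trans ?_
  rw [mul_comm]
  gcongr
  simp

/-- Fundamental theorem of calculus for absolutely continuous functions. The bound is asked of every
possible derivative value: differentiability a.e. is automatic, so a user only bounds a derivative
that is handed to them. -/
theorem AbsolutelyContinuousOnInterval.sub_le_mul_of_deriv_le {g : ℝ → ℝ} {T M : ℝ} (hT : 0 ≤ T)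
    (hg : AbsolutelyContinuousOnInterval g 0 T)
    (hd : ∀ᵐ t ∂(volume.restrict (Icc 0 T)), ∀ c, HasDerivAt g c t → c ≤ M) :
    g T - g 0 ≤ M * T := by
  rw [← hg.integral_deriv_eq_sub]
  have h1 : ∫ t in (0 : ℝ)..T, deriv g t ≤ ∫ _ in (0 : ℝ)..T, M := by
    refine intervalIntegral.integral_mono_ae_restrict hT hg.intervalIntegrable_deriv (by simp) ?_
    have hdiff : ∀ᵐ t ∂(volume.restrict (Icc 0 T)), DifferentiableAt ℝ g t := by
      rw [ae_restrict_iff' measurableSet_Icc]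
      filter_upwards [hg.ae_differentiableAt] with t ht h
      exact ht (by rwa [uIcc_of_le hT])
    filter_upwards [hd, hdiff] with t h1 h2 using h1 _ h2.hasDerivAt
  simpa [mul_comm] using h1

/-- Grönwall's inequality for absolutely continuous functions. -/
theorem AbsolutelyContinuousOnInterval.le_exp_mul_of_deriv_le {g : ℝ → ℝ} {T K : ℝ} (hT : 0 ≤ T)
    (hg : AbsolutelyContinuousOnInterval g 0 T)
    (hd : ∀ᵐ t ∂(volume.restrict (Icc 0 T)), ∀ c, HasDerivAt g c t → c ≤ K * g t) :
    g T ≤ Real.exp (K * T) * g 0 := by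
  have he : AbsolutelyContinuousOnInterval (fun t => Real.exp (-K * t)) 0 T :=
    (ContDiff.contDiffOn (by fun_prop)).absolutelyContinuousOnInterval
  have h := (he.mul hg).sub_le_mul_of_deriv_le (M := 0) hT ?_
  · simp only [Pi.mul_apply, mul_zero, Real.exp_zero, one_mul, zero_mul, sub_nonpos] at h
    have h2 := mul_le_mul_of_nonneg_left h (Real.exp_pos (K * T)).le
    rw [← mul_assoc, ← Real.exp_add] at h2
    simpa using h2
  · have hdiff : ∀ᵐ t ∂(volume.restrict (Icc 0 T)), DifferentiableAt ℝ g t := by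
      rw [ae_restrict_iff' measurableSet_Icc]
      filter_upwards [hg.ae_differentiableAt] with t ht h
      exact ht (by rwa [uIcc_of_le hT])
    filter_upwards [hd, hdiff] with t h1 h2 c hc
    have h3 := h1 _ h2.hasDerivAt
    have h4 : HasDerivAt (fun t => Real.exp (-K * t)) (Real.exp (-K * t) * (-K)) t := by
      simpa using ((hasDerivAt_id t).const_mul (-K)).exp
    have h5 := hc.unique (h4.mul h2.hasDerivAt)
    rw [h5]
    nlinarith [mul_le_mul_of_nonneg_left h3 (Real.exp_pos (-K * t)).le]

/-- Difference quotients are compared before the limit. This serves g = distance to a fixed point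
along γ, whose derivative is thereby at most the speed of γ. -/
theorem HasDerivAt.abs_le_of_dist_le {F : Type*} [NormedAddCommGroup F] [NormedSpace ℝ F]
    {γ : ℝ → F} {g : ℝ → ℝ} {v : F} {c t : ℝ} (hγ : HasDerivAt γ v t) (hg : HasDerivAt g c t)
    (h : ∀ s, |g s - g t| ≤ ‖γ s - γ t‖) : |c| ≤ ‖v‖ := by
  have h1 := (hasDerivAt_iff_tendsto_slope.1 hγ).norm
  have h2 := (hasDerivAt_iff_tendsto_slope.1 hg).norm
  refine le_of_tendsto_of_tendsto' h2 h1 fun s => ?_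
  simp only [slope, vsub_eq_sub, norm_smul]
  gcongr
  exact h s

/-! ### Subunit paths and the control distance -/

namespace XElliptic

variable {N m : ℕ} {X : Fin m → E N → E N} {S Ω : Set (E N)}

theorem IsSubunitPath.mono {S' : Set (E N)} {T : ℝ} {γ : ℝ → E N} (h : IsSubunitPath X S T γ)
    (hS : S ⊆ S') : IsSubunitPath X S' T γ :=
  ⟨h.1, fun t ht => hS (h.2.1 t ht), h.2.2⟩

theorem isSubunitPath_const {x : E N} (hx : x ∈ S) (T : ℝ) :
    IsSubunitPath X S T fun _ => x := by
  refine ⟨?_, fun _ _ => hx, Eventually.of_forall fun t => ⟨0, by simp, ?_⟩⟩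
  · exact (LipschitzWith.const x).lipschitzOnWith.absolutelyContinuousOnInterval
  · simpa using hasDerivAt_const t x

theorem ae_restrict_Icc_comp_add {P : ℝ → Prop} {T c : ℝ}
    (h : ∀ᵐ t ∂(volume.restrict (Icc 0 T)), P t) :
    ∀ᵐ t, t - c ∈ Icc 0 T → P (t - c) := by
  rw [ae_restrict_iff' measurableSet_Icc] at h
  exact (measurePreserving_sub_right volume c).quasiMeasurePreserving.ae h

theorem IsSubunitPath.reverse {T : ℝ} {γ : ℝ → E N} (h : IsSubunitPath X S T γ) :
    IsSubunitPath X S T fun t => γ (T - t) := by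
  refine ⟨?_, fun t ht => h.2.1 _ ⟨by linarith [ht.2], by linarith [ht.1]⟩, ?_⟩
  · refine h.1.comp_monotone_or_antitone (φ := fun t => T - t) (Or.inr ?_) ?_ ?_
    · intro a b hab; simp only; linarith
    · refine LipschitzWith.of_dist_le_mul fun a b => ?_
      rw [Real.dist_eq, Real.dist_eq, NNReal.coe_one, one_mul, abs_sub_comm a b]
      exact le_of_eq (by congr 1; ring)
    · intro t ht
      rw [mem_uIcc] at ht ⊢
      grind
  · have h2 := h.2.2
    rw [ae_restrict_iff' measurableSet_Icc] at h2 ⊢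
    have h3 := (Measure.measurePreserving_sub_left (volume : Measure ℝ) T).quasiMeasurePreserving.ae h2
    filter_upwards [h3] with t ht ht'
    obtain ⟨θ, h1, h2⟩ := ht ⟨by linarith [ht'.2], by linarith [ht'.1]⟩
    refine ⟨fun j => -θ j, by simpa using h1, ?_⟩
    have h4 : HasDerivAt (fun s : ℝ => T - s) (-1) t := by
      simpa using (hasDerivAt_id t).const_sub T
    have h5 := HasDerivAt.scomp t h2 h4
    have h6 : ∑ j, (fun j => -θ j) j • X j (γ (T - t)) =
        (-1 : ℝ) • ∑ j, θ j • X j (γ (T - t)) := by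
      simp
    rw [h6]
    exact h5

theorem IsSubunitPath.concat {T T' : ℝ} {γ γ' : ℝ → E N} (hT : 0 < T) (hT' : 0 < T')
    (h : IsSubunitPath X S T γ) (h' : IsSubunitPath X S T' γ') (hγ : γ T = γ' 0) :
    ∃ σ : ℝ → E N, IsSubunitPath X S (T + T') σ ∧ σ 0 = γ 0 ∧ σ (T + T') = γ' T' := by
  have hl : ∀ t, t ≤ T → γ (min t T) + γ' (max (t - T) 0) - γ' 0 = γ t := fun t ht => by
    rw [min_eq_left ht, max_eq_right (by linarith)]; abel
  have hr : ∀ t, T ≤ t → γ (min t T) + γ' (max (t - T) 0) - γ' 0 = γ' (t - T) := fun t ht => by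
    rw [min_eq_right ht, max_eq_left (by linarith), hγ]; abel
  -- Written as a sum of stopped paths rather than by cases: each summand is a path composed with a
  -- monotone 1-Lipschitz map, so absolute continuity needs no gluing.
  refine ⟨fun t => γ (min t T) + γ' (max (t - T) 0) - γ' 0, ⟨?_, ?_, ?_⟩, ?_, ?_⟩
  · refine (AbsolutelyContinuousOnInterval.add ?_ ?_).sub
      (LipschitzWith.const (γ' 0)).lipschitzOnWith.absolutelyContinuousOnInterval
    · refine h.1.comp_monotone_or_antitone (φ := fun t => min t T) (Or.inl ?_) ?_ ?_
      · intro a b hab; simp only; gcongr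
      · exact LipschitzWith.id.min_const T
      · intro t ht
        rw [uIcc_of_le (by positivity)] at ht ⊢
        exact ⟨le_min ht.1 hT.le, min_le_right _ _⟩
    · refine h'.1.comp_monotone_or_antitone (φ := fun t => max (t - T) 0) (Or.inl ?_) ?_ ?_
      · intro a b hab; simp only; gcongr
      · refine LipschitzWith.max_const ?_ 0
        refine LipschitzWith.of_dist_le_mul fun a b => ?_
        simp
      · intro t ht
        rw [uIcc_of_le (by positivity)] at ht ⊢
        exact ⟨le_max_right _ _, max_le (by linarith [ht.2]) hT'.le⟩
  · intro t ht
    rcases le_total t T with h1 | h1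
    · simp only [hl t h1]; exact h.2.1 t ⟨ht.1, h1⟩
    · simp only [hr t h1]; exact h'.2.1 _ ⟨by linarith, by linarith [ht.2]⟩
  · have h1 := h.2.2
    have h2 := ae_restrict_Icc_comp_add (c := T) h'.2.2
    rw [ae_restrict_iff' measurableSet_Icc] at h1 ⊢
    -- The junction time, where the two velocities need not agree, is a null set.
    have h3 : ∀ᵐ t : ℝ, t ≠ T := by simp [ae_iff]
    filter_upwards [h1, h2, h3] with t h1 h2 h3 ht
    rcases lt_or_gt_of_ne h3 with hlt | hlt
    · obtain ⟨θ, a, b⟩ := h1 ⟨ht.1, hlt.le⟩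
      refine ⟨θ, a, ?_⟩
      rw [hl t hlt.le]
      refine b.congr_of_eventuallyEq ?_
      filter_upwards [Iio_mem_nhds hlt] with s hs using hl s (le_of_lt hs)
    · obtain ⟨θ, a, b⟩ := h2 ⟨by linarith, by linarith [ht.2]⟩
      refine ⟨θ, a, ?_⟩
      rw [hr t hlt.le]
      refine (b.comp_sub_const t T).congr_of_eventuallyEq ?_
      filter_upwards [Ioi_mem_nhds hlt] with s hs using hr s (le_of_lt hs)
  · exact hl 0 hT.le
  · simpa using hr (T + T') (by linarith)

theorem ccDist_nonneg (x y : E N) : 0 ≤ ccDist X x y :=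
  Real.sInf_nonneg fun _ hT => hT.1.le

theorem ccDist_le {x y : E N} {T : ℝ} {γ : ℝ → E N} (hT : 0 < T)
    (hγ : IsSubunitPath X univ T γ) (h0 : γ 0 = x) (h1 : γ T = y) : ccDist X x y ≤ T :=
  csInf_le ⟨0, fun _ h => h.1.le⟩ ⟨hT, γ, hγ, h0, h1⟩

theorem IsXConnected.exists_of_ccDist_lt (hΩ : IsXConnected X Ω) {x y : E N} (hx : x ∈ Ω)
    (hy : y ∈ Ω) {r : ℝ} (h : ccDist X x y < r) :
    ∃ T : ℝ, 0 < T ∧ T < r ∧ ∃ γ : ℝ → E N, IsSubunitPath X univ T γ ∧ γ 0 = x ∧ γ T = y := by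
  obtain ⟨T, hT, γ, hγ, h0, h1⟩ := hΩ x hx y hy
  have hne : {T : ℝ | 0 < T ∧ ∃ γ : ℝ → E N, IsSubunitPath X univ T γ ∧ γ 0 = x ∧ γ T = y}.Nonempty :=
    ⟨T, hT, γ, hγ.mono (subset_univ _), h0, h1⟩
  obtain ⟨T', ⟨h2, h3⟩, h4⟩ := exists_lt_of_csInf_lt hne h
  exact ⟨T', h2, h4, h3⟩

theorem ccDist_self (x : E N) : ccDist X x x = 0 := by
  refine le_antisymm (le_of_forall_gt_imp_ge_of_dense fun r hr => ?_) (ccDist_nonneg x x)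
  exact ccDist_le hr (isSubunitPath_const (mem_univ x) r) rfl rfl

theorem ccDist_comm (x y : E N) : ccDist X x y = ccDist X y x := by
  unfold ccDist
  congr 1
  ext T
  constructor <;>
  · rintro ⟨hT, γ, hγ, h0, h1⟩
    exact ⟨hT, _, hγ.reverse, by simpa using h1, by simpa using h0⟩

theorem IsXConnected.ccDist_triangle (hΩ : IsXConnected X Ω) {x y z : E N} (hx : x ∈ Ω)
    (hy : y ∈ Ω) (hz : z ∈ Ω) : ccDist X x z ≤ ccDist X x y + ccDist X y z := by
  refine le_of_forall_pos_le_add fun ε hε => ?_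
  obtain ⟨T, hT, h1, γ, hγ, h0, h2⟩ :=
    hΩ.exists_of_ccDist_lt hx hy (r := ccDist X x y + ε / 2) (by linarith)
  obtain ⟨T', hT', h1', γ', hγ', h0', h2'⟩ :=
    hΩ.exists_of_ccDist_lt hy hz (r := ccDist X y z + ε / 2) (by linarith)
  obtain ⟨σ, hσ, hσ0, hσ1⟩ := hγ.concat hT hT' hγ' (h2.trans h0'.symm)
  have := ccDist_le (by positivity) hσ (hσ0.trans h0) (hσ1.trans h2')
  linarith

/-- Speed bound for subunit paths. -/
theorem IsSubunitPath.dist_le {T M : ℝ} {γ : ℝ → E N} (hT : 0 ≤ T) (h : IsSubunitPath X S T γ)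
    (hM : ∀ t ∈ Icc 0 T, ∀ θ : Fin m → ℝ, ∑ j, θ j ^ 2 ≤ 1 → ‖∑ j, θ j • X j (γ t)‖ ≤ M) :
    dist (γ T) (γ 0) ≤ M * T := by
  have hL : LipschitzWith 1 fun z : E N => dist z (γ 0) := LipschitzWith.dist_left (γ 0)
  have := (hL.comp_absolutelyContinuousOnInterval h.1).sub_le_mul_of_deriv_le (M := M) hT ?_
  · simpa using this
  · filter_upwards [h.2.2, ae_restrict_mem measurableSet_Icc] with t ht htT c hc
    obtain ⟨θ, h1, h2⟩ := ht
    refine (le_abs_self c).trans ((h2.abs_le_of_dist_le hc fun s => ?_).trans (hM t htT θ h1))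
    simpa [Real.dist_eq, dist_eq_norm] using hL.dist_le_mul (γ s) (γ t)

theorem IsSubunitPath.restrict {T T' : ℝ} {γ : ℝ → E N} (h : IsSubunitPath X S T γ) (h0 : 0 ≤ T')
    (hT : T' ≤ T) : IsSubunitPath X S T' γ := by
  refine ⟨h.1.mono ?_, fun t ht => h.2.1 t ⟨ht.1, ht.2.trans hT⟩, ?_⟩
  · rw [uIcc_of_le h0, uIcc_of_le (h0.trans hT)]
    exact Icc_subset_Icc_right hT
  · exact ae_mono (Measure.restrict_mono (Icc_subset_Icc_right hT) le_rfl) h.2.2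

/-- A subunit path starting at `x` cannot leave the ball `B(x, R)` before the time `R / M`, where
`M` bounds the speed in that ball. -/
theorem IsSubunitPath.mem_ball {T M R : ℝ} {γ : ℝ → E N} (h : IsSubunitPath X S T γ)
    (hM : ∀ y ∈ Metric.closedBall (γ 0) R, ∀ θ : Fin m → ℝ, ∑ j, θ j ^ 2 ≤ 1 →
      ‖∑ j, θ j • X j y‖ ≤ M) (hMT : M * T < R) (hM0 : 0 ≤ M) {t : ℝ} (ht : t ∈ Icc 0 T) :
    γ t ∈ Metric.ball (γ 0) R := by
  have hT : 0 ≤ T := ht.1.trans ht.2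
  have hR : 0 < R := lt_of_le_of_lt (by positivity) hMT
  by_contra hcon
  have hcont : ContinuousOn (fun s => dist (γ s) (γ 0)) (Icc 0 T) := by
    have := h.1.continuousOn
    rw [uIcc_of_le hT] at this
    exact fun s hs => Filter.Tendsto.dist (this s hs) tendsto_const_nhds
  -- The first time τ at distance at least R. Up to τ the path lies in the closed ball where M
  -- bounds the speed, hence R ≤ Mτ ≤ MT < R.
  set Z := Icc 0 T ∩ (fun s => dist (γ s) (γ 0)) ⁻¹' Ici R with hZ
  have hZc : IsClosed Z := hcont.preimage_isClosed_of_isClosed isClosed_Icc isClosed_Ici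
  have hZn : Z.Nonempty := ⟨t, ht, by simpa using hcon⟩
  have hZb : BddBelow Z := ⟨0, fun s hs => hs.1.1⟩
  have hτ := hZc.csInf_mem hZn hZb
  set τ := sInf Z
  have hlt : ∀ s ∈ Icc 0 τ, γ s ∈ Metric.closedBall (γ 0) R := by
    intro s hs
    rcases hs.2.eq_or_lt with rfl | hs'
    · by_contra hgt
      simp only [Metric.mem_closedBall, not_le] at hgt
      have h0 : (0 : ℝ) ≤ τ := hτ.1.1
      have hc : ContinuousOn (fun s => dist (γ s) (γ 0)) (Icc 0 τ) :=
        hcont.mono (Icc_subset_Icc_right hτ.1.2)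
      obtain ⟨s, hs1, hs2⟩ := intermediate_value_Icc h0 hc
        (show R ∈ Icc (dist (γ 0) (γ 0)) (dist (γ τ) (γ 0)) from ⟨by simpa using hR.le, hgt.le⟩)
      have h3 : τ ≤ s := csInf_le hZb ⟨⟨hs1.1, hs1.2.trans hτ.1.2⟩, by simp [hs2]⟩
      have h4 : s = τ := le_antisymm hs1.2 h3
      simp only [h4] at hs2
      linarith
    · by_contra hgt
      simp only [Metric.mem_closedBall, not_le] at hgt
      exact absurd (csInf_le hZb ⟨⟨hs.1, hs'.le.trans hτ.1.2⟩, by simpa using hgt.le⟩)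
        (not_le.2 hs')
  have h1 := (h.restrict hτ.1.1 hτ.1.2).dist_le hτ.1.1 (M := M) fun s hs => hM _ (hlt s hs)
  have h2 : R ≤ dist (γ τ) (γ 0) := hτ.2
  have h3 : M * τ ≤ M * T := mul_le_mul_of_nonneg_left hτ.1.2 hM0
  linarith

end XElliptic

/-! ### Balls of d_X: openness, boundedness of Ω, volume lower bound -/

namespace XElliptic

variable {N m : ℕ} {X : Fin m → E N → E N} {Ω : Set (E N)} {Q : ℝ}

theorem ccBall_subset {x : E N} {r : ℝ} : ccBall X Ω x r ⊆ Ω := fun _ h => h.1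

theorem mem_ccBall_self {x : E N} {r : ℝ} (hx : x ∈ Ω) (hr : 0 < r) : x ∈ ccBall X Ω x r :=
  ⟨hx, by rwa [ccDist_self]⟩

theorem ccBall_mono {x : E N} {r s : ℝ} (h : r ≤ s) : ccBall X Ω x r ⊆ ccBall X Ω x s :=
  fun _ hy => ⟨hy.1, hy.2.trans_le h⟩

namespace IsAdmissible

theorem isOpen_ccBall (hX : IsAdmissible X Ω Q) {x : E N} (hx : x ∈ Ω) (r : ℝ) :
    IsOpen (ccBall X Ω x r) := by
  rw [isOpen_iff_mem_nhds]
  intro y hy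
  have h1 : ∀ᶠ z in 𝓝[Ω] y, ccDist X y z < r - ccDist X x y :=
    (hX.tendsto_ccDist y hy.1).eventually_lt_const (by linarith [hy.2])
  rw [hX.isOpen.nhdsWithin_eq hy.1] at h1
  filter_upwards [h1, hX.isOpen.mem_nhds hy.1] with z hz hzΩ
  exact ⟨hzΩ, by linarith [hX.connected.ccDist_triangle hx hy.1 hzΩ]⟩

theorem ccBall_subset_ccBall (hX : IsAdmissible X Ω Q) {x y : E N} (hx : x ∈ Ω) (hy : y ∈ Ω)
    {r s : ℝ} (h : ccDist X x y + r ≤ s) : ccBall X Ω y r ⊆ ccBall X Ω x s :=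
  fun z hz => ⟨hz.1, by linarith [hX.connected.ccDist_triangle hx hy hz.1, hz.2]⟩

theorem volume_ccBall_lt_top (hX : IsAdmissible X Ω Q) (x : E N) (r : ℝ) :
    volume (ccBall X Ω x r) < ⊤ :=
  (measure_mono ccBall_subset).trans_lt hX.volume_lt_top

theorem volume_ccBall_pos (hX : IsAdmissible X Ω Q) {x : E N} (hx : x ∈ Ω) {r : ℝ} (hr : 0 < r) :
    0 < volume (ccBall X Ω x r) := by
  have := (hX.doubling x hx (r / 2) (by positivity)).1
  rwa [mul_div_cancel₀ r two_ne_zero] at this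

theorem volume_real_ccBall_pos (hX : IsAdmissible X Ω Q) {x : E N} (hx : x ∈ Ω) {r : ℝ}
    (hr : 0 < r) : 0 < volume.real (ccBall X Ω x r) :=
  ENNReal.toReal_pos (hX.volume_ccBall_pos hx hr).ne' (hX.volume_ccBall_lt_top x r).ne

theorem volume_real_ccBall_mono (hX : IsAdmissible X Ω Q) {x : E N} {r s : ℝ} (h : r ≤ s) :
    volume.real (ccBall X Ω x r) ≤ volume.real (ccBall X Ω x s) :=
  measureReal_mono (ccBall_mono h) (hX.volume_ccBall_lt_top x s).ne

theorem volume_ccBall_two_pow_le (hX : IsAdmissible X Ω Q) {x : E N} (hx : x ∈ Ω) {r : ℝ}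
    (hr : 0 < r) (k : ℕ) :
    volume (ccBall X Ω x (2 ^ k * r)) ≤ ENNReal.ofReal (2 ^ Q) ^ k * volume (ccBall X Ω x r) := by
  induction k with
  | zero => simp
  | succ k ih =>
    have := (hX.doubling x hx (2 ^ k * r) (by positivity)).2
    rw [pow_succ', mul_assoc, pow_succ', mul_assoc]
    exact this.trans (by gcongr)

theorem volume_real_ccBall_two_pow_le (hX : IsAdmissible X Ω Q) {x : E N} (hx : x ∈ Ω) {r : ℝ}
    (hr : 0 < r) (k : ℕ) :
    volume.real (ccBall X Ω x (2 ^ k * r)) ≤ (2 ^ Q) ^ k * volume.real (ccBall X Ω x r) := by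
  have h := hX.volume_ccBall_two_pow_le hx hr k
  have h2 := ENNReal.toReal_mono ?_ h
  · simpa [Measure.real, ENNReal.toReal_mul, ENNReal.toReal_pow,
      ENNReal.toReal_ofReal (show (0 : ℝ) ≤ 2 ^ Q by positivity)] using h2
  · exact ENNReal.mul_ne_top (by simp) (hX.volume_ccBall_lt_top x r).ne

/-- The metric space `(Ω, d_X)` is bounded: its measure is doubling and finite. -/
theorem exists_ccBall_eq (hX : IsAdmissible X Ω Q) :
    ∃ D : ℝ, 0 < D ∧ ∀ x ∈ Ω, ∀ r, D ≤ r → ccBall X Ω x r = Ω := by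
  rcases Ω.eq_empty_or_nonempty with rfl | ⟨a, ha⟩
  · exact ⟨1, one_pos, by simp⟩
  have hmono : Monotone fun n : ℕ => ccBall X Ω a n := fun i j hij =>
    ccBall_mono (by exact_mod_cast hij)
  have hU : ⋃ n : ℕ, ccBall X Ω a n = Ω := by
    refine subset_antisymm (iUnion_subset fun n => ccBall_subset) fun y hy => ?_
    obtain ⟨n, hn⟩ := exists_nat_gt (ccDist X a y)
    exact mem_iUnion.2 ⟨n, hy, hn⟩
  have hlim := tendsto_measure_iUnion_atTop (μ := volume) hmono
  rw [hU] at hlim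
  have hlim' := (ENNReal.tendsto_toReal hX.volume_lt_top.ne).comp hlim
  set V := volume.real Ω with hV
  have hVpos : 0 < V := by
    refine ENNReal.toReal_pos ?_ hX.volume_lt_top.ne
    exact ((hX.volume_ccBall_pos ha one_pos).trans_le (measure_mono ccBall_subset)).ne'
  set q : ℝ := ((2 : ℝ) ^ Q) ^ 2 with hq
  have hqpos : 0 < q := by positivity
  have hev : ∀ᶠ n : ℕ in atTop, V * (1 - 1 / (1 + q)) < volume.real (ccBall X Ω a n) := by
    refine hlim'.eventually_const_lt (u := V * (1 - 1 / (1 + q))) ?_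
    change _ < V
    have : 0 < 1 / (1 + q) := by positivity
    nlinarith
  obtain ⟨n, hn, hn1⟩ := (hev.and (eventually_ge_atTop 1)).exists
  set R : ℝ := (n : ℝ) with hR
  have hRpos : 0 < R := by simp only [hR]; exact_mod_cast hn1
  -- B(a,R) has more than the fraction q/(1+q) of |Ω|, where q is the cost of two doublings. If y
  -- were at distance s ≥ 4R, then B(y,s/2) would be disjoint from B(a,R) while B(y,2s) contains it,
  -- so |B(a,R)| ≤ q|B(y,s/2)| ≤ q(|Ω| - |B(a,R)|), a contradiction.
  have key : ∀ y ∈ Ω, ccDist X a y < 4 * R := by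
    intro y hy
    by_contra! hcon
    set s := ccDist X a y with hs
    have hspos : 0 < s := by linarith
    have h1 : ccBall X Ω a R ⊆ ccBall X Ω y (2 ^ 2 * (s / 2)) :=
      hX.ccBall_subset_ccBall hy ha (by rw [ccDist_comm]; linarith)
    have hdisj : Disjoint (ccBall X Ω a R) (ccBall X Ω y (s / 2)) := by
      rw [Set.disjoint_left]
      intro z hz hz'
      have := hX.connected.ccDist_triangle ha hz.1 hy
      rw [ccDist_comm z y] at this
      linarith [hz.2, hz'.2]
    have h2 : volume.real (ccBall X Ω a R) + volume.real (ccBall X Ω y (s / 2)) ≤ V := by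
      rw [← measureReal_union hdisj (hX.isOpen_ccBall hy _).measurableSet
        (hX.volume_ccBall_lt_top _ _).ne (hX.volume_ccBall_lt_top _ _).ne]
      exact measureReal_mono (union_subset ccBall_subset ccBall_subset) hX.volume_lt_top.ne
    have h3 := hX.volume_real_ccBall_two_pow_le hy (half_pos hspos) 2
    have h4 := measureReal_mono (μ := volume) h1 (hX.volume_ccBall_lt_top _ _).ne
    rw [← hq] at h3
    have h5 : V * (1 - 1 / (1 + q)) * (1 + q) = V * q := by field_simp; ring
    nlinarith
  refine ⟨8 * R, by positivity, fun x hx r hr => ?_⟩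
  refine subset_antisymm ccBall_subset fun y hy => ⟨hy, ?_⟩
  have := hX.connected.ccDist_triangle hx ha hy
  rw [ccDist_comm x a] at this
  linarith [key x hx, key y hy]

/-- Lower bound for the volume of balls. -/
theorem exists_mul_rpow_le_volume (hX : IsAdmissible X Ω Q) (hΩ : Ω.Nonempty) {D : ℝ} (hD : 0 < D)
    (hDΩ : ∀ x ∈ Ω, ∀ r, D ≤ r → ccBall X Ω x r = Ω) :
    ∃ c : ℝ, 0 < c ∧ ∀ x ∈ Ω, ∀ r, 0 < r → r ≤ D → c * r ^ Q ≤ volume.real (ccBall X Ω x r) := by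
  have hQ : 0 < Q := two_pos.trans hX.two_lt
  obtain ⟨a, ha⟩ := hΩ
  have hVpos : 0 < volume.real Ω := by
    rw [← hDΩ a ha D le_rfl]
    exact hX.volume_real_ccBall_pos ha hD
  refine ⟨volume.real Ω / (2 * D) ^ Q, by positivity, fun x hx r hr hrD => ?_⟩
  -- k+1 doublings carry the radius r past D, where the ball is all of Ω, and 2^{k+1} ≤ 2D/r.
  obtain ⟨k, hk1, hk2⟩ := exists_nat_pow_near (x := D / r) (y := 2) ((one_le_div hr).2 hrD)
    one_lt_two
  have h1 := hX.volume_real_ccBall_two_pow_le hx hr (k + 1)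
  rw [hDΩ x hx (2 ^ (k + 1) * r) ((div_lt_iff₀ hr).1 hk2).le] at h1
  have h2 : ((2 : ℝ) ^ Q) ^ (k + 1) ≤ (2 * D / r) ^ Q := by
    rw [Real.rpow_pow_comm two_pos.le]
    refine Real.rpow_le_rpow (by positivity) ?_ hQ.le
    rw [pow_succ']
    calc (2 : ℝ) * 2 ^ k ≤ 2 * (D / r) := by gcongr
      _ = 2 * D / r := by ring
  rw [Real.div_rpow (by positivity) hr.le] at h2
  have hm := hX.volume_real_ccBall_pos hx hr
  have h3 : volume.real Ω ≤ (2 * D) ^ Q / r ^ Q * volume.real (ccBall X Ω x r) :=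
    h1.trans (by gcongr)
  have hr' : 0 < r ^ Q := by positivity
  have hD' : 0 < (2 * D) ^ Q := by positivity
  rw [div_mul_eq_mul_div, le_div_iff₀ hr'] at h3
  rw [div_mul_eq_mul_div, div_le_iff₀ hD']
  linarith

/-- Near each point the vector fields `∑ θ_j X_j`, `∑ θ_j² ≤ 1`, are bounded and Lipschitz,
uniformly in `θ`. -/
theorem exists_lipschitz_bound (hX : IsAdmissible X Ω Q) (x₀ : E N) :
    ∃ ρ M : ℝ, ∃ K : ℝ≥0, 0 < ρ ∧ 0 < M ∧ ∀ θ : Fin m → ℝ, ∑ j, θ j ^ 2 ≤ 1 →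
      LipschitzOnWith K (fun y => ∑ j, θ j • X j y) (Metric.closedBall x₀ ρ) ∧
      ∀ y ∈ Metric.closedBall x₀ ρ, ‖∑ j, θ j • X j y‖ ≤ M := by
  have h : ∀ j, ∃ K : ℝ≥0, ∃ t ∈ 𝓝 x₀, LipschitzOnWith K (X j) t := fun j =>
    hX.locallyLipschitz j x₀
  choose K t ht hK using h
  have h2 : (⋂ j, t j) ∈ 𝓝 x₀ := by simpa using ht
  obtain ⟨ρ, hρ, hsub⟩ := Metric.nhds_basis_closedBall.mem_iff.1 h2
  have hθ : ∀ θ : Fin m → ℝ, ∑ j, θ j ^ 2 ≤ 1 → ∀ j, |θ j| ≤ 1 := by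
    intro θ h j
    have : θ j ^ 2 ≤ 1 :=
      (Finset.single_le_sum (f := fun j => θ j ^ 2) (fun i _ => sq_nonneg (θ i))
        (Finset.mem_univ j)).trans h
    exact (sq_le_one_iff_abs_le_one _).1 this
  have hlip : ∀ θ : Fin m → ℝ, ∑ j, θ j ^ 2 ≤ 1 →
      LipschitzOnWith (∑ j, K j) (fun y => ∑ j, θ j • X j y) (Metric.closedBall x₀ ρ) := by
    intro θ h
    refine LipschitzOnWith.of_dist_le_mul fun x hx y hy => ?_
    rw [dist_eq_norm, ← Finset.sum_sub_distrib, NNReal.coe_sum, Finset.sum_mul]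
    refine norm_sum_le_of_le _ fun j _ => ?_
    rw [← smul_sub, norm_smul, Real.norm_eq_abs, ← dist_eq_norm]
    have h3 := (hK j).dist_le_mul x (mem_iInter.1 (hsub hx) j) y (mem_iInter.1 (hsub hy) j)
    calc |θ j| * dist (X j x) (X j y) ≤ 1 * (K j * dist x y) := by
          gcongr
          exact hθ θ h j
      _ = _ := one_mul _
  refine ⟨ρ, ∑ j, ‖X j x₀‖ + (∑ j, K j : ℝ≥0) * ρ + 1, ∑ j, K j, hρ, by positivity,
    fun θ h => ⟨hlip θ h, fun y hy => ?_⟩⟩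
  have h1 := (hlip θ h).dist_le_mul y hy x₀ (Metric.mem_closedBall_self hρ.le)
  have h2 : ‖∑ j, θ j • X j x₀‖ ≤ ∑ j, ‖X j x₀‖ := by
    refine norm_sum_le_of_le _ fun j _ => ?_
    rw [norm_smul, Real.norm_eq_abs]
    exact mul_le_of_le_one_left (norm_nonneg _) (hθ θ h j)
  have h3 : ((∑ j, K j : ℝ≥0) : ℝ) * dist y x₀ ≤ (∑ j, K j : ℝ≥0) * ρ := by
    gcongr
    exact hy
  have h4 := norm_sub_norm_le (∑ j, θ j • X j y) (∑ j, θ j • X j x₀)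
  rw [dist_eq_norm] at h1
  linarith

/-- The topology of `d_X` is finer than the Euclidean one. -/
theorem exists_ccBall_subset_ball (hX : IsAdmissible X Ω Q) {x : E N} (hx : x ∈ Ω) {R : ℝ}
    (hR : 0 < R) : ∃ δ > 0, ccBall X Ω x δ ⊆ Metric.ball x R := by
  obtain ⟨ρ, M, K, hρ, hM, h⟩ := hX.exists_lipschitz_bound x
  refine ⟨min ρ R / M, by positivity, fun y hy => ?_⟩
  obtain ⟨T, hT, hTδ, γ, hγ, h0, h1⟩ := hX.connected.exists_of_ccDist_lt hx hy.1 hy.2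
  rw [lt_div_iff₀ hM] at hTδ
  have := hγ.mem_ball (M := M) (R := min ρ R) ?_ (by linarith) hM.le ⟨hT.le, le_rfl⟩
  · rw [h1, h0] at this
    exact Metric.ball_subset_ball (min_le_right _ _) this
  · intro y hy θ hθ
    rw [h0] at hy
    exact (h θ hθ).2 y (Metric.closedBall_subset_closedBall (min_le_left _ _) hy)

end IsAdmissible

end XElliptic

/-! ### Bi-Lipschitz changes of variables and local flows -/

namespace XElliptic

variable {N m : ℕ} {X : Fin m → E N → E N} {Ω : Set (E N)} {Q : ℝ}

theorem volume_image_le {f : E N → E N} {s : Set (E N)} {K : ℝ≥0} (hf : LipschitzOnWith K f s) :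
    volume (f '' s) ≤ (K : ℝ≥0∞) ^ N * volume s := by
  have hH : (μH[N] : Measure (E N)).IsAddHaarMeasure := by
    simpa using isAddHaarMeasure_hausdorffMeasure (E := E N)
  have h := hf.hausdorffMeasure_image_le (d := N) (by positivity)
  have hc := Measure.isAddLeftInvariant_eq_smul (volume : Measure (E N)) (μH[N])
  rw [hc]
  simp only [Measure.smul_apply, ENNReal.smul_def, smul_eq_mul]
  calc _ ≤ _ := mul_le_mul_right h _
    _ = _ := by rw [ENNReal.rpow_natCast]; ring

/-- On B the map f is injective with a K-Lipschitz inverse, and the preimage is the image of part of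
S under that inverse. -/
theorem volume_preimage_le {f : E N → E N} {B S : Set (E N)} {K : ℝ≥0}
    (hf : ∀ x ∈ B, ∀ y ∈ B, dist x y ≤ K * dist (f x) (f y)) :
    volume (B ∩ f ⁻¹' S) ≤ (K : ℝ≥0∞) ^ N * volume S := by
  rcases (B ∩ f ⁻¹' S).eq_empty_or_nonempty with h0 | ⟨a, ha⟩
  · simp [h0]
  have : Nonempty (E N) := ⟨a⟩
  set A := B ∩ f ⁻¹' S
  have hinj : InjOn f A := fun x hx y hy hxy => by
    have := hf x hx.1 y hy.1
    rw [hxy, dist_self, mul_zero] at this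
    exact dist_le_zero.1 this
  set g := Function.invFunOn f A
  have hg : ∀ x ∈ A, g (f x) = x := fun x hx => hinj.leftInvOn_invFunOn hx
  have hlip : LipschitzOnWith K g (f '' A) := by
    refine LipschitzOnWith.of_dist_le_mul ?_
    rintro _ ⟨x, hx, rfl⟩ _ ⟨y, hy, rfl⟩
    rw [hg x hx, hg y hy]
    exact hf x hx.1 y hy.1
  have himg : g '' (f '' A) = A := by
    rw [image_image]
    ext x
    constructor
    · rintro ⟨y, hy, rfl⟩
      simpa only [hg y hy] using hy
    · exact fun hx => ⟨x, hx, hg x hx⟩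
  have := volume_image_le hlip
  rw [himg] at this
  refine this.trans (mul_le_mul_right (measure_mono ?_) _)
  rintro _ ⟨x, hx, rfl⟩
  exact hx.2

/-- A change of variables inequality without a Jacobian: the lower Lipschitz bound alone makes the
pushforward of Lebesgue measure on B at most K^N times Lebesgue measure. -/
theorem lintegral_comp_le {f : E N → E N} {B : Set (E N)} {K : ℝ≥0} (hB : IsClosed B)
    (hc : ContinuousOn f B) (hf : ∀ x ∈ B, ∀ y ∈ B, dist x y ≤ K * dist (f x) (f y))
    {G : E N → ℝ≥0∞} (hG : Measurable G) :
    ∫⁻ x in B, G (f x) ≤ (K : ℝ≥0∞) ^ N * ∫⁻ x, G x := by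
  have hm : AEMeasurable f (volume.restrict B) := hc.aemeasurable hB.measurableSet
  rw [← lintegral_map' hG.aemeasurable hm, ← smul_eq_mul, ← lintegral_smul_measure]
  refine lintegral_mono' ?_ le_rfl
  refine Measure.le_iff.2 fun S hS => ?_
  rw [Measure.map_apply_of_aemeasurable hm hS, Measure.restrict_apply₀' hB.nullMeasurableSet,
    inter_comm, Measure.smul_apply, smul_eq_mul]
  exact volume_preimage_le hf

/-- Local flow of a Lipschitz vector field, with first order and bi-Lipschitz estimates. -/
theorem exists_flow {Y : E N → E N} {x₀ : E N} {ρ M : ℝ} {K : ℝ≥0} (hρ : 0 < ρ) (hM : 0 < M)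
    (hY : LipschitzOnWith K Y (Metric.closedBall x₀ ρ))
    (hYM : ∀ y ∈ Metric.closedBall x₀ ρ, ‖Y y‖ ≤ M) :
    ∃ h > 0, ∃ Φ : E N × ℝ → E N,
      ContinuousOn Φ (Metric.closedBall x₀ (ρ / 2) ×ˢ Icc 0 h) ∧
      (∀ x ∈ Metric.closedBall x₀ (ρ / 2), Φ (x, 0) = x ∧ ∀ t ∈ Icc 0 h,
        Φ (x, t) ∈ Metric.closedBall x₀ ρ ∧
        HasDerivWithinAt (fun s => Φ (x, s)) (Y (Φ (x, t))) (Icc 0 h) t ∧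
        ‖Φ (x, t) - x - t • Y x‖ ≤ 2 * K * M * t ^ 2) ∧
      ∀ t ∈ Icc 0 h, ∀ x ∈ Metric.closedBall x₀ (ρ / 2), ∀ y ∈ Metric.closedBall x₀ (ρ / 2),
        dist (Φ (x, t)) (Φ (y, t)) ≤ 2 * dist x y ∧
        dist x y ≤ 2 * dist (Φ (x, t)) (Φ (y, t)) := by
  -- The first bound keeps trajectories from the half ball inside the ball of radius ρ. The second
  -- gives Kh ≤ 1/4, so Grönwall's factor is at most 2, and over time h the difference of two
  -- trajectories changes by at most half its initial size.
  set h := min (ρ / (4 * M)) (1 / (4 * (K + 1))) with hh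
  have hh0 : 0 < h := by positivity
  have hhM : 2 * M * h ≤ ρ / 2 := by
    have : h ≤ ρ / (4 * M) := min_le_left _ _
    rw [le_div_iff₀ (by positivity)] at this
    linarith
  have hhK : K * h ≤ 1 / 4 := by
    have : h ≤ 1 / (4 * (K + 1)) := min_le_right _ _
    rw [le_div_iff₀ (by positivity)] at this
    nlinarith [K.coe_nonneg]
  have hPL : IsPicardLindelof (fun _ => Y) (tmin := 0) (tmax := h) ⟨0, le_rfl, hh0.le⟩ x₀
      ⟨ρ, hρ.le⟩ ⟨ρ / 2, by positivity⟩ ⟨M, hM.le⟩ K := by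
    refine IsPicardLindelof.of_time_independent hYM hY ?_
    simp only [sub_zero, sub_self, max_eq_left hh0.le]
    change M * h ≤ ρ - ρ / 2
    nlinarith
  obtain ⟨Φ, h1, h2⟩ := hPL.exists_forall_mem_closedBall_eq_hasDerivWithinAt_continuousOn
  have hder : ∀ x ∈ Metric.closedBall x₀ (ρ / 2), ∀ t ∈ Ico 0 h,
      HasDerivWithinAt (fun s => Φ (x, s)) (Y (Φ (x, t))) (Ici t) t := fun x hx t ht =>
    ((h1 x hx).2 t ⟨ht.1, ht.2.le⟩).mono_of_mem_nhdsWithin (Icc_mem_nhdsGE_of_mem ht)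
  have hcont : ∀ x ∈ Metric.closedBall x₀ (ρ / 2), ContinuousOn (fun s => Φ (x, s)) (Icc 0 h) :=
    fun x hx t ht => ((h1 x hx).2 t ht).continuousWithinAt
  -- The speed is at most M but the fence has slope 2M, because the comparison requires a strict
  -- inequality at contact times. At such a time the point is still in the large ball, so the speed
  -- bound applies.
  have hstay : ∀ x ∈ Metric.closedBall x₀ (ρ / 2), ∀ t ∈ Icc 0 h, ‖Φ (x, t) - x‖ ≤ 2 * M * t := by
    intro x hx
    refine image_norm_le_of_norm_deriv_right_lt_deriv_boundary' (f' := fun t => Y (Φ (x, t)))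
      (B' := fun _ => 2 * M) ((hcont x hx).sub continuousOn_const)
      (fun t ht => (hder x hx t ht).sub_const x) (by simp [(h1 x hx).1]) (by fun_prop)
      (fun t _ => by simpa using (((hasDerivAt_id t).const_mul (2 * M)).hasDerivWithinAt))
      fun t ht heq => ?_
    change ‖Φ (x, t) - x‖ = 2 * M * t at heq
    refine (hYM _ ?_).trans_lt (by linarith)
    rw [Metric.mem_closedBall, dist_eq_norm]
    have h3 : ‖Φ (x, t) - x₀‖ ≤ ‖Φ (x, t) - x‖ + ‖x - x₀‖ := norm_sub_le_norm_sub_add_norm_sub _ _ _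
    rw [Metric.mem_closedBall, dist_eq_norm] at hx
    have : 2 * M * t ≤ 2 * M * h := by gcongr; exact ht.2.le
    linarith
  have hball : ∀ x ∈ Metric.closedBall x₀ (ρ / 2), ∀ t ∈ Icc 0 h,
      Φ (x, t) ∈ Metric.closedBall x₀ ρ := by
    intro x hx t ht
    have h4 := hstay x hx t ht
    rw [Metric.mem_closedBall, dist_eq_norm]
    have h3 : ‖Φ (x, t) - x₀‖ ≤ ‖Φ (x, t) - x‖ + ‖x - x₀‖ := norm_sub_le_norm_sub_add_norm_sub _ _ _
    rw [Metric.mem_closedBall, dist_eq_norm] at hx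
    have : 2 * M * t ≤ 2 * M * h := by gcongr; exact ht.2
    linarith
  have hupper : ∀ t ∈ Icc 0 h, ∀ x ∈ Metric.closedBall x₀ (ρ / 2),
      ∀ y ∈ Metric.closedBall x₀ (ρ / 2), dist (Φ (x, t)) (Φ (y, t)) ≤ 2 * dist x y := by
    intro t ht x hx y hy
    have h5 := dist_le_of_trajectories_ODE_of_mem (v := fun _ => Y) (K := K) (a := 0) (b := h)
      (s := fun _ => Metric.closedBall x₀ ρ) (δ := dist x y) (fun _ _ => hY) (hcont x hx)
      (hder x hx) (fun t ht => hball x hx t ⟨ht.1, ht.2.le⟩) (hcont y hy)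
      (hder y hy) (fun t ht => hball y hy t ⟨ht.1, ht.2.le⟩)
      (by rw [(h1 x hx).1, (h1 y hy).1]) t ht
    refine h5.trans ?_
    rw [mul_comm]
    gcongr
    have h6 : (K : ℝ) * (t - 0) ≤ 1 / 4 := by
      rw [sub_zero]
      exact (mul_le_mul_of_nonneg_left ht.2 K.coe_nonneg).trans hhK
    have h7 : (1 / 4 : ℝ) ≤ Real.log 2 := by linarith [Real.log_two_gt_d9]
    exact (Real.exp_le_exp.2 (h6.trans h7)).trans_eq (Real.exp_log two_pos)
  refine ⟨h, hh0, Φ, h2, fun x hx => ⟨(h1 x hx).1, fun t ht => ⟨hball x hx t ht, (h1 x hx).2 t ht,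
    ?_⟩⟩, fun t ht x hx y hy => ⟨hupper t ht x hx y hy, ?_⟩⟩
  · have h8 := norm_image_sub_le_of_norm_deriv_le_segment' (a := 0) (b := t)
      (f := fun s => Φ (x, s) - s • Y x) (f' := fun s => Y (Φ (x, s)) - Y x)
      (C := K * (2 * M * t)) ?_ ?_ t ⟨ht.1, le_rfl⟩
    · simp only [zero_smul, sub_zero, (h1 x hx).1] at h8
      rw [sub_right_comm]
      exact h8.trans_eq (by ring)
    · intro s hs
      refine HasDerivWithinAt.sub (((h1 x hx).2 s ⟨hs.1, hs.2.trans ht.2⟩).mono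
        (Icc_subset_Icc_right ht.2)) ?_
      simpa using ((hasDerivAt_id s).smul_const (Y x)).hasDerivWithinAt
    · intro s hs
      have hs' : s ∈ Icc 0 h := ⟨hs.1, hs.2.le.trans ht.2⟩
      have hx' : x ∈ Metric.closedBall x₀ ρ := Metric.closedBall_subset_closedBall (by linarith) hx
      rw [← dist_eq_norm]
      refine (hY.dist_le_mul _ (hball x hx s hs') _ hx').trans ?_
      rw [dist_eq_norm]
      gcongr
      refine (hstay x hx s hs').trans ?_
      gcongr
      exact hs.2.le
  · have h8 := norm_image_sub_le_of_norm_deriv_le_segment' (a := 0) (b := t)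
      (f := fun s => Φ (x, s) - Φ (y, s)) (f' := fun s => Y (Φ (x, s)) - Y (Φ (y, s)))
      (C := K * (2 * dist x y)) ?_ ?_ t ⟨ht.1, le_rfl⟩
    · simp only [sub_zero, (h1 x hx).1, (h1 y hy).1] at h8
      have h9 : K * (2 * dist x y) * t ≤ dist x y / 2 := by
        have : K * t ≤ 1 / 4 := (mul_le_mul_of_nonneg_left ht.2 K.coe_nonneg).trans hhK
        nlinarith [dist_nonneg (x := x) (y := y)]
      have h10 := norm_sub_norm_le (x - y) (Φ (x, t) - Φ (y, t))
      rw [norm_sub_rev (x - y)] at h10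
      rw [dist_eq_norm] at h9 ⊢
      rw [dist_eq_norm] at h8 ⊢
      linarith
    · intro s hs
      exact (((h1 x hx).2 s ⟨hs.1, hs.2.trans ht.2⟩).mono (Icc_subset_Icc_right ht.2)).sub
        (((h1 y hy).2 s ⟨hs.1, hs.2.trans ht.2⟩).mono (Icc_subset_Icc_right ht.2))
    · intro s hs
      have hs' : s ∈ Icc 0 h := ⟨hs.1, hs.2.le.trans ht.2⟩
      rw [← dist_eq_norm]
      refine (hY.dist_le_mul _ (hball x hx s hs') _ (hball y hy s hs')).trans ?_
      gcongr
      exact hupper s hs' x hx y hy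

theorem continuous_xGrad (hX : ∀ j, Continuous (X j)) {u : E N → ℝ} (hu : ContDiff ℝ 1 u) :
    Continuous (xGrad X u) := by
  refine (PiLp.continuous_toLp 2 _).comp ?_
  refine continuous_pi fun j => ?_
  exact (hu.continuous_fderiv one_ne_zero).clm_apply (hX j)

theorem abs_fderiv_sum_le {u : E N → ℝ} {θ : Fin m → ℝ} (hθ : ∑ j, θ j ^ 2 ≤ 1) (y : E N) :
    ‖fderiv ℝ u y (∑ j, θ j • X j y)‖ ≤ ‖xGrad X u y‖ := by
  have h : fderiv ℝ u y (∑ j, θ j • X j y) = inner ℝ (WithLp.toLp 2 θ : E m) (xGrad X u y) := by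
    simp [xGrad, PiLp.inner_apply, mul_comm]
  rw [h]
  refine (norm_inner_le_norm _ _).trans (mul_le_of_le_one_left (norm_nonneg _) ?_)
  rw [EuclideanSpace.norm_eq]
  simpa using hθ

/-- A function changes along a flow at most by the integral of its derivative. -/
theorem lintegral_flow_sub_le {Y : E N → E N} {B : Set (E N)} {h : ℝ} {Φ : E N × ℝ → E N}
    (hB : IsClosed B) (hYc : Continuous Y) (hΦ : ContinuousOn Φ (B ×ˢ Icc 0 h))
    (h0 : ∀ x ∈ B, Φ (x, 0) = x)
    (hder : ∀ x ∈ B, ∀ t ∈ Icc 0 h, HasDerivWithinAt (fun s => Φ (x, s)) (Y (Φ (x, t))) (Icc 0 h) t)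
    (hanti : ∀ t ∈ Icc 0 h, ∀ x ∈ B, ∀ y ∈ B, dist x y ≤ 2 * dist (Φ (x, t)) (Φ (y, t)))
    {u : E N → ℝ} (hu : ContDiff ℝ 1 u) {t : ℝ} (ht : t ∈ Icc 0 h) :
    ∫⁻ x in B, ‖u (Φ (x, t)) - u x‖ₑ ≤
      ENNReal.ofReal h * (2 ^ N * ∫⁻ y, ‖fderiv ℝ u y (Y y)‖ₑ) := by
  set G : E N → ℝ≥0∞ := fun y => ‖fderiv ℝ u y (Y y)‖ₑ with hG
  have hGc : Continuous fun y => fderiv ℝ u y (Y y) :=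
    (hu.continuous_fderiv one_ne_zero).clm_apply hYc
  have hGm : Measurable G := hGc.enorm.measurable
  have hcs : ∀ x ∈ B, ContinuousOn (fun s => Φ (x, s)) (Icc 0 h) :=
    fun x hx s hs => (hder x hx s hs).continuousWithinAt
  have hpt : ∀ x ∈ B, ‖u (Φ (x, t)) - u x‖ₑ ≤ ∫⁻ s in Icc 0 h, G (Φ (x, s)) := by
    intro x hx
    have hint : ContinuousOn (fun s => fderiv ℝ u (Φ (x, s)) (Y (Φ (x, s)))) (Icc 0 t) :=
      hGc.comp_continuousOn ((hcs x hx).mono (Icc_subset_Icc_right ht.2))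
    have hftc := intervalIntegral.integral_eq_sub_of_hasDeriv_right_of_le ht.1
      (f := fun s => u (Φ (x, s))) (f' := fun s => fderiv ℝ u (Φ (x, s)) (Y (Φ (x, s))))
      (hu.continuous.comp_continuousOn ((hcs x hx).mono (Icc_subset_Icc_right ht.2))) ?_ ?_
    · simp only [h0 x hx] at hftc
      rw [← hftc, intervalIntegral.integral_of_le ht.1]
      refine (enorm_integral_le_lintegral_enorm _).trans ?_
      exact lintegral_mono' (Measure.restrict_mono
        (Ioc_subset_Icc_self.trans (Icc_subset_Icc_right ht.2)) le_rfl) le_rfl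
    · intro s hs
      have h1 : HasDerivAt (fun s => Φ (x, s)) (Y (Φ (x, s))) s :=
        (hder x hx s ⟨hs.1.le, hs.2.le.trans ht.2⟩).hasDerivAt
          (Icc_mem_nhds hs.1 (hs.2.trans_le ht.2))
      have h2 := (hu.differentiable one_ne_zero (Φ (x, s))).hasFDerivAt
      exact (h2.comp_hasDerivAt s h1).hasDerivWithinAt
    · exact (hint.mono (by rw [uIcc_of_le ht.1])).intervalIntegrable
  calc ∫⁻ x in B, ‖u (Φ (x, t)) - u x‖ₑ
      ≤ ∫⁻ x in B, ∫⁻ s in Icc 0 h, G (Φ (x, s)) :=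
        setLIntegral_mono' hB.measurableSet hpt
    _ = ∫⁻ s in Icc 0 h, ∫⁻ x in B, G (Φ (x, s)) := by
        refine lintegral_lintegral_swap ?_
        rw [Measure.prod_restrict]
        exact (hGc.enorm.comp_continuousOn hΦ).aemeasurable
          (hB.measurableSet.prod measurableSet_Icc)
    _ ≤ ∫⁻ s in Icc 0 h, 2 ^ N * ∫⁻ y, G y := by
        refine setLIntegral_mono' measurableSet_Icc fun s hs => ?_
        have hc : ContinuousOn (fun x => Φ (x, s)) B :=
          hΦ.comp (by fun_prop) fun x hx => ⟨hx, hs⟩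
        simpa using lintegral_comp_le (K := 2) hB hc (by simpa using hanti s hs) hGm
    _ = _ := by
        rw [lintegral_const, Measure.restrict_apply_univ, Real.volume_Icc, sub_zero, mul_comm]

end XElliptic

/-! ### Control of compactly supported functions by their X-gradient in L¹ -/

namespace XElliptic

variable {N m : ℕ} {X : Fin m → E N → E N} {Ω : Set (E N)} {Q : ℝ}

theorem hasCompactSupport_xGrad {u : E N → ℝ} (hu : HasCompactSupport u) :
    HasCompactSupport (xGrad X u) := by
  refine (hu.fderiv ℝ).mono fun x hx h0 => hx ?_
  ext j
  simp [xGrad, h0]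

theorem xGrad_eq_zero {u : E N → ℝ} {x : E N} (hx : x ∉ tsupport u) : xGrad X u x = 0 := by
  have : fderiv ℝ u x = 0 := by
    by_contra h
    exact hx (tsupport_fderiv_subset ℝ (subset_closure h))
  ext j
  simp [xGrad, this]

namespace IsAdmissible

theorem continuous_field (hX : IsAdmissible X Ω Q) (j : Fin m) : Continuous (X j) :=
  (hX.locallyLipschitz j).continuous

theorem integrable_xGrad (hX : IsAdmissible X Ω Q) {u : E N → ℝ} (hu : ContDiff ℝ 1 u)
    (hc : HasCompactSupport u) : Integrable (xGrad X u) :=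
  (continuous_xGrad hX.continuous_field hu).integrable_of_hasCompactSupport
    (hasCompactSupport_xGrad hc)

/-- The Poincaré inequality with integrals in place of averages. -/
theorem exists_poincare (hX : IsAdmissible X Ω Q) :
    ∃ C : ℝ, 0 < C ∧ ∃ l : ℕ, ∀ x ∈ Ω, ∀ r, 0 < r → ∀ u : E N → ℝ, ContDiff ℝ 1 u →
      HasCompactSupport u →
      ∫ y in ccBall X Ω x r, |u y - ⨍ z in ccBall X Ω x r, u z| ≤
        C * r * ∫ y in ccBall X Ω x (2 ^ l * r), ‖xGrad X u y‖ := by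
  obtain ⟨CP, ν, hCP, hν, hP⟩ := hX.poincare
  -- 2^l ≥ ν enlarges the ball of integration; 2^l ν ≥ 1 lets l doublings compare |B_r| with
  -- |B_{νr}| when ν < 1.
  obtain ⟨l, hl⟩ := pow_unbounded_of_one_lt (max ν ν⁻¹) (one_lt_two (α := ℝ))
  have hl1 : ν ≤ 2 ^ l := (le_max_left _ _).trans hl.le
  have hl2 : 1 ≤ 2 ^ l * ν := by
    have := (le_max_right _ _).trans hl.le
    rwa [inv_le_iff_one_le_mul₀ hν] at this
  refine ⟨CP * (2 ^ Q) ^ l, by positivity, l, fun x hx r hr u hu hc => ?_⟩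
  have h := hP x hx r hr u hu hc
  rw [setAverage_eq, setAverage_eq (f := fun y => ‖xGrad X u y‖), smul_eq_mul, smul_eq_mul] at h
  have hm := hX.volume_real_ccBall_pos hx hr
  have hmν := hX.volume_real_ccBall_pos hx (mul_pos hν hr)
  have h1 : volume.real (ccBall X Ω x r) ≤ (2 ^ Q) ^ l * volume.real (ccBall X Ω x (ν * r)) := by
    refine le_trans ?_ (hX.volume_real_ccBall_two_pow_le hx (mul_pos hν hr) l)
    refine hX.volume_real_ccBall_mono ?_
    nlinarith
  have h2 : ∫ y in ccBall X Ω x (ν * r), ‖xGrad X u y‖ ≤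
      ∫ y in ccBall X Ω x (2 ^ l * r), ‖xGrad X u y‖ := by
    refine setIntegral_mono_set (hX.integrable_xGrad hu hc).norm.integrableOn
      (Eventually.of_forall fun _ => norm_nonneg _) (ccBall_mono (by gcongr)).eventuallyLE
  have h0 : 0 ≤ ∫ y in ccBall X Ω x (ν * r), ‖xGrad X u y‖ :=
    integral_nonneg fun _ => norm_nonneg _
  rw [inv_mul_le_iff₀ hm] at h
  refine h.trans ?_
  calc volume.real (ccBall X Ω x r) * (CP * r * ((volume.real (ccBall X Ω x (ν * r)))⁻¹ *
        ∫ y in ccBall X Ω x (ν * r), ‖xGrad X u y‖))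
      ≤ ((2 ^ Q) ^ l * volume.real (ccBall X Ω x (ν * r))) *
        (CP * r * ((volume.real (ccBall X Ω x (ν * r)))⁻¹ *
        ∫ y in ccBall X Ω x (ν * r), ‖xGrad X u y‖)) := by gcongr
    _ = CP * (2 ^ Q) ^ l * r * ∫ y in ccBall X Ω x (ν * r), ‖xGrad X u y‖ := by
        field_simp
    _ ≤ _ := by gcongr

/-- The Poincaré inequality on the whole of `Ω`. -/
theorem exists_poincare_omega (hX : IsAdmissible X Ω Q) :
    ∃ C : ℝ≥0, ∀ u : E N → ℝ, ContDiff ℝ 1 u → HasCompactSupport u →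
      ∫⁻ y in Ω, ‖u y - ⨍ z in Ω, u z‖ₑ ≤ C * ∫⁻ y in Ω, ‖xGrad X u y‖ₑ := by
  rcases Ω.eq_empty_or_nonempty with rfl | ⟨a, ha⟩
  · exact ⟨0, by simp⟩
  obtain ⟨D, hD, hDΩ⟩ := hX.exists_ccBall_eq
  obtain ⟨C, hC, l, h⟩ := hX.exists_poincare
  refine ⟨(C * D).toNNReal, fun u hu hc => ?_⟩
  have h1 := h a ha D hD u hu hc
  have h2 : D ≤ 2 ^ l * D := le_mul_of_one_le_left hD.le (one_le_pow₀ one_le_two)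
  rw [hDΩ a ha D le_rfl, hDΩ a ha _ h2] at h1
  have hi1 : Integrable (fun y => u y - ⨍ z in Ω, u z) (volume.restrict Ω) := by
    have : IsFiniteMeasure (volume.restrict Ω) := ⟨by simpa using hX.volume_lt_top⟩
    exact (hu.continuous.integrable_of_hasCompactSupport hc).integrableOn.sub
      (integrable_const _)
  have hi2 := (hX.integrable_xGrad hu hc).integrableOn (s := Ω)
  simp_rw [← Real.norm_eq_abs] at h1
  have h3 := ENNReal.ofReal_le_ofReal h1
  rw [ofReal_integral_norm_eq_lintegral_enorm hi1, ENNReal.ofReal_mul (by positivity),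
    ofReal_integral_norm_eq_lintegral_enorm hi2] at h3
  exact h3

/-- If the functions of `C¹` class with compact support in `Ω` are not controlled by their gradient,
then no set of positive measure enters `Ω` under the local flow of `∑ θ_j X_j`. -/
theorem volume_eq_zero_of_flow (hX : IsAdmissible X Ω Q)
    (H : ∀ n : ℕ, ∃ u : E N → ℝ, ContDiff ℝ 1 u ∧ HasCompactSupport u ∧ tsupport u ⊆ Ω ∧
      (n : ℝ≥0∞) * ∫⁻ x in Ω, ‖xGrad X u x‖ₑ < ∫⁻ x in Ω, ‖u x‖ₑ)
    {θ : Fin m → ℝ} (hθ : ∑ j, θ j ^ 2 ≤ 1) {x₀ : E N} {R : ℝ} {h : ℝ} {Φ : E N × ℝ → E N}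
    (hΦ : ContinuousOn Φ (Metric.closedBall x₀ R ×ˢ Icc 0 h))
    (h0 : ∀ x ∈ Metric.closedBall x₀ R, Φ (x, 0) = x)
    (hder : ∀ x ∈ Metric.closedBall x₀ R, ∀ t ∈ Icc 0 h,
      HasDerivWithinAt (fun s => Φ (x, s)) (∑ j, θ j • X j (Φ (x, t))) (Icc 0 h) t)
    (hanti : ∀ t ∈ Icc 0 h, ∀ x ∈ Metric.closedBall x₀ R, ∀ y ∈ Metric.closedBall x₀ R,
      dist x y ≤ 2 * dist (Φ (x, t)) (Φ (y, t)))
    {t : ℝ} (ht : t ∈ Icc 0 h) :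
    volume ((Metric.closedBall x₀ R ∩ Ωᶜ) ∩ (fun x => Φ (x, t)) ⁻¹' Ω) = 0 := by
  set B := Metric.closedBall x₀ R with hB
  have hBc : IsClosed B := Metric.isClosed_closedBall
  have hft : ContinuousOn (fun x => Φ (x, t)) B := hΦ.comp (by fun_prop) fun x hx => ⟨hx, ht⟩
  set P := (B ∩ Ωᶜ) ∩ (fun x => Φ (x, t)) ⁻¹' Ω with hP
  have hPB : P ⊆ B := fun x hx => hx.1.1
  have hPm : MeasurableSet P := by
    obtain ⟨O, hO, hO'⟩ := continuousOn_iff'.1 hft Ω hX.isOpen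
    have : P = O ∩ B ∩ Ωᶜ := by
      rw [← hO', hP]
      ext x
      simp only [mem_inter_iff]
      tauto
    rw [this]
    exact (hO.measurableSet.inter hBc.measurableSet).inter hX.isOpen.measurableSet.compl
  have hPfin : volume P ≠ ⊤ :=
    ((measure_mono hPB).trans_lt (isCompact_closedBall x₀ R).measure_lt_top).ne
  obtain ⟨C₁, hC₁⟩ := hX.exists_poincare_omega
  set C₂ : ℝ≥0∞ := 2 ^ N * C₁ + ENNReal.ofReal h * 2 ^ N with hC₂
  have hC₂fin : C₂ ≠ ⊤ := by
    simp only [hC₂]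
    finiteness
  set C₃ : ℝ≥0∞ := C₂ * volume Ω + volume P * C₁ with hC₃
  have hC₃fin : C₃ ≠ ⊤ := by
    simp only [hC₃]
    have := hX.volume_lt_top.ne
    finiteness
  -- On P, u vanishes at x but Φ_t(x) lies in Ω, where u is near its mean a. The change of u along
  -- the flow and the oscillation of u on Ω are both O(J), so |a||P| = O(J), and then |P| ∫|u| ≤ C₃
  -- J. Since nJ < ∫|u|, this bounds n|P| uniformly in n.
  have main : ∀ n : ℕ, volume P * n ≤ C₃ := by
    intro n
    obtain ⟨u, hu, hc, hsub, hlt⟩ := H n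
    set J := ∫⁻ x in Ω, ‖xGrad X u x‖ₑ with hJ
    set a := ⨍ z in Ω, u z with ha
    have hJfin : J ≠ ⊤ := (hX.integrable_xGrad hu hc).integrableOn.hasFiniteIntegral.ne
    have hYc : Continuous fun y => ∑ j, θ j • X j y :=
      continuous_finsetSum _ fun j _ => (hX.continuous_field j).const_smul (θ j)
    have e1 : ∫⁻ x in P, ‖u (Φ (x, t))‖ₑ ≤ ENNReal.ofReal h * 2 ^ N * J := by
      have h1 := lintegral_flow_sub_le hBc hYc hΦ h0 hder hanti hu ht
      have h2 : ∫⁻ y, ‖fderiv ℝ u y (∑ j, θ j • X j y)‖ₑ ≤ J := by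
        rw [hJ, ← lintegral_indicator hX.isOpen.measurableSet]
        refine lintegral_mono fun y => ?_
        by_cases hy : y ∈ Ω
        · rw [indicator_of_mem hy]
          exact enorm_le_iff_norm_le.2 (abs_fderiv_sum_le hθ y)
        · have := abs_fderiv_sum_le (X := X) (u := u) hθ y
          rw [xGrad_eq_zero (fun h => hy (hsub h)), norm_zero] at this
          simp [norm_le_zero_iff.1 this]
      calc ∫⁻ x in P, ‖u (Φ (x, t))‖ₑ = ∫⁻ x in P, ‖u (Φ (x, t)) - u x‖ₑ := by
            refine setLIntegral_congr_fun hPm fun x hx => ?_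
            have : u x = 0 := image_eq_zero_of_notMem_tsupport fun h => hx.1.2 (hsub h)
            simp [this]
        _ ≤ ∫⁻ x in B, ‖u (Φ (x, t)) - u x‖ₑ := lintegral_mono_set hPB
        _ ≤ _ := h1
        _ ≤ _ := by rw [mul_assoc]; gcongr
    have e2 : ∫⁻ x in P, ‖u (Φ (x, t)) - a‖ₑ ≤ 2 ^ N * (C₁ * J) := by
      have hG : Measurable (Ω.indicator fun y => ‖u y - a‖ₑ) :=
        ((hu.continuous.sub continuous_const).enorm.measurable).indicator hX.isOpen.measurableSet
      have h1 := lintegral_comp_le (K := 2) hBc hft (by simpa using hanti t ht) hG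
      rw [lintegral_indicator hX.isOpen.measurableSet] at h1
      calc ∫⁻ x in P, ‖u (Φ (x, t)) - a‖ₑ
          = ∫⁻ x in P, Ω.indicator (fun y => ‖u y - a‖ₑ) (Φ (x, t)) := by
            refine setLIntegral_congr_fun hPm fun x hx => ?_
            have hx2 : Φ (x, t) ∈ Ω := hx.2
            rw [indicator_of_mem hx2]
        _ ≤ ∫⁻ x in B, Ω.indicator (fun y => ‖u y - a‖ₑ) (Φ (x, t)) := lintegral_mono_set hPB
        _ ≤ _ := h1
        _ ≤ _ := by
            simp only [ENNReal.coe_ofNat]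
            gcongr
            exact hC₁ u hu hc
    have e3 : ‖a‖ₑ * volume P ≤ C₂ * J := by
      rw [← setLIntegral_const]
      have hm : AEMeasurable (fun x => ‖u (Φ (x, t)) - a‖ₑ) (volume.restrict P) :=
        (((hu.continuous.comp_continuousOn hft).mono hPB).sub continuousOn_const).enorm.aemeasurable
          hPm
      calc ∫⁻ x in P, ‖a‖ₑ ≤ ∫⁻ x in P, (‖u (Φ (x, t)) - a‖ₑ + ‖u (Φ (x, t))‖ₑ) := by
            refine lintegral_mono fun x => ?_
            have := enorm_sub_le (a := u (Φ (x, t))) (b := u (Φ (x, t)) - a)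
            rw [sub_sub_cancel] at this
            rwa [add_comm]
        _ = _ := lintegral_add_left' hm _
        _ ≤ 2 ^ N * (C₁ * J) + ENNReal.ofReal h * 2 ^ N * J := add_le_add e2 e1
        _ = C₂ * J := by rw [hC₂]; ring
    have e4 : ∫⁻ x in Ω, ‖u x‖ₑ ≤ C₁ * J + ‖a‖ₑ * volume Ω := by
      rw [← setLIntegral_const]
      calc ∫⁻ x in Ω, ‖u x‖ₑ ≤ ∫⁻ x in Ω, (‖u x - a‖ₑ + ‖a‖ₑ) := by
            refine lintegral_mono fun x => ?_
            have := enorm_add_le (u x - a) a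
            rwa [sub_add_cancel] at this
        _ = _ := lintegral_add_right _ measurable_const
        _ ≤ _ := by gcongr; exact hC₁ u hu hc
    have e5 : volume P * ∫⁻ x in Ω, ‖u x‖ₑ ≤ C₃ * J := by
      calc volume P * ∫⁻ x in Ω, ‖u x‖ₑ ≤ volume P * (C₁ * J + ‖a‖ₑ * volume Ω) := by gcongr
        _ = volume P * C₁ * J + (‖a‖ₑ * volume P) * volume Ω := by ring
        _ ≤ volume P * C₁ * J + (C₂ * J) * volume Ω := by gcongr
        _ = C₃ * J := by rw [hC₃]; ring
    rcases eq_or_ne J 0 with hJ0 | hJ0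
    · rw [hJ0, mul_zero] at e5 hlt
      rcases mul_eq_zero.1 (le_zero_iff.1 e5) with h6 | h6
      · simp [h6]
      · exact absurd h6 hlt.ne'
    · refine (ENNReal.mul_le_mul_iff_left hJ0 hJfin).1 (le_trans ?_ e5)
      rw [mul_assoc]
      gcongr
  by_contra hne
  obtain ⟨n, hn⟩ := ENNReal.exists_nat_mul_gt hne hC₃fin
  rw [mul_comm] at hn
  exact absurd (main n) (not_le.2 hn)

/-- Under the same hypothesis, the essential complement of `Ω` is tangent to the vector fields. -/
theorem exists_mem_support_near (hX : IsAdmissible X Ω Q)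
    (H : ∀ n : ℕ, ∃ u : E N → ℝ, ContDiff ℝ 1 u ∧ HasCompactSupport u ∧ tsupport u ⊆ Ω ∧
      (n : ℝ≥0∞) * ∫⁻ x in Ω, ‖xGrad X u x‖ₑ < ∫⁻ x in Ω, ‖u x‖ₑ)
    {θ : Fin m → ℝ} (hθ : ∑ j, θ j ^ 2 ≤ 1) {x₀ : E N} {ρ M : ℝ} {K : ℝ≥0} (hρ : 0 < ρ)
    (hM : 0 < M)
    (hY : LipschitzOnWith K (fun y => ∑ j, θ j • X j y) (Metric.closedBall x₀ ρ))
    (hYM : ∀ y ∈ Metric.closedBall x₀ ρ, ‖∑ j, θ j • X j y‖ ≤ M) :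
    ∃ h > 0, ∃ C : ℝ, ∀ p ∈ (volume.restrict Ωᶜ).support ∩ Metric.ball x₀ (ρ / 2),
      ∀ t ∈ Icc 0 h, ∃ q ∈ (volume.restrict Ωᶜ).support,
        ‖q - p - t • ∑ j, θ j • X j p‖ ≤ C * t ^ 2 := by
  obtain ⟨h, hh, Φ, hΦ, h1, h2⟩ := exists_flow hρ hM hY hYM
  -- The witness is the flowed point. Near p the complement has positive measure, almost all of it
  -- stays in the complement under Φ_t, and the bi-Lipschitz map Φ_t does not destroy positive
  -- measure.
  refine ⟨h, hh, 2 * K * M, fun p hp t ht => ⟨Φ (p, t), ?_,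
    ((h1 p (Metric.ball_subset_closedBall hp.2)).2 t ht).2.2⟩⟩
  have hz := hX.volume_eq_zero_of_flow H hθ hΦ (fun x hx => (h1 x hx).1)
    (fun x hx t ht => ((h1 x hx).2 t ht).2.1) (fun t ht x hx y hy => (h2 t ht x hx y hy).2) ht
  rw [Measure.mem_support_iff_forall]
  intro U hU
  obtain ⟨ε, hε, hεU⟩ := Metric.mem_nhds_iff.1 hU
  obtain ⟨δ, hδ, hδB⟩ := Metric.mem_nhds_iff.1 (Metric.isOpen_ball.mem_nhds hp.2)
  set s := Metric.ball p (min δ (ε / 2)) with hs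
  have hsB : s ⊆ Metric.closedBall x₀ (ρ / 2) :=
    ((Metric.ball_subset_ball (min_le_left _ _)).trans hδB).trans Metric.ball_subset_closedBall
  have hpos : 0 < volume (s ∩ Ωᶜ) := by
    rw [← Measure.restrict_apply Metric.isOpen_ball.measurableSet]
    exact (Measure.mem_support_iff_forall p).1 hp.1 _ (Metric.ball_mem_nhds _ (by positivity))
  have hpos2 : 0 < volume ((s ∩ Ωᶜ) ∩ (fun x => Φ (x, t)) ⁻¹' Ωᶜ) := by
    by_contra hcon
    have h3 : volume ((s ∩ Ωᶜ) ∩ (fun x => Φ (x, t)) ⁻¹' Ωᶜ) = 0 := by simpa using hcon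
    refine hpos.ne' (le_zero_iff.1 ?_)
    calc volume (s ∩ Ωᶜ) ≤ volume (((Metric.closedBall x₀ (ρ / 2) ∩ Ωᶜ) ∩
          (fun x => Φ (x, t)) ⁻¹' Ω) ∪ ((s ∩ Ωᶜ) ∩ (fun x => Φ (x, t)) ⁻¹' Ωᶜ)) := by
          refine measure_mono fun x hx => ?_
          by_cases hxΩ : Φ (x, t) ∈ Ω
          · exact Or.inl ⟨⟨hsB hx.1, hx.2⟩, hxΩ⟩
          · exact Or.inr ⟨hx, hxΩ⟩
      _ ≤ 0 := (measure_union_le _ _).trans (by rw [hz, h3, add_zero])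
  have h4 : (s ∩ Ωᶜ) ∩ (fun x => Φ (x, t)) ⁻¹' Ωᶜ ⊆
      Metric.closedBall x₀ (ρ / 2) ∩ (fun x => Φ (x, t)) ⁻¹' (Metric.ball (Φ (p, t)) ε ∩ Ωᶜ) := by
    intro x hx
    refine ⟨hsB hx.1.1, ?_, hx.2⟩
    have h5 := (h2 t ht x (hsB hx.1.1) p (Metric.ball_subset_closedBall hp.2)).1
    have h6 : dist x p < ε / 2 := (Metric.mem_ball.1 hx.1.1).trans_le (min_le_right _ _)
    change dist (Φ (x, t)) (Φ (p, t)) < ε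
    linarith
  have h7 := volume_preimage_le (f := fun x => Φ (x, t)) (B := Metric.closedBall x₀ (ρ / 2))
    (S := Metric.ball (Φ (p, t)) ε ∩ Ωᶜ) (K := 2)
    (fun x hx y hy => by simpa using (h2 t ht x hx y hy).2)
  have h8 := (hpos2.trans_le (measure_mono h4)).trans_le h7
  have h9 : 0 < volume (Metric.ball (Φ (p, t)) ε ∩ Ωᶜ) := by
    by_contra hcon
    have : volume (Metric.ball (Φ (p, t)) ε ∩ Ωᶜ) = 0 := by simpa using hcon
    simp [this] at h8
  rw [← Measure.restrict_apply Metric.isOpen_ball.measurableSet] at h9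
  exact h9.trans_le (measure_mono hεU)

end IsAdmissible

end XElliptic

namespace XElliptic

variable {N m : ℕ} {X : Fin m → E N → E N} {Ω : Set (E N)} {Q : ℝ}

/-- Otherwise the closure of Ω is exactly the open complement of the essential support of Ωᶜ. It is
then clopen, hence everything; Ωᶜ would be null and Ω would have infinite measure. -/
theorem exists_mem_closure_inter_support (hN : 2 ≤ N) (hne : Ω.Nonempty)
    (hfin : volume Ω < ⊤) : ∃ x₀, x₀ ∈ closure Ω ∧ x₀ ∈ (volume.restrict Ωᶜ).support := by
  have : Nonempty (Fin N) := ⟨⟨0, by omega⟩⟩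
  set F := (volume.restrict Ωᶜ : Measure (E N)).support with hF
  by_contra! hcon
  have hFo : IsOpen Fᶜ := Measure.isOpen_compl_support
  have h0 : volume (Fᶜ ∩ Ωᶜ) = 0 := by
    rw [← Measure.restrict_apply hFo.measurableSet]
    exact Measure.measure_compl_support
  have heq : closure Ω = Fᶜ := by
    refine subset_antisymm hcon fun x hx => ?_
    by_contra hxc
    have hO : IsOpen (Fᶜ ∩ (closure Ω)ᶜ) := hFo.inter isClosed_closure.isOpen_compl
    have := hO.measure_pos volume ⟨x, hx, hxc⟩
    refine this.ne' (measure_mono_null ?_ h0)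
    exact inter_subset_inter_right _ (compl_subset_compl.2 subset_closure)
  have hclopen : IsClopen (closure Ω) := ⟨isClosed_closure, heq ▸ hFo⟩
  have huniv := hclopen.eq_univ hne.closure
  have hFe : F = ∅ := by
    rw [huniv] at heq
    exact compl_univ_iff.1 heq.symm
  have hz : volume (Ωᶜ) = 0 := by
    have := Measure.support_eq_empty_iff.1 hFe
    simpa using this
  have htop : volume (univ : Set (E N)) = ⊤ := measure_univ_of_isAddLeftInvariant volume
  have : volume (univ : Set (E N)) ≤ volume Ω + volume Ωᶜ := by
    rw [← union_compl_self Ω]; exact measure_union_le _ _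
  rw [htop, hz, add_zero] at this
  exact absurd (top_le_iff.1 this) hfin.ne

namespace IsAdmissible

/-- Along a subunit path, the distance to a set to which the vector fields are tangent grows at most
exponentially. -/
theorem infDist_le_exp (hX : IsAdmissible X Ω Q)
    (H : ∀ n : ℕ, ∃ u : E N → ℝ, ContDiff ℝ 1 u ∧ HasCompactSupport u ∧ tsupport u ⊆ Ω ∧
      (n : ℝ≥0∞) * ∫⁻ x in Ω, ‖xGrad X u x‖ₑ < ∫⁻ x in Ω, ‖u x‖ₑ)
    {x₀ : E N} {ρ M : ℝ} {K : ℝ≥0} (hρ : 0 < ρ) (hM : 0 < M)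
    (hY : ∀ θ : Fin m → ℝ, ∑ j, θ j ^ 2 ≤ 1 →
      LipschitzOnWith K (fun y => ∑ j, θ j • X j y) (Metric.closedBall x₀ ρ) ∧
      ∀ y ∈ Metric.closedBall x₀ ρ, ‖∑ j, θ j • X j y‖ ≤ M)
    (hx₀ : x₀ ∈ (volume.restrict Ωᶜ).support) {T : ℝ} (hT : 0 ≤ T) {γ : ℝ → E N} {S : Set (E N)}
    (hγ : IsSubunitPath X S T γ) (hγB : ∀ t ∈ Icc 0 T, γ t ∈ Metric.ball x₀ (ρ / 4)) :
    Metric.infDist (γ T) (volume.restrict Ωᶜ).support ≤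
      Real.exp (K * T) * Metric.infDist (γ 0) (volume.restrict Ωᶜ).support := by
  set F := (volume.restrict Ωᶜ : Measure (E N)).support with hF
  have hFc : IsClosed F := Measure.isClosed_support
  have hFn : F.Nonempty := ⟨x₀, hx₀⟩
  have hAC := (Metric.lipschitz_infDist_pt F).comp_absolutelyContinuousOnInterval hγ.1
  refine hAC.le_exp_mul_of_deriv_le hT ?_
  filter_upwards [hγ.2.2, ae_restrict_mem measurableSet_Icc] with t ht htT c hc
  obtain ⟨θ, hθ, hd⟩ := ht
  -- Let the nearest point p of F move along the same combination θ as γ does at time t. It stays in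
  -- F up to O(s²), and the two velocities differ by at most K times the distance to F.
  obtain ⟨p, hpF, hp⟩ := hFc.exists_infDist_eq_dist hFn (γ t)
  have hγt := Metric.mem_ball.1 (hγB t htT)
  have hpd : dist (γ t) p ≤ dist (γ t) x₀ := hp ▸ Metric.infDist_le_dist_of_mem hx₀
  have hpB : p ∈ Metric.ball x₀ (ρ / 2) := by
    have := dist_triangle_left p x₀ (γ t)
    rw [Metric.mem_ball]
    linarith
  obtain ⟨h, hh, C, hq⟩ := hX.exists_mem_support_near H hθ hρ hM (hY θ hθ).1 (hY θ hθ).2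
  set v := ∑ j, θ j • X j (γ t) with hv
  set e : ℝ → ℝ := (fun z => Metric.infDist z F) ∘ γ with he
  have hvp : ‖v - ∑ j, θ j • X j p‖ ≤ K * e t := by
    rw [← dist_eq_norm]
    refine ((hY θ hθ).1.dist_le_mul _ ?_ _ ?_).trans_eq ?_
    · exact Metric.closedBall_subset_closedBall (by linarith) (Metric.mem_closedBall.2 hγt.le)
    · exact Metric.closedBall_subset_closedBall (by linarith) (Metric.ball_subset_closedBall hpB)
    · simp only [he, Function.comp_apply, hp]
  have hslope : ∀ s ∈ Ioo 0 h, s⁻¹ * (e (t + s) - e t) ≤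
      ‖s⁻¹ • (γ (t + s) - γ t) - v‖ + K * e t + C * s := by
    intro s hs
    obtain ⟨q, hqF, hqd⟩ := hq p ⟨hpF, hpB⟩ s ⟨hs.1.le, hs.2.le⟩
    have h1 : e (t + s) ≤ ‖γ (t + s) - q‖ := by
      rw [← dist_eq_norm]
      exact Metric.infDist_le_dist_of_mem hqF
    have h2 : γ (t + s) - q = s • (s⁻¹ • (γ (t + s) - γ t) - v) + (γ t - p) +
        s • (v - ∑ j, θ j • X j p) - (q - p - s • ∑ j, θ j • X j p) := by
      rw [smul_sub, smul_inv_smul₀ hs.1.ne', smul_sub]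
      abel
    have h3 : ‖γ (t + s) - q‖ ≤ s * ‖s⁻¹ • (γ (t + s) - γ t) - v‖ + e t + s * (K * e t) +
        C * s ^ 2 := by
      rw [h2]
      refine (norm_sub_le _ _).trans (add_le_add ?_ hqd)
      refine (norm_add_le _ _).trans (add_le_add ?_ ?_)
      · refine (norm_add_le _ _).trans (add_le_add ?_ ?_)
        · rw [norm_smul, Real.norm_of_nonneg hs.1.le]
        · rw [← dist_eq_norm, ← hp]; rfl
      · rw [norm_smul, Real.norm_of_nonneg hs.1.le]
        exact mul_le_mul_of_nonneg_left hvp hs.1.le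
    rw [inv_mul_le_iff₀ hs.1]
    linarith
  have hl1 : Tendsto (fun s : ℝ => s⁻¹ • (e (t + s) - e t)) (𝓝[>] 0) (𝓝 c) :=
    (hasDerivAt_iff_tendsto_slope_zero.1 hc).mono_left (nhdsWithin_mono _ fun s hs => ne_of_gt hs)
  have hl2 : Tendsto (fun s : ℝ => ‖s⁻¹ • (γ (t + s) - γ t) - v‖ + K * e t + C * s) (𝓝[>] 0)
      (𝓝 (‖v - v‖ + K * e t + C * 0)) := by
    have h4 : Tendsto (fun s : ℝ => s⁻¹ • (γ (t + s) - γ t)) (𝓝[>] 0) (𝓝 v) :=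
      (hasDerivAt_iff_tendsto_slope_zero.1 hd).mono_left
        (nhdsWithin_mono _ fun s hs => ne_of_gt hs)
    refine ((h4.sub_const v).norm.add_const _).add ?_
    exact (tendsto_const_nhds.mul tendsto_id).mono_left nhdsWithin_le_nhds
  have := le_of_tendsto_of_tendsto hl1 hl2 (by
    filter_upwards [Ioo_mem_nhdsGT hh] with s hs using hslope s hs)
  simpa using this

/-- Functions with compact support in `Ω` are controlled by their `X`-gradient in `L¹`. -/
theorem exists_lintegral_le (hN : 2 ≤ N) (hX : IsAdmissible X Ω Q) :
    ∃ K : ℝ≥0, ∀ u : E N → ℝ, ContDiff ℝ 1 u → HasCompactSupport u → tsupport u ⊆ Ω →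
      ∫⁻ x in Ω, ‖u x‖ₑ ≤ K * ∫⁻ x in Ω, ‖xGrad X u x‖ₑ := by
  rcases Ω.eq_empty_or_nonempty with rfl | hne
  · exact ⟨0, by simp⟩
  by_contra! hcon
  have H : ∀ n : ℕ, ∃ u : E N → ℝ, ContDiff ℝ 1 u ∧ HasCompactSupport u ∧ tsupport u ⊆ Ω ∧
      (n : ℝ≥0∞) * ∫⁻ x in Ω, ‖xGrad X u x‖ₑ < ∫⁻ x in Ω, ‖u x‖ₑ := fun n => by
    simpa using hcon n
  obtain ⟨x₀, hx₀c, hx₀⟩ := exists_mem_closure_inter_support hN hne hX.volume_lt_top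
  obtain ⟨ρ, M, K, hρ, hM, hY⟩ := hX.exists_lipschitz_bound x₀
  obtain ⟨D, hD, hDΩ⟩ := hX.exists_ccBall_eq
  obtain ⟨c, hc, hvol⟩ := hX.exists_mul_rpow_le_volume hne hD hDΩ
  set F := (volume.restrict Ωᶜ : Measure (E N)).support with hF
  have hFc : IsClosed F := Measure.isClosed_support
  -- Paths of time less than r from points within ρ/8 of x₀ stay within ρ/4 of x₀, where the
  -- tangency estimate is available; r ≤ D is needed for the volume lower bound.
  set r := min (ρ / (8 * M)) D with hr
  have hr0 : 0 < r := by positivity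
  have hrM : M * r ≤ ρ / 8 := by
    have : r ≤ ρ / (8 * M) := min_le_left _ _
    rw [le_div_iff₀ (by positivity)] at this
    linarith
  have hdisj : ∀ z ∈ Ω, z ∉ F := by
    intro z hz hzF
    have := (Measure.mem_support_iff_forall z).1 hzF Ω (hX.isOpen.mem_nhds hz)
    rw [Measure.restrict_apply hX.isOpen.measurableSet] at this
    simp at this
  have key : ∀ ε, 0 < ε → ε < ρ / 8 → ∃ y ∈ Ω,
      ccBall X Ω y r ⊆ {z | z ∈ Ω ∧ Metric.infDist z F ≤ Real.exp (K * r) * ε} := by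
    intro ε hε hερ
    obtain ⟨y, hyΩ, hy⟩ := Metric.mem_closure_iff.1 hx₀c ε hε
    refine ⟨y, hyΩ, fun z hz => ⟨hz.1, ?_⟩⟩
    obtain ⟨T, hT, hTr, γ, hγ, h0, h1⟩ := hX.connected.exists_of_ccDist_lt hyΩ hz.1 hz.2
    have hMT : M * T < ρ / 8 := (mul_lt_mul_of_pos_left hTr hM).trans_le hrM
    have hball : ∀ t ∈ Icc 0 T, γ t ∈ Metric.ball x₀ (ρ / 4) := by
      intro t ht
      have h2 := hγ.mem_ball (M := M) (R := ρ / 8) (fun w hw θ hθ => (hY θ hθ).2 w ?_) hMT hM.le ht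
      · rw [h0] at h2
        rw [Metric.mem_ball] at h2 ⊢
        have := dist_triangle (γ t) y x₀
        rw [dist_comm y x₀] at this
        linarith
      · rw [h0] at hw
        rw [Metric.mem_closedBall] at hw ⊢
        have := dist_triangle w y x₀
        rw [dist_comm y x₀] at this
        linarith
    have h3 := hX.infDist_le_exp H hρ hM hY hx₀ hT.le hγ hball
    rw [h0, h1] at h3
    refine h3.trans ?_
    have h4 : Metric.infDist y F ≤ ε :=
      (Metric.infDist_le_dist_of_mem hx₀).trans (by rw [dist_comm]; exact hy.le)
    exact mul_le_mul (Real.exp_le_exp.2 (by gcongr)) h4 Metric.infDist_nonneg (Real.exp_pos _).le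
  -- These layers of Ω shrink to the empty set, because F is closed and disjoint from the open set
  -- Ω; finiteness of |Ω| then sends their measures to 0.
  set A : ℕ → Set (E N) := fun n =>
    {z | z ∈ Ω ∧ Metric.infDist z F ≤ Real.exp (K * r) * (1 / ((n : ℝ) + 1))} with hA
  have hAm : ∀ n, MeasurableSet (A n) := fun n =>
    hX.isOpen.measurableSet.inter
      (isClosed_le (Metric.continuous_infDist_pt F) continuous_const).measurableSet
  have hAanti : Antitone A := fun i j hij z hz => ⟨hz.1, hz.2.trans (by gcongr)⟩
  have hlim := tendsto_measure_iInter_atTop (μ := volume) (fun n => (hAm n).nullMeasurableSet)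
    hAanti ⟨0, ((measure_mono fun z hz => hz.1).trans_lt hX.volume_lt_top).ne⟩
  have hAe : ⋂ n, A n = ∅ := by
    rw [eq_empty_iff_forall_notMem]
    intro z hz
    have hzΩ : z ∈ Ω := (mem_iInter.1 hz 0).1
    have hle : ∀ n : ℕ, Metric.infDist z F ≤ Real.exp (K * r) * (1 / ((n : ℝ) + 1)) :=
      fun n => (mem_iInter.1 hz n).2
    have h0 : Metric.infDist z F ≤ Real.exp (K * r) * 0 :=
      ge_of_tendsto' (tendsto_const_nhds.mul tendsto_one_div_add_atTop_nhds_zero_nat) hle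
    rw [mul_zero] at h0
    refine hdisj z hzΩ ((hFc.mem_iff_infDist_zero ⟨x₀, hx₀⟩).2 ?_)
    exact le_antisymm h0 Metric.infDist_nonneg
  rw [hAe, measure_empty] at hlim
  have hpos : (0 : ℝ≥0∞) < ENNReal.ofReal (c * r ^ Q) := ENNReal.ofReal_pos.2 (by positivity)
  have h5 := (hlim.eventually_lt_const hpos).and
    ((tendsto_one_div_add_atTop_nhds_zero_nat (𝕜 := ℝ)).eventually_lt_const
      (show (0 : ℝ) < ρ / 8 by positivity))
  obtain ⟨n, hn1, hn2⟩ := h5.exists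
  obtain ⟨y, hyΩ, hy⟩ := key (1 / ((n : ℝ) + 1)) (by positivity) hn2
  have h6 := hvol y hyΩ r hr0 (min_le_right _ _)
  have h7 : ENNReal.ofReal (c * r ^ Q) ≤ volume (ccBall X Ω y r) := by
    rw [← ENNReal.ofReal_toReal (hX.volume_ccBall_lt_top y r).ne]
    exact ENNReal.ofReal_le_ofReal h6
  exact absurd (h7.trans (measure_mono hy)) (not_le.2 hn1)

end IsAdmissible

end XElliptic

/-! ### Telescoping averages, Vitali covering and the weak type Sobolev inequality -/

theorem sum_dyadic_le {D ρ : ℝ} (hρ : 0 < ρ) (n : ℕ) :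
    ∑ i ∈ Finset.range n, (if D / 2 ^ i ≤ ρ then D / 2 ^ i else 0) ≤ 2 * ρ := by
  -- The bound is sharpened by the remaining tail of the geometric series so that induction on n
  -- closes; negative D makes every term nonpositive.
  suffices h : ∑ i ∈ Finset.range n, (if D / 2 ^ i ≤ ρ then D / 2 ^ i else 0) ≤
      2 * ρ - 2 * min ρ (D / 2 ^ n) ∨ D < 0 by
    rcases h with h | h
    · by_cases hD : 0 ≤ D
      · have : 0 ≤ min ρ (D / 2 ^ n) := by positivity
        linarith
      · refine (Finset.sum_nonpos fun i _ => ?_).trans (by positivity)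
        push Not at hD
        split_ifs
        · exact (div_neg_of_neg_of_pos hD (by positivity)).le
        · exact le_rfl
    · refine (Finset.sum_nonpos fun i _ => ?_).trans (by positivity)
      split_ifs
      · exact (div_neg_of_neg_of_pos h (by positivity)).le
      · exact le_rfl
  by_cases hD : D < 0
  · exact Or.inr hD
  left
  push Not at hD
  induction n with
  | zero =>
    simp only [Finset.range_zero, Finset.sum_empty]
    linarith [min_le_left ρ (D / 2 ^ 0)]
  | succ n ih =>
    rw [Finset.sum_range_succ]
    have h2 : D / 2 ^ (n + 1) = D / 2 ^ n / 2 := by rw [pow_succ, div_div]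
    have h0 : 0 ≤ D / 2 ^ n := by positivity
    split_ifs with h
    · rw [min_eq_right h] at ih
      rw [h2, min_eq_right (by linarith)]
      linarith
    · push Not at h
      rw [min_eq_left h.le] at ih
      have := min_le_left ρ (D / 2 ^ (n + 1))
      linarith

theorem sum_dyadic_rpow_le {D ρ a : ℝ} (hD : 0 < D) (hρ : 0 < ρ) (ha : 0 < a) (n : ℕ) :
    ∑ i ∈ Finset.range n, (if D / 2 ^ i ≤ ρ then 0 else (D / 2 ^ i) ^ (-a)) ≤
      (1 - 2 ^ (-a))⁻¹ * ρ ^ (-a) := by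
  have h1 : (2 : ℝ) ^ (-a) < 1 := Real.rpow_lt_one_of_one_lt_of_neg one_lt_two (by linarith)
  have h2 : 0 < 1 - (2 : ℝ) ^ (-a) := by linarith
  set κ := (1 - (2 : ℝ) ^ (-a))⁻¹ with hκ
  have hκ0 : 0 < κ := by positivity
  have hκ1 : κ * 2 ^ (-a) + 1 = κ := by
    rw [hκ]; field_simp; ring
  -- The induction follows the last radius exceeding ρ: it dominates the sum, since κ solves κ
  -- 2^{-a} + 1 = κ.
  suffices h : ∑ i ∈ Finset.range n, (if D / 2 ^ i ≤ ρ then 0 else (D / 2 ^ i) ^ (-a)) ≤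
      κ * (max ρ (2 * (D / 2 ^ n))) ^ (-a) by
    refine h.trans (mul_le_mul_of_nonneg_left ?_ hκ0.le)
    exact Real.rpow_le_rpow_of_nonpos hρ (le_max_left _ _) (by linarith)
  induction n with
  | zero => simp only [Finset.range_zero, Finset.sum_empty]; positivity
  | succ n ih =>
    rw [Finset.sum_range_succ]
    have h3 : 2 * (D / 2 ^ (n + 1)) = D / 2 ^ n := by rw [pow_succ]; field_simp
    have h0 : 0 < D / 2 ^ n := by positivity
    rw [h3]
    split_ifs with h
    · rw [max_eq_left h, add_zero]
      refine ih.trans (mul_le_mul_of_nonneg_left ?_ hκ0.le)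
      exact Real.rpow_le_rpow_of_nonpos hρ (le_max_left _ _) (by linarith)
    · push Not at h
      rw [max_eq_right h.le]
      rw [max_eq_right (by linarith), Real.mul_rpow two_pos.le h0.le] at ih
      have e : κ * (2 ^ (-a) * (D / 2 ^ n) ^ (-a)) + (D / 2 ^ n) ^ (-a) = κ * (D / 2 ^ n) ^ (-a) := by
        linear_combination (D / 2 ^ n) ^ (-a) * hκ1
      linarith

namespace XElliptic

variable {N m : ℕ} {X : Fin m → E N → E N} {Ω : Set (E N)} {Q : ℝ}

/-- Cauchy–Schwarz against 1, read off from ∫(g - a)² ≥ 0 at the mean a = I/V. -/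
theorem sq_setIntegral_le {α : Type*} [MeasurableSpace α] {μ : Measure α} [IsFiniteMeasure μ]
    {g : α → ℝ} (h1 : Integrable g μ) (h2 : Integrable (fun x => g x ^ 2) μ) :
    (∫ x, g x ∂μ) ^ 2 ≤ μ.real univ * ∫ x, g x ^ 2 ∂μ := by
  set I := ∫ x, g x ∂μ
  set V := μ.real univ
  have h3 : ∀ a : ℝ, 0 ≤ ∫ x, g x ^ 2 ∂μ - 2 * a * I + a ^ 2 * V := by
    intro a
    have : ∫ x, (g x - a) ^ 2 ∂μ = ∫ x, g x ^ 2 ∂μ - 2 * a * I + a ^ 2 * V := by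
      have e : ∀ x, (g x - a) ^ 2 = g x ^ 2 - 2 * a * g x + a ^ 2 := fun x => by ring
      simp_rw [e]
      have e1 : ∫ x, (g x ^ 2 - 2 * a * g x + a ^ 2) ∂μ =
          ∫ x, (g x ^ 2 - 2 * a * g x) ∂μ + ∫ _, a ^ 2 ∂μ :=
        integral_add (h2.sub (h1.const_mul _)) (integrable_const _)
      rw [e1, integral_sub h2 (h1.const_mul _), integral_const_mul, integral_const, smul_eq_mul]
      ring
    rw [← this]
    exact integral_nonneg fun x => sq_nonneg _
  rcases (measureReal_nonneg : 0 ≤ V).eq_or_lt with hV | hV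
  · have hμ : μ = 0 := by
      have : μ.real univ = 0 := hV.symm
      rwa [measureReal_eq_zero_iff, Measure.measure_univ_eq_zero] at this
    have hI : I = 0 := by simp only [I, hμ, integral_zero_measure]
    rw [hI, show V = 0 from hV.symm]
    simp
  · have := h3 (I / V)
    have e : ∫ x, g x ^ 2 ∂μ - 2 * (I / V) * I + (I / V) ^ 2 * V =
        ∫ x, g x ^ 2 ∂μ - I ^ 2 / V := by field_simp; ring
    rw [e, sub_nonneg, div_le_iff₀ hV] at this
    linarith

namespace IsAdmissible

theorem integrable_xGrad_sq (hX : IsAdmissible X Ω Q) {u : E N → ℝ} (hu : ContDiff ℝ 1 u)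
    (hc : HasCompactSupport u) : Integrable (fun y => ‖xGrad X u y‖ ^ 2) := by
  refine ((continuous_xGrad hX.continuous_field hu).norm.pow 2).integrable_of_hasCompactSupport ?_
  refine (hasCompactSupport_xGrad (X := X) hc).mono fun x hx h0 => hx ?_
  simp [h0]

/-- Averages over balls of radius `D / 2 ^ i` converge to the value at the centre. -/
theorem tendsto_average (hX : IsAdmissible X Ω Q) {D : ℝ} (hD : 0 < D) {x : E N} (hx : x ∈ Ω)
    {u : E N → ℝ} (hu : Continuous u) (hc : HasCompactSupport u) :
    Tendsto (fun i : ℕ => ⨍ z in ccBall X Ω x (D / 2 ^ i), u z) atTop (𝓝 (u x)) := by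
  rw [Metric.tendsto_atTop]
  intro ε hε
  obtain ⟨R, hR, hRu⟩ := Metric.continuousAt_iff.1 hu.continuousAt (ε / 2) (half_pos hε)
  obtain ⟨δ, hδ, hδB⟩ := hX.exists_ccBall_subset_ball hx hR
  obtain ⟨n, hn⟩ := pow_unbounded_of_one_lt (D / δ) (one_lt_two (α := ℝ))
  refine ⟨n, fun i hi => ?_⟩
  have hri : D / 2 ^ i ≤ δ := by
    rw [div_lt_iff₀ hδ] at hn
    rw [div_le_iff₀ (by positivity)]
    have : (2 : ℝ) ^ n ≤ 2 ^ i := pow_le_pow_right₀ one_le_two hi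
    nlinarith
  have hr0 : 0 < D / 2 ^ i := by positivity
  set B := ccBall X Ω x (D / 2 ^ i) with hB
  have hm := hX.volume_real_ccBall_pos hx hr0
  have hfin : IsFiniteMeasure (volume.restrict B) :=
    ⟨by simpa using hX.volume_ccBall_lt_top x (D / 2 ^ i)⟩
  have hint : IntegrableOn u B := (hu.integrable_of_hasCompactSupport hc).integrableOn
  have h1 : (⨍ z in B, u z) - u x = (volume.real B)⁻¹ * ∫ z in B, (u z - u x) := by
    rw [integral_sub hint (integrable_const _), setAverage_eq, integral_const, smul_eq_mul,
      smul_eq_mul, mul_sub, measureReal_restrict_apply_univ, inv_mul_cancel_left₀ hm.ne']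
  have h2 : ‖∫ z in B, (u z - u x)‖ ≤ ε / 2 * volume.real B := by
    refine norm_setIntegral_le_of_norm_le_const (hX.volume_ccBall_lt_top x _) fun z hz => ?_
    exact (hRu (hδB (ccBall_mono hri hz))).le
  rw [Real.dist_eq, h1, abs_mul, abs_of_pos (inv_pos.2 hm), inv_mul_lt_iff₀ hm]
  rw [Real.norm_eq_abs] at h2
  nlinarith

/-- Telescoping estimate between two consecutive averages. -/
theorem exists_average_sub_le (hX : IsAdmissible X Ω Q) :
    ∃ C : ℝ, 0 < C ∧ ∃ l : ℕ, ∀ x ∈ Ω, ∀ r, 0 < r → ∀ u : E N → ℝ, ContDiff ℝ 1 u →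
      HasCompactSupport u →
      |(⨍ z in ccBall X Ω x (r / 2), u z) - ⨍ z in ccBall X Ω x r, u z| ≤
        C * (r * √((∫ y in ccBall X Ω x (2 ^ l * r), ‖xGrad X u y‖ ^ 2) /
          volume.real (ccBall X Ω x (2 ^ l * r)))) := by
  obtain ⟨C, hC, l, h⟩ := hX.exists_poincare
  refine ⟨C * (2 ^ Q) ^ (l + 1), by positivity, l, fun x hx r hr u hu hc => ?_⟩
  have h1 := h x hx r hr u hu hc
  set B := ccBall X Ω x r with hB
  set B' := ccBall X Ω x (r / 2) with hB'
  set B'' := ccBall X Ω x (2 ^ l * r) with hB''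
  set a := ⨍ z in B, u z with ha
  have hm' : 0 < volume.real B' := hX.volume_real_ccBall_pos hx (by positivity)
  have hm'' : 0 < volume.real B'' := hX.volume_real_ccBall_pos hx (by positivity)
  have hf : ∀ s, IsFiniteMeasure (volume.restrict (ccBall X Ω x s)) := fun s =>
    ⟨by simpa using hX.volume_ccBall_lt_top x s⟩
  have hf1 := hf r
  have hf2 := hf (r / 2)
  have hf3 := hf (2 ^ l * r)
  have hint : Integrable u := hu.continuous.integrable_of_hasCompactSupport hc
  have e1 : (⨍ z in B', u z) - a = (volume.real B')⁻¹ * ∫ z in B', (u z - a) := by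
    rw [integral_sub hint.integrableOn (integrable_const _), setAverage_eq, integral_const,
      smul_eq_mul, smul_eq_mul, mul_sub, measureReal_restrict_apply_univ,
      inv_mul_cancel_left₀ hm'.ne']
  have e2 : |∫ z in B', (u z - a)| ≤ ∫ z in B, |u z - a| := by
    refine (abs_integral_le_integral_abs).trans ?_
    refine setIntegral_mono_set ?_ (Eventually.of_forall fun _ => abs_nonneg _)
      (ccBall_mono (by linarith)).eventuallyLE
    exact (hint.integrableOn.sub (integrable_const _)).abs
  have e3 : (∫ y in B'', ‖xGrad X u y‖) ^ 2 ≤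
      volume.real B'' * ∫ y in B'', ‖xGrad X u y‖ ^ 2 := by
    have := sq_setIntegral_le (hX.integrable_xGrad hu hc).norm.integrableOn
      ((hX.integrable_xGrad_sq hu hc).integrableOn (s := B''))
    rwa [measureReal_restrict_apply_univ] at this
  have e4 : ∫ y in B'', ‖xGrad X u y‖ ≤ volume.real B'' *
      √((∫ y in B'', ‖xGrad X u y‖ ^ 2) / volume.real B'') := by
    refine Real.le_sqrt_of_sq_le e3 |>.trans_eq ?_
    set J := ∫ y in B'', ‖xGrad X u y‖ ^ 2
    have : volume.real B'' * J = volume.real B'' ^ 2 * (J / volume.real B'') := by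
      field_simp
    rw [this, Real.sqrt_mul (by positivity), Real.sqrt_sq hm''.le]
  have e5 : volume.real B'' ≤ (2 ^ Q) ^ (l + 1) * volume.real B' := by
    have := hX.volume_real_ccBall_two_pow_le hx (half_pos hr) (l + 1)
    have e : (2 : ℝ) ^ (l + 1) * (r / 2) = 2 ^ l * r := by ring
    rwa [e] at this
  rw [e1, abs_mul, abs_of_pos (inv_pos.2 hm'), inv_mul_le_iff₀ hm']
  set s := √((∫ y in B'', ‖xGrad X u y‖ ^ 2) / volume.real B'')
  have hs : 0 ≤ s := Real.sqrt_nonneg _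
  calc |∫ z in B', (u z - a)| ≤ C * r * ∫ y in B'', ‖xGrad X u y‖ := e2.trans h1
    _ ≤ C * r * (volume.real B'' * s) := by gcongr
    _ ≤ C * r * (((2 ^ Q) ^ (l + 1) * volume.real B') * s) := by gcongr
    _ = _ := by ring

end IsAdmissible

end XElliptic

namespace XElliptic

variable {N m : ℕ} {X : Fin m → E N → E N} {Ω : Set (E N)} {Q : ℝ}

namespace IsAdmissible

/-- Pointwise bound of `u - u_Ω` by the averages of `|X u|²` over small balls. -/
theorem exists_abs_sub_average_le (hX : IsAdmissible X Ω Q) (hΩ : Ω.Nonempty) :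
    ∃ C : ℝ, 0 < C ∧ ∃ l : ℕ, ∃ D : ℝ, 0 < D ∧ ∀ u : E N → ℝ, ContDiff ℝ 1 u →
      HasCompactSupport u → ∀ x ∈ Ω, ∀ ρ τ : ℝ, 0 < ρ → 0 ≤ τ →
      (∀ r, 0 < r → r ≤ ρ → r ≤ D → ∫ y in ccBall X Ω x (2 ^ l * r), ‖xGrad X u y‖ ^ 2 ≤
        τ ^ 2 * volume.real (ccBall X Ω x (2 ^ l * r))) →
      |u x - ⨍ z in Ω, u z| ≤
        C * (ρ * τ + √(∫ y in Ω, ‖xGrad X u y‖ ^ 2) * ρ ^ (-(Q / 2 - 1))) := by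
  obtain ⟨D, hD, hDΩ⟩ := hX.exists_ccBall_eq
  obtain ⟨c, hc, hvol⟩ := hX.exists_mul_rpow_le_volume hΩ hD hDΩ
  obtain ⟨C, hC, l, h⟩ := hX.exists_average_sub_le
  have ha : 0 < Q / 2 - 1 := by linarith [hX.two_lt]
  set a := Q / 2 - 1 with ha'
  set κ := (1 - (2 : ℝ) ^ (-a))⁻¹ with hκ
  have hκ0 : 0 < κ := by
    have h1 : (2 : ℝ) ^ (-a) < 1 := Real.rpow_lt_one_of_one_lt_of_neg one_lt_two (by linarith)
    exact inv_pos.2 (by linarith)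
  have hsc : 0 < √c := Real.sqrt_pos.2 hc
  refine ⟨C * (2 + κ / √c), by positivity, l, D, hD, fun u hu hcs x hx ρ τ hρ hτ hsmall => ?_⟩
  set S := √(∫ y in Ω, ‖xGrad X u y‖ ^ 2) with hS
  have hS0 : 0 ≤ S := Real.sqrt_nonneg _
  set A : ℕ → ℝ := fun i => ⨍ z in ccBall X Ω x (D / 2 ^ i), u z with hA
  have hA0 : A 0 = ⨍ z in Ω, u z := by
    simp only [hA, pow_zero, div_one]
    rw [hDΩ x hx D le_rfl]
  have hlim : Tendsto A atTop (𝓝 (u x)) := hX.tendsto_average hD hx hu.continuous hcs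
  -- Hedberg's splitting at scale ρ. Below it the averaged energy is at most τ²; above it the total
  -- energy is divided by |B_r| ≥ c r^Q, which leaves r^{1-Q/2}, summable over large radii because Q
  -- > 2.
  have hterm : ∀ i, |A (i + 1) - A i| ≤ C * (τ * (if D / 2 ^ i ≤ ρ then D / 2 ^ i else 0) +
      S / √c * (if D / 2 ^ i ≤ ρ then 0 else (D / 2 ^ i) ^ (-a))) := by
    intro i
    have hr : 0 < D / 2 ^ i := by positivity
    have hrD : D / 2 ^ i ≤ D := div_le_self hD.le (one_le_pow₀ one_le_two)
    have h1 := h x hx _ hr u hu hcs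
    have e : D / 2 ^ i / 2 = D / 2 ^ (i + 1) := by rw [pow_succ, div_div]
    rw [e] at h1
    refine h1.trans (mul_le_mul_of_nonneg_left ?_ hC.le)
    set r := D / 2 ^ i with hr'
    have hm : 0 < volume.real (ccBall X Ω x (2 ^ l * r)) :=
      hX.volume_real_ccBall_pos hx (by positivity)
    split_ifs with hi
    · rw [mul_zero, add_zero, mul_comm]
      refine mul_le_mul_of_nonneg_right ?_ hr.le
      refine Real.sqrt_le_iff.2 ⟨hτ, ?_⟩
      rw [div_le_iff₀ hm]
      exact hsmall r hr hi hrD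
    · rw [mul_zero, zero_add]
      have h2 : √((∫ y in ccBall X Ω x (2 ^ l * r), ‖xGrad X u y‖ ^ 2) /
          volume.real (ccBall X Ω x (2 ^ l * r))) ≤ S / (√c * r ^ (Q / 2)) := by
        have h3 : c * r ^ Q ≤ volume.real (ccBall X Ω x (2 ^ l * r)) :=
          (hvol x hx r hr hrD).trans (hX.volume_real_ccBall_mono
            (le_mul_of_one_le_left hr.le (one_le_pow₀ one_le_two)))
        have h4 : ∫ y in ccBall X Ω x (2 ^ l * r), ‖xGrad X u y‖ ^ 2 ≤
            ∫ y in Ω, ‖xGrad X u y‖ ^ 2 :=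
          setIntegral_mono_set (hX.integrable_xGrad_sq hu hcs).integrableOn
            (Eventually.of_forall fun _ => by positivity) ccBall_subset.eventuallyLE
        have h5 : S / (√c * r ^ (Q / 2)) = √((∫ y in Ω, ‖xGrad X u y‖ ^ 2) / (c * r ^ Q)) := by
          rw [Real.sqrt_div' _ (by positivity), Real.sqrt_mul hc.le]
          congr 2
          rw [← Real.sqrt_sq (show 0 ≤ r ^ (Q / 2) by positivity), ← Real.rpow_natCast,
            ← Real.rpow_mul hr.le]
          norm_num
        rw [h5]
        refine Real.sqrt_le_sqrt ?_
        refine div_le_div₀ ?_ h4 (by positivity) h3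
        exact integral_nonneg fun _ => by positivity
      calc r * √((∫ y in ccBall X Ω x (2 ^ l * r), ‖xGrad X u y‖ ^ 2) /
          volume.real (ccBall X Ω x (2 ^ l * r))) ≤ r * (S / (√c * r ^ (Q / 2))) := by gcongr
        _ = S / √c * (r ^ (1 : ℝ) / r ^ (Q / 2)) := by rw [Real.rpow_one]; field_simp
        _ = S / √c * r ^ (-a) := by
          rw [← Real.rpow_sub hr]
          congr 2
          rw [ha']; ring
  have hsum : ∀ n, |A n - A 0| ≤ C * (2 + κ / √c) * (ρ * τ + S * ρ ^ (-a)) := by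
    intro n
    rw [← Finset.sum_range_sub]
    refine (Finset.abs_sum_le_sum_abs _ _).trans ((Finset.sum_le_sum fun i _ => hterm i).trans ?_)
    rw [← Finset.mul_sum, Finset.sum_add_distrib, ← Finset.mul_sum, ← Finset.mul_sum, mul_assoc]
    refine mul_le_mul_of_nonneg_left ?_ hC.le
    have h1 := sum_dyadic_le (D := D) hρ n
    have h2 := sum_dyadic_rpow_le hD hρ ha n
    rw [← hκ] at h2
    have hP : 0 ≤ ρ ^ (-a) := by positivity
    calc _ ≤ τ * (2 * ρ) + S / √c * (κ * ρ ^ (-a)) := by gcongr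
      _ ≤ τ * (2 * ρ) + S / √c * (κ * ρ ^ (-a)) + (κ / √c * (ρ * τ) + 2 * (S * ρ ^ (-a))) := by
        have : 0 ≤ κ / √c * (ρ * τ) + 2 * (S * ρ ^ (-a)) := by positivity
        linarith
      _ = (2 + κ / √c) * (ρ * τ + S * ρ ^ (-a)) := by ring
  rw [← hA0]
  exact le_of_tendsto ((hlim.sub_const (A 0)).abs) (Eventually.of_forall hsum)

/-- Covering estimate for the set where averages of `|X u|²` are large. -/
theorem volume_le_of_large_average (hX : IsAdmissible X Ω Q) {g : E N → ℝ} (hg : Integrable g)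
    (hg0 : ∀ x, 0 ≤ g x) {Z : Set (E N)} (hZ : Z ⊆ Ω) {l : ℕ} {D τ : ℝ} (hτ : 0 < τ)
    (hlarge : ∀ x ∈ Z, ∃ r, 0 < r ∧ r ≤ D ∧ τ * volume.real (ccBall X Ω x (2 ^ l * r)) ≤
      ∫ y in ccBall X Ω x (2 ^ l * r), g y) :
    volume Z ≤ ENNReal.ofReal (2 ^ Q) ^ 2 * ENNReal.ofReal (τ⁻¹ * ∫ y in Ω, g y) := by
  choose! r hr0 hrD hr using hlarge
  set B : E N → Set (E N) := fun x => ccBall X Ω x (2 ^ l * r x) with hB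
  obtain ⟨U, hUZ, hUd, hUcov⟩ := Vitali.exists_disjoint_subfamily_covering_enlargement B Z
    (fun x => 2 ^ l * r x) 2 one_lt_two (fun x hx => by have := hr0 x hx; positivity) (2 ^ l * D)
    (fun x hx => by have := hrD x hx; gcongr) (fun x hx => ⟨x, mem_ccBall_self (hZ hx) (by
      have := hr0 x hx; positivity)⟩)
  have hUc : U.Countable := hUd.countable_of_isOpen
    (fun x hx => hX.isOpen_ccBall (hZ (hUZ hx)) _) fun x hx => ⟨x, mem_ccBall_self (hZ (hUZ hx)) (by
      have := hr0 x (hUZ hx); positivity)⟩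
  -- Only centres have to be covered. If B_x meets the selected B_b and its radius is at most twice
  -- that of B_b, then x is within three radii of b, so two doublings suffice.
  have hcov : Z ⊆ ⋃ b ∈ U, ccBall X Ω b (2 ^ 2 * (2 ^ l * r b)) := by
    intro x hx
    obtain ⟨b, hb, ⟨y, hy1, hy2⟩, hle⟩ := hUcov x hx
    refine mem_iUnion₂.2 ⟨b, hb, hZ hx, ?_⟩
    have h1 := hX.connected.ccDist_triangle (hZ (hUZ hb)) hy1.1 (hZ hx)
    rw [ccDist_comm y x] at h1
    have h2 := hy1.2
    have h3 := hy2.2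
    have h4 : 0 < 2 ^ l * r b := by have := hr0 b (hUZ hb); positivity
    linarith
  have hball : ∀ b ∈ U, volume (ccBall X Ω b (2 ^ 2 * (2 ^ l * r b))) ≤
      ENNReal.ofReal (2 ^ Q) ^ 2 * (ENNReal.ofReal τ⁻¹ * ∫⁻ y in B b, ENNReal.ofReal (g y)) := by
    intro b hb
    have hbΩ := hZ (hUZ hb)
    have h4 : 0 < 2 ^ l * r b := by have := hr0 b (hUZ hb); positivity
    refine (hX.volume_ccBall_two_pow_le hbΩ h4 2).trans ?_
    gcongr
    rw [← ofReal_integral_eq_lintegral_ofReal hg.integrableOn (Eventually.of_forall hg0),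
      ← ENNReal.ofReal_mul (by positivity),
      ← ENNReal.ofReal_toReal (hX.volume_ccBall_lt_top b _).ne]
    refine ENNReal.ofReal_le_ofReal ?_
    rw [le_inv_mul_iff₀ hτ]
    exact hr b (hUZ hb)
  calc volume Z ≤ ∑' b : U, volume (ccBall X Ω b (2 ^ 2 * (2 ^ l * r b))) :=
        (measure_mono hcov).trans (measure_biUnion_le _ hUc _)
    _ ≤ ∑' b : U, ENNReal.ofReal (2 ^ Q) ^ 2 *
          (ENNReal.ofReal τ⁻¹ * ∫⁻ y in B b, ENNReal.ofReal (g y)) :=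
        ENNReal.tsum_le_tsum fun b => hball b b.2
    _ = ENNReal.ofReal (2 ^ Q) ^ 2 * (ENNReal.ofReal τ⁻¹ *
          ∑' b : U, ∫⁻ y in B b, ENNReal.ofReal (g y)) := by
        rw [ENNReal.tsum_mul_left, ENNReal.tsum_mul_left]
    _ = ENNReal.ofReal (2 ^ Q) ^ 2 * (ENNReal.ofReal τ⁻¹ *
          ∫⁻ y in ⋃ b ∈ U, B b, ENNReal.ofReal (g y)) := by
        rw [lintegral_biUnion hUc
          (fun b hb => (hX.isOpen_ccBall (hZ (hUZ hb)) _).measurableSet) hUd]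
    _ ≤ ENNReal.ofReal (2 ^ Q) ^ 2 * (ENNReal.ofReal τ⁻¹ * ∫⁻ y in Ω, ENNReal.ofReal (g y)) := by
        gcongr
        exact iUnion₂_subset fun b _ => ccBall_subset
    _ = _ := by
        rw [← ofReal_integral_eq_lintegral_ofReal hg.integrableOn (Eventually.of_forall hg0),
          ← ENNReal.ofReal_mul (by positivity)]

/-- Weak type Sobolev inequality for smooth functions with compact support. -/
theorem exists_weak_sobolev_smooth (hN : 2 ≤ N) (hX : IsAdmissible X Ω Q) :
    ∃ C : ℝ, 0 < C ∧ ∀ u : E N → ℝ, ContDiff ℝ 1 u → HasCompactSupport u → tsupport u ⊆ Ω →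
      ∀ t, 0 < t → volume (Ω ∩ {x | t < |u x|}) ≤
        ENNReal.ofReal (C * (√(∫ y in Ω, ‖xGrad X u y‖ ^ 2) / t) ^ (2 * Q / (Q - 2))) := by
  rcases Ω.eq_empty_or_nonempty with rfl | hΩ
  · exact ⟨1, one_pos, by simp⟩
  obtain ⟨C, hC, l, D, hD, hptw⟩ := hX.exists_abs_sub_average_le hΩ
  obtain ⟨K, hK⟩ := hX.exists_lintegral_le hN
  have hQ := hX.two_lt
  have ha : 0 < Q / 2 - 1 := by linarith
  set a := Q / 2 - 1 with ha'
  have hΩm : IsFiniteMeasure (volume.restrict Ω) := ⟨by simpa using hX.volume_lt_top⟩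
  set V := volume.real Ω with hV
  have hVpos : 0 < V := by
    refine ENNReal.toReal_pos ?_ hX.volume_lt_top.ne
    exact (hX.isOpen.measure_pos volume hΩ).ne'
  set s := 2 * Q / (Q - 2) with hs
  have hs0 : 0 < s := by have : 0 < Q - 2 := by linarith
                         positivity
  have hsa : s = 2 + 2 / a := by
    have : Q - 2 ≠ 0 := by linarith
    rw [hs, ha']
    field_simp
    ring
  set C₄ := K / √V + 1 with hC₄
  have hC₄0 : 0 < C₄ := by positivity
  set C₅ : ℝ := (2 ^ Q) ^ 2 * ((8 * C) ^ 2 * (4 * C) ^ (2 / a)) with hC₅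
  refine ⟨C₅ + V * (2 * C₄) ^ s, by positivity, fun u hu hcs hsub t ht => ?_⟩
  set S := √(∫ y in Ω, ‖xGrad X u y‖ ^ 2) with hS
  have hS0 : 0 ≤ S := Real.sqrt_nonneg _
  have hSsq : S ^ 2 = ∫ y in Ω, ‖xGrad X u y‖ ^ 2 :=
    Real.sq_sqrt (integral_nonneg fun _ => by positivity)
  have hint : IntegrableOn u Ω := (hu.continuous.integrable_of_hasCompactSupport hcs).integrableOn
  have hintX : IntegrableOn (xGrad X u) Ω := (hX.integrable_xGrad hu hcs).integrableOn
  have hL1 : ∫ x in Ω, ‖u x‖ ≤ K * ∫ x in Ω, ‖xGrad X u x‖ := by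
    have := hK u hu hcs hsub
    rw [← ofReal_integral_norm_eq_lintegral_enorm hint,
      ← ofReal_integral_norm_eq_lintegral_enorm hintX, ← ENNReal.ofReal_coe_nnreal,
      ← ENNReal.ofReal_mul K.coe_nonneg] at this
    exact (ENNReal.ofReal_le_ofReal_iff (by positivity)).1 this
  have hCS : ∫ x in Ω, ‖xGrad X u x‖ ≤ √V * S := by
    rw [hS, ← Real.sqrt_mul hVpos.le]
    refine Real.le_sqrt_of_sq_le ?_
    have := sq_setIntegral_le hintX.norm ((hX.integrable_xGrad_sq hu hcs).integrableOn (s := Ω))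
    rwa [measureReal_restrict_apply_univ] at this
  have hmean : |⨍ z in Ω, u z| ≤ C₄ * S := by
    rw [setAverage_eq, smul_eq_mul, abs_mul, abs_of_pos (inv_pos.2 hVpos), inv_mul_le_iff₀ hVpos]
    calc |∫ x in Ω, u x| ≤ ∫ x in Ω, ‖u x‖ := norm_integral_le_integral_norm u
      _ ≤ K * (√V * S) := hL1.trans (by gcongr)
      _ = V * (K / √V * S) := by
        conv_rhs => rw [← Real.mul_self_sqrt hVpos.le]
        have := Real.sqrt_pos.2 hVpos
        field_simp
        rw [Real.sqrt_sq this.le]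
        ring
      _ ≤ V * (C₄ * S) := by gcongr; simp [hC₄]
  -- For vanishing energy the radius ρ chosen below would be 0; here the L¹ bound already forces u =
  -- 0 a.e. in Ω.
  rcases hS0.eq_or_lt with hSz | hSpos
  · have h1 : ∫ x in Ω, ‖u x‖ ≤ 0 := by
      refine hL1.trans ?_
      rw [← hSz, mul_zero] at hCS
      exact mul_nonpos_of_nonneg_of_nonpos K.coe_nonneg hCS
    have h2 : ∀ᵐ x ∂(volume.restrict Ω), u x = 0 := by
      have h3 := (integral_eq_zero_iff_of_nonneg (fun x => norm_nonneg (u x)) hint.norm).1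
        (le_antisymm h1 (integral_nonneg fun _ => norm_nonneg _))
      filter_upwards [h3] with x hx using by simpa using hx
    have h4 : volume (Ω ∩ {x | t < |u x|}) = 0 := by
      rw [ae_restrict_iff' hX.isOpen.measurableSet, ae_iff] at h2
      refine measure_mono_null (fun x hx => ?_) h2
      simp only [mem_ofPred_eq, Classical.not_imp]
      refine ⟨hx.1, fun h0 => ?_⟩
      have := hx.2
      simp only [mem_ofPred_eq, h0, abs_zero] at this
      linarith
    rw [h4]
    exact zero_le
  have hP : 0 ≤ (S / t) ^ s := by positivity
  by_cases hcase : C₄ * S ≤ t / 2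
  -- Chosen so that the two terms of the pointwise bound contribute t/8 and t/4. Since |u_Ω| ≤ t/2,
  -- where |u| > t some average of |Xu|² must exceed τ², and the covering estimate gives a multiple
  -- of S²/τ², which is (S/t)^{2+2/a} up to a constant.
  · set ρ := (4 * C * (S / t)) ^ (1 / a) with hρ
    have hρ0 : 0 < ρ := by positivity
    set τ := t / (8 * C * ρ) with hτ
    have hτ0 : 0 < τ := by positivity
    have hρa : ρ ^ (-a) = t / (4 * C * S) := by
      rw [hρ, ← Real.rpow_mul (by positivity)]
      have : 1 / a * -a = -1 := by field_simp
      rw [this, Real.rpow_neg_one]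
      field_simp
    have hbound : C * (ρ * τ + S * ρ ^ (-a)) < t / 2 := by
      rw [hρa, hτ]
      have : C * (ρ * (t / (8 * C * ρ)) + S * (t / (4 * C * S))) = 3 * t / 8 := by
        field_simp; norm_num
      rw [this]
      linarith
    have hlarge : ∀ x ∈ Ω ∩ {x | t < |u x|}, ∃ r, 0 < r ∧ r ≤ D ∧
        τ ^ 2 * volume.real (ccBall X Ω x (2 ^ l * r)) ≤
          ∫ y in ccBall X Ω x (2 ^ l * r), ‖xGrad X u y‖ ^ 2 := by
      intro x hx
      by_contra! hcon
      have h1 := hptw u hu hcs x hx.1 ρ τ hρ0 hτ0.le fun r hr0 _ hrD => (hcon r hr0 hrD).le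
      have h2 : t < |u x| := hx.2
      have h3 := abs_sub_abs_le_abs_sub (u x) (⨍ z in Ω, u z)
      rw [← hS] at h1
      linarith
    have h4 := hX.volume_le_of_large_average (hX.integrable_xGrad_sq hu hcs)
      (fun x => by positivity) inter_subset_left (by positivity : 0 < τ ^ 2) hlarge
    refine h4.trans ?_
    rw [← ENNReal.ofReal_pow (by positivity), ← ENNReal.ofReal_mul (by positivity)]
    refine ENNReal.ofReal_le_ofReal ?_
    rw [← hSsq, add_mul]
    have h5 : (2 ^ Q) ^ 2 * ((τ ^ 2)⁻¹ * S ^ 2) = C₅ * (S / t) ^ s := by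
      have e1 : ρ ^ 2 = (4 * C) ^ (2 / a) * (S / t) ^ (2 / a) := by
        rw [hρ, ← Real.rpow_natCast, ← Real.rpow_mul (by positivity),
          Real.mul_rpow (by positivity) (by positivity)]
        congr 2 <;> push_cast <;> ring
      rw [hsa, Real.rpow_add (by positivity), hC₅, Real.rpow_two]
      have e2 : (τ ^ 2)⁻¹ * S ^ 2 = (8 * C) ^ 2 * ρ ^ 2 * (S / t) ^ 2 := by
        rw [hτ]; field_simp
      rw [e2, e1]
      ring
    rw [h5]
    have : 0 ≤ V * (2 * C₄) ^ s * (S / t) ^ s := by positivity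
    linarith
  -- Now S/t is bounded below, so |Ω| itself is an admissible bound.
  · push Not at hcase
    have h1 : 1 ≤ (2 * C₄ * (S / t)) ^ s := by
      refine Real.one_le_rpow ?_ hs0.le
      rw [mul_div_assoc', le_div_iff₀ ht]
      linarith
    have h2 : volume (Ω ∩ {x | t < |u x|}) ≤ ENNReal.ofReal V := by
      rw [hV, Measure.real, ENNReal.ofReal_toReal hX.volume_lt_top.ne]
      exact measure_mono inter_subset_left
    refine h2.trans (ENNReal.ofReal_le_ofReal ?_)
    rw [Real.mul_rpow (by positivity) (by positivity)] at h1
    rw [add_mul]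
    have : 0 ≤ C₅ * (S / t) ^ s := by positivity
    nlinarith

end IsAdmissible

end XElliptic

/-! ### Truncation and the chain rule in W₀^{1,p} -/

/-- Dominated convergence in `L^p`, `p < ∞`. -/
theorem MeasureTheory.tendsto_eLpNorm_zero_of_dominated {α F : Type*} [MeasurableSpace α]
    {μ : Measure α} [NormedAddCommGroup F] {p : ℝ≥0∞} (hp : p ≠ ⊤) {f : ℕ → α → F} {g : α → ℝ}
    (hf : ∀ n, AEStronglyMeasurable (f n) μ) (hg : MemLp g p μ)
    (hfg : ∀ n, ∀ᵐ x ∂μ, ‖f n x‖ ≤ g x) (hlim : ∀ᵐ x ∂μ, Tendsto (fun n => f n x) atTop (𝓝 0)) :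
    Tendsto (fun n => eLpNorm (f n) p μ) atTop (𝓝 0) := by
  rcases eq_or_ne p 0 with rfl | hp0
  · simp
  have hp1 : 0 < p.toReal := ENNReal.toReal_pos hp0 hp
  simp_rw [eLpNorm_eq_lintegral_rpow_enorm_toReal hp0 hp]
  have h0 : (0 : ℝ≥0∞) = (∫⁻ _, (0 : ℝ≥0∞) ∂μ) ^ (1 / p.toReal) := by
    rw [lintegral_zero, ENNReal.zero_rpow_of_pos (by positivity)]
  rw [h0]
  refine (ENNReal.continuous_rpow_const.tendsto _).comp ?_
  refine tendsto_lintegral_of_dominated_convergence' (fun x => ‖g x‖ₑ ^ p.toReal)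
    (fun n => (hf n).enorm.pow_const _) ?_ ?_ ?_
  · intro n
    filter_upwards [hfg n] with x hx
    gcongr
    exact enorm_le_iff_norm_le.2 (hx.trans (le_abs_self _))
  · exact (lintegral_rpow_enorm_lt_top_of_eLpNorm_lt_top hp0 hp hg.2).ne
  · filter_upwards [hlim] with x hx
    have := (ENNReal.continuous_rpow_const (y := p.toReal)).tendsto 0
    rw [ENNReal.zero_rpow_of_pos hp1] at this
    refine this.comp ?_
    simpa using hx.enorm

/-- The primitive of `b` that vanishes at `0`. -/
noncomputable def primitive (b : ℝ → ℝ) (s : ℝ) : ℝ := ∫ x in (0 : ℝ)..s, b x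

/-- Truncation at the level `k`. -/
noncomputable def trunc (k s : ℝ) : ℝ := max (-k) (min s k)

section primitive

variable {b : ℝ → ℝ} {M : ℝ}

theorem intervalIntegrable_of_abs_le (hb : Measurable b) (hM : ∀ s, |b s| ≤ M) (s t : ℝ) :
    IntervalIntegrable b volume s t := by
  rw [intervalIntegrable_iff]
  have : IsFiniteMeasure (volume.restrict (uIoc s t)) := ⟨by simp [uIoc]⟩
  exact Integrable.of_bound hb.aestronglyMeasurable M (Eventually.of_forall hM)

@[simp] theorem primitive_zero : primitive b 0 = 0 := by simp [primitive]

theorem primitive_sub_primitive (hb : Measurable b) (hM : ∀ s, |b s| ≤ M) (s t : ℝ) :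
    primitive b t - primitive b s = ∫ x in s..t, b x :=
  intervalIntegral.integral_interval_sub_left (intervalIntegrable_of_abs_le hb hM _ _)
    (intervalIntegrable_of_abs_le hb hM _ _)

theorem abs_primitive_sub_le (hb : Measurable b) (hM : ∀ s, |b s| ≤ M) (s t : ℝ) :
    |primitive b t - primitive b s| ≤ M * |t - s| := by
  rw [primitive_sub_primitive hb hM]
  exact intervalIntegral.norm_integral_le_of_norm_le_const fun x _ =>
    (Real.norm_eq_abs (b x)).trans_le (hM x)

theorem abs_primitive_le (hb : Measurable b) (hM : ∀ s, |b s| ≤ M) (s : ℝ) :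
    |primitive b s| ≤ M * |s| := by
  simpa using abs_primitive_sub_le hb hM 0 s

theorem continuous_primitive' (hb : Measurable b) (hM : ∀ s, |b s| ≤ M) :
    Continuous (primitive b) := by
  have h0 : 0 ≤ M := (abs_nonneg _).trans (hM 0)
  refine (LipschitzWith.of_dist_le_mul (K := ⟨M, h0⟩) fun s t => ?_).continuous
  exact abs_primitive_sub_le hb hM t s

theorem hasDerivAt_primitive (hb : Continuous b) (s : ℝ) : HasDerivAt (primitive b) (b s) s :=
  intervalIntegral.integral_hasDerivAt_right (hb.intervalIntegrable _ _)
    (hb.stronglyMeasurableAtFilter _ _) hb.continuousAt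

theorem contDiff_primitive (hb : ContDiff ℝ ∞ b) : ContDiff ℝ ∞ (primitive b) := by
  rw [contDiff_infty_iff_deriv]
  have h : deriv (primitive b) = b := funext fun s => (hasDerivAt_primitive hb.continuous s).deriv
  refine ⟨fun s => (hasDerivAt_primitive hb.continuous s).differentiableAt, ?_⟩
  rwa [h]

theorem tendsto_primitive {bn : ℕ → ℝ → ℝ} (hb : ∀ n, Measurable (bn n))
    (hM : ∀ n s, |bn n s| ≤ M) (hlim : ∀ s, Tendsto (fun n => bn n s) atTop (𝓝 (b s))) (s : ℝ) :
    Tendsto (fun n => primitive (bn n) s) atTop (𝓝 (primitive b s)) :=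
  intervalIntegral.tendsto_integral_filter_of_dominated_convergence (fun _ => M)
    (Eventually.of_forall fun n => (hb n).aestronglyMeasurable)
    (Eventually.of_forall fun n => Eventually.of_forall fun x _ => hM n x)
    (by simp) (Eventually.of_forall fun x _ => hlim x)

/-- Places truncation among the primitives of bounded functions, so that its chain rule is a limit
case of the general one. The open interval is what increasing continuous approximations produce. -/
theorem primitive_indicator {k : ℝ} (hk : 0 < k) (s : ℝ) :
    primitive ((Ioo (-k) k).indicator 1) s = trunc k s := by
  have hmeas : Measurable ((Ioo (-k) k).indicator (1 : ℝ → ℝ)) :=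
    measurable_one.indicator measurableSet_Ioo
  have hbd : ∀ s, |(Ioo (-k) k).indicator (1 : ℝ → ℝ) s| ≤ 1 := fun s => by
    by_cases h : s ∈ Ioo (-k) k <;> simp [h]
  have h1 : ∀ s t : ℝ, s ≤ t → -k ≤ s → t ≤ k →
      ∫ x in s..t, (Ioo (-k) k).indicator (1 : ℝ → ℝ) x = t - s := by
    intro s t hst h1 h2
    have : ∫ x in s..t, (Ioo (-k) k).indicator (1 : ℝ → ℝ) x = ∫ _ in s..t, (1 : ℝ) := by
      rw [intervalIntegral.integral_of_le hst, intervalIntegral.integral_of_le hst,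
        integral_Ioc_eq_integral_Ioo, integral_Ioc_eq_integral_Ioo]
      refine setIntegral_congr_fun measurableSet_Ioo fun x hx => ?_
      exact indicator_of_mem (show x ∈ Ioo (-k) k from ⟨h1.trans_lt hx.1, hx.2.trans_le h2⟩) _
    rw [this]; simp
  have h2 : ∀ s t : ℝ, s ≤ t → (k ≤ s ∨ t ≤ -k) →
      ∫ x in s..t, (Ioo (-k) k).indicator (1 : ℝ → ℝ) x = 0 := by
    intro s t hst h
    rw [intervalIntegral.integral_of_le hst, integral_Ioc_eq_integral_Ioo]
    refine setIntegral_eq_zero_of_forall_eq_zero fun x hx => ?_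
    refine indicator_of_notMem (fun hx' => ?_) _
    rcases h with h | h
    · linarith [hx.1, hx'.2]
    · linarith [hx.2, hx'.1]
  have hi := intervalIntegrable_of_abs_le hmeas hbd
  unfold primitive trunc
  rcases le_total 0 s with hs | hs
  · rcases le_total s k with hsk | hsk
    · rw [h1 0 s hs (by linarith) hsk, min_eq_left hsk, max_eq_right (by linarith), sub_zero]
    · rw [← intervalIntegral.integral_add_adjacent_intervals (hi 0 k) (hi k s),
        h1 0 k hk.le (by linarith) le_rfl, h2 k s hsk (Or.inl le_rfl), min_eq_right hsk,
        max_eq_right (by linarith)]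
      ring
  · rw [intervalIntegral.integral_symm, min_eq_left (by linarith)]
    rcases le_total (-k) s with hsk | hsk
    · rw [h1 s 0 hs hsk hk.le, max_eq_right hsk]; ring
    · rw [← intervalIntegral.integral_add_adjacent_intervals (hi s (-k)) (hi (-k) 0),
        h1 (-k) 0 (by linarith) le_rfl hk.le, h2 s (-k) hsk (Or.inr le_rfl), max_eq_left hsk]
      ring

theorem abs_trunc_le {k : ℝ} (hk : 0 ≤ k) (s : ℝ) : |trunc k s| ≤ k := by
  unfold trunc
  rw [abs_le]
  exact ⟨le_max_left _ _, max_le (by linarith) (min_le_right _ _)⟩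

theorem abs_trunc {k : ℝ} (hk : 0 ≤ k) (s : ℝ) : |trunc k s| = min |s| k := by
  unfold trunc
  rcases le_total 0 s with h | h
  · rw [max_eq_right (by have := le_min h hk; linarith), abs_of_nonneg (le_min h hk),
      abs_of_nonneg h]
  · rw [min_eq_left (by linarith), abs_of_nonpos (max_le (by linarith) h), abs_of_nonpos h,
      ← min_neg_neg, neg_neg, min_comm]

theorem abs_trunc_le_abs {k : ℝ} (hk : 0 ≤ k) (s : ℝ) : |trunc k s| ≤ |s| := by
  rw [abs_trunc hk]; exact min_le_left _ _

theorem trunc_eq_self {k s : ℝ} (h : |s| ≤ k) : trunc k s = s := by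
  unfold trunc
  rw [abs_le] at h
  rw [min_eq_left h.2, max_eq_right h.1]

theorem continuous_trunc (k : ℝ) : Continuous (trunc k) := by
  unfold trunc; fun_prop

end primitive

namespace XElliptic

variable {N m : ℕ} {X : Fin m → E N → E N} {Ω : Set (E N)} {Q : ℝ} {p : ℝ≥0∞}
  {u v : E N → ℝ} {U V : E N → E m}

theorem xGrad_sub {φ ψ : E N → ℝ} (hφ : Differentiable ℝ φ) (hψ : Differentiable ℝ ψ) :
    xGrad X (φ - ψ) = xGrad X φ - xGrad X ψ := by
  ext x j
  simp [xGrad, fderiv_sub (hφ x) (hψ x)]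

theorem xGrad_comp {φ H : ℝ → ℝ} {ψ : E N → ℝ} (hH : ∀ s, HasDerivAt H (φ s) s)
    (hψ : Differentiable ℝ ψ) (x : E N) : xGrad X (H ∘ ψ) x = φ (ψ x) • xGrad X ψ x := by
  have h := ((hH (ψ x)).comp_hasFDerivAt x (hψ x).hasFDerivAt).fderiv
  ext j
  simp [xGrad, h]

theorem MemW0.sub (hX : ∀ j, Continuous (X j)) (hp : 1 ≤ p) (hu : MemW0 X Ω p u U)
    (hv : MemW0 X Ω p v V) : MemW0 X Ω p (u - v) (U - V) := by
  obtain ⟨hu1, hu2, φ, hφ, h1, h2⟩ := hu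
  obtain ⟨hv1, hv2, ψ, hψ, h3, h4⟩ := hv
  have c1 : ∀ n, Continuous (φ n) := fun n => (hφ n).1.continuous
  have c2 : ∀ n, Continuous (ψ n) := fun n => (hψ n).1.continuous
  have c3 : ∀ n, Continuous (xGrad X (φ n)) := fun n =>
    continuous_xGrad hX ((hφ n).1.of_le (by exact_mod_cast le_top))
  have c4 : ∀ n, Continuous (xGrad X (ψ n)) := fun n =>
    continuous_xGrad hX ((hψ n).1.of_le (by exact_mod_cast le_top))
  refine ⟨hu1.sub hv1, hu2.sub hv2, fun n => φ n - ψ n, fun n => ⟨(hφ n).1.sub (hψ n).1,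
    (hφ n).2.1.sub (hψ n).2.1, (tsupport_sub _ _).trans (union_subset (hφ n).2.2 (hψ n).2.2)⟩,
    ?_, ?_⟩
  · have h5 := h1.add h3
    rw [add_zero] at h5
    refine tendsto_of_tendsto_of_tendsto_of_le_of_le tendsto_const_nhds h5 (fun _ => zero_le)
      fun n => ?_
    have : φ n - ψ n - (u - v) = (φ n - u) - (ψ n - v) := by abel
    simp only [this]
    exact eLpNorm_sub_le ((c1 n).aestronglyMeasurable.sub hu1.1)
      ((c2 n).aestronglyMeasurable.sub hv1.1) hp
  · have h5 := h2.add h4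
    rw [add_zero] at h5
    refine tendsto_of_tendsto_of_tendsto_of_le_of_le tendsto_const_nhds h5 (fun _ => zero_le)
      fun n => ?_
    have : xGrad X (φ n - ψ n) - (U - V) = (xGrad X (φ n) - U) - (xGrad X (ψ n) - V) := by
      rw [xGrad_sub ((hφ n).1.differentiable (by simp)) ((hψ n).1.differentiable (by simp))]
      abel
    simp only [this]
    exact eLpNorm_sub_le ((c3 n).aestronglyMeasurable.sub hu2.1)
      ((c4 n).aestronglyMeasurable.sub hv2.1) hp

theorem exists_eLpNorm_le_of_exponent_le {α : Type*} [MeasurableSpace α] (μ : Measure α)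
    [IsFiniteMeasure μ] {p q : ℝ≥0∞} (hq : 1 ≤ q) (hqp : q ≤ p) :
    ∃ C : ℝ≥0, ∀ {F : Type} [NormedAddCommGroup F] (f : α → F), AEStronglyMeasurable f μ →
      eLpNorm f q μ ≤ C * eLpNorm f p μ := by
  have hκ : μ univ ^ (1 / q.toReal - 1 / p.toReal) ≠ ⊤ := by
    refine ENNReal.rpow_ne_top_of_nonneg (sub_nonneg.2 ?_) (measure_ne_top μ univ)
    rcases eq_or_ne p ⊤ with rfl | hp
    · simp
    · have h1 : 0 < q.toReal :=
        ENNReal.toReal_pos (one_pos.trans_le hq).ne' (ne_top_of_le_ne_top hp hqp)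
      have h2 := ENNReal.toReal_mono hp hqp
      exact one_div_le_one_div_of_le h1 h2
  refine ⟨(μ univ ^ (1 / q.toReal - 1 / p.toReal)).toNNReal, fun f hf => ?_⟩
  rw [ENNReal.coe_toNNReal hκ, mul_comm]
  exact eLpNorm_le_eLpNorm_mul_rpow_measure_univ hqp hf

theorem tendsto_eLpNorm_of_exponent_le {α F : Type*} [MeasurableSpace α] {μ : Measure α}
    [IsFiniteMeasure μ] [NormedAddCommGroup F] {p q : ℝ≥0∞} (hq : 1 ≤ q) (hqp : q ≤ p)
    {f : ℕ → α → F} (hf : ∀ n, AEStronglyMeasurable (f n) μ)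
    (h : Tendsto (fun n => eLpNorm (f n) p μ) atTop (𝓝 0)) :
    Tendsto (fun n => eLpNorm (f n) q μ) atTop (𝓝 0) := by
  have hκ : μ univ ^ (1 / q.toReal - 1 / p.toReal) ≠ ⊤ := by
    refine ENNReal.rpow_ne_top_of_nonneg (sub_nonneg.2 ?_) (measure_ne_top μ univ)
    rcases eq_or_ne p ⊤ with rfl | hp
    · simp
    · have h1 : 0 < q.toReal :=
        ENNReal.toReal_pos (one_pos.trans_le hq).ne' (ne_top_of_le_ne_top hp hqp)
      have h2 := ENNReal.toReal_mono hp hqp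
      exact one_div_le_one_div_of_le h1 h2
  have h2 := ENNReal.Tendsto.mul_const h (Or.inr hκ)
  rw [zero_mul] at h2
  exact tendsto_of_tendsto_of_tendsto_of_le_of_le tendsto_const_nhds h2 (fun _ => zero_le)
    fun n => eLpNorm_le_eLpNorm_mul_rpow_measure_univ hqp (hf n)

theorem MemW0.mono_exponent (hX : ∀ j, Continuous (X j)) (hΩ : volume Ω < ⊤) {q : ℝ≥0∞}
    (hq : 1 ≤ q) (hqp : q ≤ p) (hu : MemW0 X Ω p u U) : MemW0 X Ω q u U := by
  obtain ⟨hu1, hu2, φ, hφ, h1, h2⟩ := hu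
  have : IsFiniteMeasure (volume.restrict Ω) := ⟨by simpa using hΩ⟩
  refine ⟨hu1.mono_exponent hqp, hu2.mono_exponent hqp, φ, hφ, ?_, ?_⟩
  · exact tendsto_eLpNorm_of_exponent_le hq hqp
      (fun n => (hφ n).1.continuous.aestronglyMeasurable.sub hu1.1) h1
  · exact tendsto_eLpNorm_of_exponent_le hq hqp (fun n => (continuous_xGrad hX
      ((hφ n).1.of_le (by exact_mod_cast le_top))).aestronglyMeasurable.sub hu2.1) h2

/-- The graph of the `X`-gradient on `W₀^{1,p}` is closed. -/
theorem MemW0.of_tendsto (hX : ∀ j, Continuous (X j)) (hp : 1 ≤ p) {un : ℕ → E N → ℝ}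
    {Un : ℕ → E N → E m} (h : ∀ n, MemW0 X Ω p (un n) (Un n))
    (hu : MemLp u p (volume.restrict Ω)) (hU : MemLp U p (volume.restrict Ω))
    (h1 : Tendsto (fun n => eLpNorm (un n - u) p (volume.restrict Ω)) atTop (𝓝 0))
    (h2 : Tendsto (fun n => eLpNorm (Un n - U) p (volume.restrict Ω)) atTop (𝓝 0)) :
    MemW0 X Ω p u U := by
  have hex : ∀ n : ℕ, ∃ φ : E N → ℝ, (ContDiff ℝ ∞ φ ∧ HasCompactSupport φ ∧ tsupport φ ⊆ Ω) ∧
      eLpNorm (φ - un n) p (volume.restrict Ω) ≤ ((n : ℝ≥0∞) + 1)⁻¹ ∧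
      eLpNorm (xGrad X φ - Un n) p (volume.restrict Ω) ≤ ((n : ℝ≥0∞) + 1)⁻¹ := by
    intro n
    obtain ⟨-, -, φ, hφ, h3, h4⟩ := h n
    have hpos : (0 : ℝ≥0∞) < ((n : ℝ≥0∞) + 1)⁻¹ := by
      rw [ENNReal.inv_pos]; finiteness
    obtain ⟨k, hk1, hk2⟩ := ((h3.eventually_lt_const hpos).and (h4.eventually_lt_const hpos)).exists
    exact ⟨φ k, hφ k, hk1.le, hk2.le⟩
  choose φ hφ h3 h4 using hex
  have hlim : Tendsto (fun n : ℕ => ((n : ℝ≥0∞) + 1)⁻¹) atTop (𝓝 0) := by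
    have := (tendsto_add_atTop_iff_nat 1).2 ENNReal.tendsto_inv_nat_nhds_zero
    simpa using this
  refine ⟨hu, hU, φ, hφ, ?_, ?_⟩
  · have h5 := hlim.add h1
    rw [add_zero] at h5
    refine tendsto_of_tendsto_of_tendsto_of_le_of_le tendsto_const_nhds h5 (fun _ => zero_le)
      fun n => ?_
    rw [← sub_add_sub_cancel (φ n) (un n) u]
    exact (eLpNorm_add_le ((hφ n).1.continuous.aestronglyMeasurable.sub (h n).1.1)
      ((h n).1.1.sub hu.1) hp).trans (by gcongr; exact h3 n)
  · have h5 := hlim.add h2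
    rw [add_zero] at h5
    refine tendsto_of_tendsto_of_tendsto_of_le_of_le tendsto_const_nhds h5 (fun _ => zero_le)
      fun n => ?_
    rw [← sub_add_sub_cancel (xGrad X (φ n)) (Un n) U]
    exact (eLpNorm_add_le ((continuous_xGrad hX
      ((hφ n).1.of_le (by exact_mod_cast le_top))).aestronglyMeasurable.sub (h n).2.1.1)
      ((h n).2.1.1.sub hU.1) hp).trans (by gcongr; exact h4 n)

section chainRule

variable {b : ℝ → ℝ} {M : ℝ}

theorem MemLp.primitive_comp (hb : Measurable b) (hM : ∀ s, |b s| ≤ M)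
    (hu : MemLp u p (volume.restrict Ω)) : MemLp (primitive b ∘ u) p (volume.restrict Ω) := by
  refine (hu.const_mul M).mono
    ((continuous_primitive' hb hM).comp_aestronglyMeasurable hu.1) (Eventually.of_forall fun x => ?_)
  refine (abs_primitive_le hb hM (u x)).trans ?_
  rw [norm_mul]
  exact mul_le_mul_of_nonneg_right (le_abs_self M) (abs_nonneg _)

theorem MemLp.smul_comp (hb : Measurable b) (hM : ∀ s, |b s| ≤ M)
    (hu : AEStronglyMeasurable u (volume.restrict Ω)) (hU : MemLp U p (volume.restrict Ω)) :
    MemLp (fun x => b (u x) • U x) p (volume.restrict Ω) := by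
  refine (hU.norm.const_mul M).mono
    ((hb.comp_aemeasurable hu.aemeasurable).aestronglyMeasurable.smul hU.1)
    (Eventually.of_forall fun x => ?_)
  rw [norm_smul, norm_mul, norm_norm]
  exact mul_le_mul_of_nonneg_right ((hM (u x)).trans (le_abs_self M)) (norm_nonneg _)

/-- Chain rule for smooth functions with bounded derivative. -/
theorem MemW0.comp_smooth (hX : ∀ j, Continuous (X j)) (hp : 1 ≤ p) (hp' : p ≠ ⊤)
    (hb : ContDiff ℝ ∞ b) (hM : ∀ s, |b s| ≤ M) (hu : MemW0 X Ω p u U) :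
    MemW0 X Ω p (primitive b ∘ u) (fun x => b (u x) • U x) := by
  obtain ⟨hu1, hu2, φ', hφ', h1', h2'⟩ := hu
  have hbm : Measurable b := hb.continuous.measurable
  have h0M : 0 ≤ M := (abs_nonneg _).trans (hM 0)
  -- A.e. convergence along a subsequence is needed for b(φₙ) → b(u) in the error term (b(φₙ) -
  -- b(u)) U, which is only dominated by 2M|U|.
  have hmeas := tendstoInMeasure_of_tendsto_eLpNorm (one_pos.trans_le hp).ne'
    (fun n => (hφ' n).1.continuous.aestronglyMeasurable) hu1.1 h1'
  obtain ⟨ns, hns, hae⟩ := hmeas.exists_seq_tendsto_ae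
  set φ := fun n => φ' (ns n) with hφdef
  have hφ : ∀ n, ContDiff ℝ ∞ (φ n) ∧ HasCompactSupport (φ n) ∧ tsupport (φ n) ⊆ Ω :=
    fun n => hφ' (ns n)
  have h1 : Tendsto (fun n => eLpNorm (φ n - u) p (volume.restrict Ω)) atTop (𝓝 0) :=
    h1'.comp hns.tendsto_atTop
  have h2 : Tendsto (fun n => eLpNorm (xGrad X (φ n) - U) p (volume.restrict Ω)) atTop (𝓝 0) :=
    h2'.comp hns.tendsto_atTop
  have hc : ∀ n, Continuous (xGrad X (φ n)) := fun n =>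
    continuous_xGrad hX ((hφ n).1.of_le (by exact_mod_cast le_top))
  have hbu : AEStronglyMeasurable (fun x => b (u x)) (volume.restrict Ω) :=
    hb.continuous.comp_aestronglyMeasurable hu1.1
  refine ⟨MemLp.primitive_comp hbm hM hu1, MemLp.smul_comp hbm hM hu1.1 hu2,
    fun n => primitive b ∘ φ n, fun n => ⟨(contDiff_primitive hb).comp (hφ n).1,
      (hφ n).2.1.comp_left primitive_zero,
      (closure_mono (Function.support_comp_subset primitive_zero _)).trans (hφ n).2.2⟩, ?_, ?_⟩
  · have h3 := ENNReal.Tendsto.const_mul (a := ENNReal.ofReal M) h1 (Or.inr ENNReal.ofReal_ne_top)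
    rw [mul_zero] at h3
    refine tendsto_of_tendsto_of_tendsto_of_le_of_le tendsto_const_nhds h3 (fun _ => zero_le)
      fun n => ?_
    refine eLpNorm_le_mul_eLpNorm_of_ae_le_mul (Eventually.of_forall fun x => ?_) p
    exact abs_primitive_sub_le hbm hM (u x) (φ n x)
  · have h3 := ENNReal.Tendsto.const_mul (a := ENNReal.ofReal M) h2 (Or.inr ENNReal.ofReal_ne_top)
    rw [mul_zero] at h3
    have h4 : Tendsto (fun n => eLpNorm (fun x => (b (φ n x) - b (u x)) • U x) p
        (volume.restrict Ω)) atTop (𝓝 0) := by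
      refine tendsto_eLpNorm_zero_of_dominated hp' (fun n => ?_) (hu2.norm.const_mul (2 * M))
        (fun n => Eventually.of_forall fun x => ?_) ?_
      · exact (((hb.continuous.comp (hφ n).1.continuous).aestronglyMeasurable).sub hbu).smul hu2.1
      · rw [norm_smul]
        refine mul_le_mul_of_nonneg_right ?_ (norm_nonneg _)
        exact (abs_sub _ _).trans (by linarith [hM (φ n x), hM (u x)])
      · filter_upwards [hae] with x hx
        have := (((hb.continuous.tendsto (u x)).comp hx).sub_const (b (u x))).smul_const (U x)
        simpa using this
    have h5 := h3.add h4
    rw [add_zero] at h5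
    refine tendsto_of_tendsto_of_tendsto_of_le_of_le tendsto_const_nhds h5 (fun _ => zero_le)
      fun n => ?_
    have e : xGrad X (primitive b ∘ φ n) - (fun x => b (u x) • U x) =
        (fun x => b (φ n x) • (xGrad X (φ n) x - U x)) + fun x => (b (φ n x) - b (u x)) • U x := by
      ext1 x
      simp only [Pi.sub_apply, Pi.add_apply]
      rw [xGrad_comp (fun s => hasDerivAt_primitive hb.continuous s)
        ((hφ n).1.differentiable (by simp)), smul_sub, sub_smul]
      abel
    rw [e]
    refine (eLpNorm_add_le ?_ ?_ hp).trans (add_le_add_left ?_ _)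
    · exact ((hb.continuous.comp (hφ n).1.continuous).aestronglyMeasurable).smul
        ((hc n).aestronglyMeasurable.sub hu2.1)
    · exact (((hb.continuous.comp (hφ n).1.continuous).aestronglyMeasurable).sub hbu).smul hu2.1
    · refine eLpNorm_le_mul_eLpNorm_of_ae_le_mul (Eventually.of_forall fun x => ?_) p
      rw [norm_smul]
      exact mul_le_mul_of_nonneg_right (hM _) (norm_nonneg _)

/-- The chain rule passes to bounded pointwise limits of the derivative. -/
theorem MemW0.comp_of_tendsto (hX : ∀ j, Continuous (X j)) (hp : 1 ≤ p) (hp' : p ≠ ⊤)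
    {bn : ℕ → ℝ → ℝ} (hb : ∀ n, Measurable (bn n)) (hM : ∀ n s, |bn n s| ≤ M)
    (hlim : ∀ s, Tendsto (fun n => bn n s) atTop (𝓝 (b s)))
    (hu1 : MemLp u p (volume.restrict Ω)) (hu2 : MemLp U p (volume.restrict Ω))
    (h : ∀ n, MemW0 X Ω p (primitive (bn n) ∘ u) (fun x => bn n (u x) • U x)) :
    MemW0 X Ω p (primitive b ∘ u) (fun x => b (u x) • U x) := by
  have hbm : Measurable b := measurable_of_tendsto_metrizable hb (tendsto_pi_nhds.2 hlim)
  have hbM : ∀ s, |b s| ≤ M := fun s => le_of_tendsto' (hlim s).abs fun n => hM n s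
  have m1 := MemLp.primitive_comp hbm hbM hu1
  have m2 := MemLp.smul_comp hbm hbM hu1.1 hu2
  refine MemW0.of_tendsto hX hp h m1 m2 ?_ ?_
  · refine tendsto_eLpNorm_zero_of_dominated hp' (fun n => (h n).1.1.sub m1.1)
      (hu1.norm.const_mul (2 * M)) (fun n => Eventually.of_forall fun x => ?_)
      (Eventually.of_forall fun x => ?_)
    · have h3 := abs_primitive_le (hb n) (hM n) (u x)
      have h4 := abs_primitive_le hbm hbM (u x)
      simp only [Pi.sub_apply, Function.comp_apply, Real.norm_eq_abs]
      refine (abs_sub _ _).trans (by linarith)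
    · have := (tendsto_primitive hb hM hlim (u x)).sub_const (primitive b (u x))
      simpa using this
  · refine tendsto_eLpNorm_zero_of_dominated hp' (fun n => (h n).2.1.1.sub m2.1)
      (hu2.norm.const_mul (2 * M)) (fun n => Eventually.of_forall fun x => ?_)
      (Eventually.of_forall fun x => ?_)
    · simp only [Pi.sub_apply, ← sub_smul, norm_smul]
      refine mul_le_mul_of_nonneg_right ?_ (norm_nonneg _)
      exact (abs_sub _ _).trans (by linarith [hM n (u x), hbM (u x)])
    · have := (((hlim (u x)).sub_const (b (u x))).smul_const (U x))
      simpa [sub_smul] using this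

/-- Chain rule for `C¹` functions with bounded derivative. -/
theorem MemW0.comp_continuous (hX : ∀ j, Continuous (X j)) (hp : 1 ≤ p) (hp' : p ≠ ⊤)
    (hb : Continuous b) (hM : ∀ s, |b s| ≤ M) (hu : MemW0 X Ω p u U) :
    MemW0 X Ω p (primitive b ∘ u) (fun x => b (u x) • U x) := by
  -- Mollification of the derivative b: the bound M is kept and convergence is pointwise.
  let ψ : ℕ → ContDiffBump (0 : ℝ) := fun n =>
    ⟨1 / ((n : ℝ) + 2), 1 / ((n : ℝ) + 1), by positivity, by gcongr; linarith⟩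
  have hψ : Tendsto (fun n => (ψ n).rOut) atTop (𝓝 0) := tendsto_one_div_add_atTop_nhds_zero_nat
  let bn : ℕ → ℝ → ℝ := fun n =>
    convolution ((ψ n).normed volume) b (ContinuousLinearMap.lsmul ℝ ℝ) volume
  have hsmooth : ∀ n, ContDiff ℝ ∞ (bn n) := fun n =>
    (ψ n).hasCompactSupport_normed.contDiff_convolution_left _ (ψ n).contDiff_normed
      hb.locallyIntegrable
  have hbM : ∀ n s, |bn n s| ≤ M := by
    intro n s
    have h1 : ‖∫ t, (ψ n).normed volume t • b (s - t)‖ ≤ ∫ t, (ψ n).normed volume t * M := by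
      refine norm_integral_le_of_norm_le ((ψ n).integrable_normed.mul_const M)
        (Eventually.of_forall fun t => ?_)
      rw [norm_smul, Real.norm_of_nonneg ((ψ n).nonneg_normed t)]
      exact mul_le_mul_of_nonneg_left (hM _) ((ψ n).nonneg_normed t)
    rw [integral_mul_const, (ψ n).integral_normed, one_mul] at h1
    exact h1
  exact MemW0.comp_of_tendsto hX hp hp' (fun n => (hsmooth n).continuous.measurable) hbM
    (fun s => ContDiffBump.convolution_tendsto_right_of_continuous hψ hb s) hu.1 hu.2.1
    fun n => hu.comp_smooth hX hp hp' (hsmooth n) (hbM n)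

/-- Truncations of functions in `W₀^{1,p}`. -/
theorem MemW0.truncate (hX : ∀ j, Continuous (X j)) (hp : 1 ≤ p) (hp' : p ≠ ⊤) {k : ℝ} (hk : 0 < k)
    (hu : MemW0 X Ω p u U) :
    MemW0 X Ω p (fun x => trunc k (u x))
      (fun x => (Ioo (-k) k).indicator (1 : ℝ → ℝ) (u x) • U x) := by
  -- Continuous functions increasing to the indicator of the open interval; all vanish at ±k, so the
  -- gradient is set to zero where |u| = k.
  let bn : ℕ → ℝ → ℝ := fun n s => max 0 (min 1 (n * (k - |s|)))
  have hc : ∀ n, Continuous (bn n) := fun n => by fun_prop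
  have hbM : ∀ n s, |bn n s| ≤ 1 := fun n s => by
    rw [abs_of_nonneg (le_max_left _ _)]
    exact max_le zero_le_one (min_le_left _ _)
  have hlim : ∀ s, Tendsto (fun n => bn n s) atTop (𝓝 ((Ioo (-k) k).indicator (1 : ℝ → ℝ) s)) := by
    intro s
    by_cases hs : |s| < k
    · rw [indicator_of_mem (show s ∈ Ioo (-k) k from abs_lt.1 hs)]
      refine tendsto_const_nhds.congr' ?_
      obtain ⟨n₀, hn₀⟩ := exists_nat_gt (1 / (k - |s|))
      filter_upwards [eventually_ge_atTop n₀] with n hn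
      have h1 : (n₀ : ℝ) ≤ n := by exact_mod_cast hn
      have h2 : 0 < k - |s| := by linarith
      rw [div_lt_iff₀ h2] at hn₀
      have h3 : 1 ≤ n * (k - |s|) := by nlinarith
      simp only [bn, Pi.one_apply]
      rw [min_eq_left h3, max_eq_right zero_le_one]
    · rw [indicator_of_notMem (show s ∉ Ioo (-k) k from fun h => hs (abs_lt.2 h))]
      refine tendsto_const_nhds.congr fun n => ?_
      push Not at hs
      have h3 : n * (k - |s|) ≤ 0 := mul_nonpos_of_nonneg_of_nonpos n.cast_nonneg (by linarith)
      simp only [bn]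
      rw [min_eq_right (h3.trans zero_le_one), max_eq_left h3]
  have := MemW0.comp_of_tendsto hX hp hp' (fun n => (hc n).measurable) hbM hlim hu.1 hu.2.1
    fun n => hu.comp_continuous hX hp hp' (hc n) (hbM n)
  have e : primitive ((Ioo (-k) k).indicator 1) ∘ u = fun x => trunc k (u x) :=
    funext fun x => primitive_indicator hk (u x)
  rwa [e] at this

end chainRule

end XElliptic

/-! ### The Sobolev inequality in W₀^{1,2} -/

/-- Fatou's lemma for indicators: the strict inequality is an open condition, so it eventually holds
along the sequence wherever it holds in the limit. -/
theorem MeasureTheory.measure_lt_abs_le_liminf {α : Type*} [MeasurableSpace α] {μ : Measure α}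
    {f : ℕ → α → ℝ} {g : α → ℝ} (hf : ∀ n, AEMeasurable (f n) μ) (hg : AEMeasurable g μ)
    (hlim : ∀ᵐ x ∂μ, Tendsto (fun n => f n x) atTop (𝓝 (g x))) (t : ℝ) :
    μ {x | t < |g x|} ≤ liminf (fun n => μ {x | t < |f n x|}) atTop := by
  have hm : ∀ {φ : α → ℝ}, AEMeasurable φ μ → NullMeasurableSet {x | t < |φ x|} μ := fun hφ =>
    nullMeasurableSet_lt aemeasurable_const hφ.norm
  rw [← lintegral_indicator_one₀ (hm hg)]
  simp_rw [← fun n => lintegral_indicator_one₀ (hm (hf n))]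
  refine le_trans (lintegral_mono_ae ?_)
    (lintegral_liminf_le' fun n => aemeasurable_one.indicator₀ (hm (hf n)))
  filter_upwards [hlim] with x hx
  by_cases h : t < |g x|
  · rw [indicator_of_mem (show x ∈ {x | t < |g x|} from h)]
    refine le_liminf_of_le (by isBoundedDefault) ?_
    filter_upwards [hx.abs.eventually_const_lt h] with n hn
    rw [indicator_of_mem (show x ∈ {x | t < |f n x|} from hn)]
  · rw [indicator_of_notMem (show x ∉ {x | t < |g x|} from h)]
    exact zero_le

namespace XElliptic

variable {N m : ℕ} {X : Fin m → E N → E N} {Ω : Set (E N)} {Q : ℝ}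

theorem IsAdmissible.exists_weak_sobolev (hN : 2 ≤ N) (hX : IsAdmissible X Ω Q) :
    ∃ C : ℝ≥0, ∀ (u : E N → ℝ) (U : E N → E m), MemW0 X Ω 2 u U → ∀ t : ℝ, 0 < t →
      volume.restrict Ω {x | t < |u x|} ≤
        C * (eLpNorm U 2 (volume.restrict Ω) / ENNReal.ofReal t) ^ (2 * Q / (Q - 2)) := by
  obtain ⟨C, hC, H⟩ := hX.exists_weak_sobolev_smooth hN
  have hQ : 0 < 2 * Q / (Q - 2) := by
    have := hX.two_lt
    exact div_pos (by linarith) (by linarith)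
  refine ⟨C.toNNReal, fun u U hu t ht => ?_⟩
  obtain ⟨hu1, hu2, φ, hφ, h1, h2⟩ := hu
  have hφ1 : ∀ n, ContDiff ℝ 1 (φ n) := fun n => (hφ n).1.of_le (by exact_mod_cast le_top)
  have hc : ∀ n, Continuous (xGrad X (φ n)) := fun n => continuous_xGrad hX.continuous_field (hφ1 n)
  obtain ⟨ns, hns, hae⟩ := (tendstoInMeasure_of_tendsto_eLpNorm two_ne_zero
    (fun n => (hφ n).1.continuous.aestronglyMeasurable) hu1.1 h1).exists_seq_tendsto_ae
  have hle : ∀ n, volume.restrict Ω {x | t < |φ n x|} ≤ ENNReal.ofReal C *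
      (eLpNorm (xGrad X (φ n)) 2 (volume.restrict Ω) / ENNReal.ofReal t) ^ (2 * Q / (Q - 2)) := by
    intro n
    have hmem : MemLp (xGrad X (φ n)) 2 (volume.restrict Ω) := by
      refine (memLp_two_iff_integrable_sq_norm (hc n).aestronglyMeasurable).2 ?_
      exact (hX.integrable_xGrad_sq (hφ1 n) (hφ n).2.1).restrict
    have h3 := H (φ n) (hφ1 n) (hφ n).2.1 (hφ n).2.2 t ht
    rw [Measure.restrict_apply (measurableSet_lt measurable_const (hφ n).1.continuous.abs.measurable),
      inter_comm]
    refine h3.trans (le_of_eq ?_)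
    rw [ENNReal.ofReal_mul hC.le, ← ENNReal.ofReal_rpow_of_nonneg (by positivity) hQ.le,
      ENNReal.ofReal_div_of_pos ht]
    congr 3
    rw [hmem.eLpNorm_eq_integral_rpow_norm two_ne_zero ENNReal.ofNat_ne_top]
    simp [Real.sqrt_eq_rpow]
  have hnorm : ∀ n, eLpNorm (xGrad X (φ n)) 2 (volume.restrict Ω) ≤
      eLpNorm (xGrad X (φ n) - U) 2 (volume.restrict Ω) + eLpNorm U 2 (volume.restrict Ω) := by
    intro n
    have := eLpNorm_add_le (μ := volume.restrict Ω) ((hc n).aestronglyMeasurable.sub hu2.1) hu2.1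
      (p := 2) one_le_two
    rwa [sub_add_cancel] at this
  refine (measure_lt_abs_le_liminf (fun n => (hφ (ns n)).1.continuous.aemeasurable)
    hu1.1.aemeasurable hae t).trans ?_
  have hlim : Tendsto (fun n => ENNReal.ofReal C *
      ((eLpNorm (xGrad X (φ (ns n)) - U) 2 (volume.restrict Ω) + eLpNorm U 2 (volume.restrict Ω)) /
        ENNReal.ofReal t) ^ (2 * Q / (Q - 2))) atTop (𝓝 (ENNReal.ofReal C *
      (eLpNorm U 2 (volume.restrict Ω) / ENNReal.ofReal t) ^ (2 * Q / (Q - 2)))) := by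
    have h4 := (h2.comp hns.tendsto_atTop).add_const (eLpNorm U 2 (volume.restrict Ω))
    rw [zero_add] at h4
    refine ENNReal.Tendsto.const_mul (((ENNReal.continuous_rpow_const).tendsto _).comp
      (ENNReal.Tendsto.div_const h4 (Or.inr ?_))) (Or.inr ENNReal.ofReal_ne_top)
    simpa using ht
  change _ ≤ ENNReal.ofReal C * _
  rw [← hlim.liminf_eq]
  refine liminf_le_liminf (Eventually.of_forall fun n => (hle (ns n)).trans ?_)
  gcongr
  exact hnorm _

/-- The Sobolev inequality in `W₀^{1,2}(Ω, X)`. -/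
theorem IsAdmissible.exists_sobolev (hN : 2 ≤ N) (hX : IsAdmissible X Ω Q) :
    ∃ S : ℝ≥0, ∀ (u : E N → ℝ) (U : E N → E m), MemW0 X Ω 2 u U →
      ∫⁻ x in Ω, ‖u x‖ₑ ^ (2 * Q / (Q - 2)) ≤
        S * eLpNorm U 2 (volume.restrict Ω) ^ (2 * Q / (Q - 2)) := by
  obtain ⟨C, H⟩ := hX.exists_weak_sobolev hN
  have hQ2 := hX.two_lt
  set q : ℝ := 2 * Q / (Q - 2) with hq
  have hq2 : 2 < q := by rw [hq, lt_div_iff₀ (by linarith)]; linarith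
  refine ⟨C * 8 ^ q, fun u U hu => ?_⟩
  set μ := volume.restrict Ω
  have hum : AEMeasurable u μ := hu.1.1.aemeasurable
  -- Maz'ya's truncation: T_{2^{j+1}}(u) - T_{2^j}(u) has gradient supported where |u| is in the
  -- j-th dyadic shell, and has modulus 2^j > 2^{j-1} where |u| > 2^{j+1}. Applied to it, the weak
  -- inequality sees only the energy a_j of one shell.
  let I : ℤ → Set ℝ := fun j => {s | (2 : ℝ) ^ j ≤ |s| ∧ |s| < 2 ^ (j + 1)}
  have hI : ∀ j, MeasurableSet (I j) := fun j =>
    (measurableSet_le measurable_const measurable_norm).inter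
      (measurableSet_lt measurable_norm measurable_const)
  let a : ℤ → ℝ≥0∞ := fun j => eLpNorm (fun x => (I j).indicator (1 : ℝ → ℝ) (u x) • U x) 2 μ
  -- the weak inequality on the dyadic truncations
  have hlevel : ∀ j : ℤ, μ {x | (2 : ℝ) ^ (j + 1) < |u x|} ≤
      C * (a j / ENNReal.ofReal (2 ^ (j - 1))) ^ q := by
    intro j
    have h2j : (0 : ℝ) < 2 ^ j := by positivity
    have e2 : (2 : ℝ) ^ (j + 1) = 2 * 2 ^ j := by rw [zpow_add₀ two_ne_zero, zpow_one, mul_comm]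
    have e3 : (2 : ℝ) ^ (j - 1) = 2 ^ j / 2 := by rw [zpow_sub₀ two_ne_zero, zpow_one]
    have hv := (hu.truncate hX.continuous_field one_le_two ENNReal.ofNat_ne_top
      (show (0 : ℝ) < 2 ^ (j + 1) by positivity)).sub hX.continuous_field one_le_two
      (hu.truncate hX.continuous_field one_le_two ENNReal.ofNat_ne_top h2j)
    refine le_trans (measure_mono fun x hx => ?_) ((H _ _ hv (2 ^ (j - 1)) (by positivity)).trans
      (le_of_eq ?_))
    · simp only [mem_ofPred_eq, Pi.sub_apply] at hx ⊢
      have hk : (2 : ℝ) ^ (j - 1) < 2 ^ j := by rw [e3]; linarith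
      rw [e2] at hx ⊢
      unfold trunc
      rcases le_or_gt 0 (u x) with h0 | h0
      · rw [abs_of_nonneg h0] at hx
        rw [min_eq_right hx.le, min_eq_right (by linarith), max_eq_right (by linarith),
          max_eq_right (by linarith), abs_of_nonneg (by linarith)]
        linarith
      · rw [abs_of_neg h0] at hx
        rw [min_eq_left (by linarith), min_eq_left (by linarith), max_eq_left (by linarith),
          max_eq_left (by linarith), abs_of_nonpos (by linarith)]
        linarith
    · congr 3
      refine congrArg (fun F => eLpNorm F 2 μ) (funext fun x => ?_)
      simp only [Pi.sub_apply, ← sub_smul]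
      congr 1
      have hmem : ∀ k : ℝ, (Ioo (-k) k).indicator (1 : ℝ → ℝ) (u x) = if |u x| < k then 1 else 0 := by
        intro k
        simp only [indicator, mem_Ioo, ← abs_lt, Pi.one_apply]
      rw [hmem, hmem]
      simp only [I, indicator, mem_ofPred_eq, Pi.one_apply]
      by_cases h1 : |u x| < 2 ^ j
      · have h3 : |u x| < 2 ^ (j + 1) := by rw [e2]; linarith
        simp [h1, h3]
      · push Not at h1
        by_cases h3 : |u x| < 2 ^ (j + 1) <;> simp [h1, h3, not_lt.2 h1]
  have ha2 : ∀ j, a j ^ 2 = ∫⁻ x, (u ⁻¹' I j).indicator (fun x => ‖U x‖ₑ ^ 2) x ∂μ := by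
    intro j
    simp only [a]
    rw [eLpNorm_eq_lintegral_rpow_enorm_toReal two_ne_zero ENNReal.ofNat_ne_top]
    rw [← ENNReal.rpow_natCast, ← ENNReal.rpow_mul]
    simp only [ENNReal.toReal_ofNat, Nat.cast_ofNat, one_div, inv_mul_cancel₀ (two_ne_zero (α := ℝ)),
      ENNReal.rpow_one]
    refine lintegral_congr fun x => ?_
    by_cases hx : u x ∈ I j
    · rw [indicator_of_mem hx, indicator_of_mem (show x ∈ u ⁻¹' I j from hx)]
      simp
    · rw [indicator_of_notMem hx, indicator_of_notMem (show x ∉ u ⁻¹' I j from hx)]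
      simp
  have hInull : ∀ j, NullMeasurableSet (u ⁻¹' I j) μ := fun j => hum.nullMeasurableSet_preimage (hI j)
  have hIdisj : Pairwise (Function.onFun Disjoint fun j => u ⁻¹' I j) := by
    intro i j hij
    refine Disjoint.preimage _ (Set.disjoint_left.2 fun s hs hs' => hij ?_)
    have h1 : i < j + 1 := (zpow_lt_zpow_iff_right₀ one_lt_two).1 (hs.1.trans_lt hs'.2)
    have h2 : j < i + 1 := (zpow_lt_zpow_iff_right₀ one_lt_two).1 (hs'.1.trans_lt hs.2)
    omega
  have hsum : ∑' j, a j ^ 2 ≤ eLpNorm U 2 μ ^ 2 := by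
    simp_rw [ha2, fun j => lintegral_indicator₀ (hInull j) (fun x => ‖U x‖ₑ ^ 2)]
    rw [← lintegral_iUnion₀ hInull hIdisj.aedisjoint]
    refine (setLIntegral_le_lintegral _ _).trans (le_of_eq ?_)
    rw [eLpNorm_eq_lintegral_rpow_enorm_toReal two_ne_zero ENNReal.ofNat_ne_top,
      ← ENNReal.rpow_natCast, ← ENNReal.rpow_mul]
    simp
  have haU : ∀ j, a j ≤ eLpNorm U 2 μ := fun j => by
    have := (ENNReal.le_tsum j).trans hsum
    exact (ENNReal.pow_le_pow_left_iff two_ne_zero).1 this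
  -- summation
  have hpt : ∀ x, ‖u x‖ₑ ^ q ≤ ∑' j : ℤ, ({x | (2 : ℝ) ^ (j + 1) < |u x|}).indicator
      (fun _ => ENNReal.ofReal (2 ^ (j + 2)) ^ q) x := by
    intro x
    rcases eq_or_ne (u x) 0 with h0 | h0
    · simp [h0, (by linarith : (0 : ℝ) < q)]
    · obtain ⟨n, hn1, hn2⟩ := exists_mem_Ioc_zpow (abs_pos.2 h0) (one_lt_two (α := ℝ))
      refine le_trans ?_ (ENNReal.le_tsum (n - 1))
      rw [indicator_of_mem (by simpa using hn1)]
      gcongr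
      rw [← ofReal_norm, Real.norm_eq_abs]
      refine ENNReal.ofReal_le_ofReal (hn2.trans (le_of_eq ?_))
      congr 1; ring
  calc ∫⁻ x, ‖u x‖ₑ ^ q ∂μ
      ≤ ∫⁻ x, ∑' j : ℤ, ({x | (2 : ℝ) ^ (j + 1) < |u x|}).indicator
          (fun _ => ENNReal.ofReal (2 ^ (j + 2)) ^ q) x ∂μ := lintegral_mono hpt
    _ = ∑' j : ℤ, ENNReal.ofReal (2 ^ (j + 2)) ^ q * μ {x | (2 : ℝ) ^ (j + 1) < |u x|} := by
        have hn : ∀ j : ℤ, NullMeasurableSet {x | (2 : ℝ) ^ (j + 1) < |u x|} μ := fun j =>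
          nullMeasurableSet_lt aemeasurable_const hum.norm
        rw [lintegral_tsum fun j => aemeasurable_const.indicator₀ (hn j)]
        exact tsum_congr fun j => lintegral_indicator_const₀ (hn j) _
    _ ≤ ∑' j : ℤ, C * 8 ^ q * (eLpNorm U 2 μ ^ (q - 2) * a j ^ 2) := by
        refine ENNReal.tsum_le_tsum fun j => ?_
        refine (mul_le_mul_right (hlevel j) _).trans ?_
        have h8 : ENNReal.ofReal (2 ^ (j + 2)) * (a j / ENNReal.ofReal (2 ^ (j - 1))) = 8 * a j := by
          have e : (2 : ℝ) ^ (j + 2) = 8 * 2 ^ (j - 1) := by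
            rw [show j + 2 = 3 + (j - 1) by ring, zpow_add₀ two_ne_zero]; norm_num
          rw [e, ENNReal.ofReal_mul (by norm_num), mul_assoc, ENNReal.mul_div_cancel]
          · simp
          · simp; positivity
          · exact ENNReal.ofReal_ne_top
        -- Since q > 2, the excess power is spent on the total energy, and what remains, the squares
        -- a_j², is summable because the shells are disjoint.
        have hpow : a j ^ q ≤ eLpNorm U 2 μ ^ (q - 2) * a j ^ 2 := by
          have : a j ^ q = a j ^ (q - 2) * a j ^ 2 := by
            rw [← ENNReal.rpow_natCast, ← ENNReal.rpow_add_of_nonneg _ _ (by linarith) (by simp)]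
            congr 1; push_cast; ring
          rw [this]
          gcongr
          exact haU j
        calc _ = C * (ENNReal.ofReal (2 ^ (j + 2)) * (a j / ENNReal.ofReal (2 ^ (j - 1)))) ^ q := by
              rw [ENNReal.mul_rpow_of_nonneg _ _ (by linarith)]; ring
          _ = C * 8 ^ q * a j ^ q := by
              rw [h8, ENNReal.mul_rpow_of_nonneg _ _ (by linarith), mul_assoc]
          _ ≤ _ := by gcongr
    _ = C * 8 ^ q * (eLpNorm U 2 μ ^ (q - 2) * ∑' j, a j ^ 2) := by
        rw [ENNReal.tsum_mul_left, ENNReal.tsum_mul_left]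
    _ ≤ C * 8 ^ q * (eLpNorm U 2 μ ^ (q - 2) * eLpNorm U 2 μ ^ 2) := by gcongr
    _ = _ := by
        rw [← ENNReal.rpow_natCast, ← ENNReal.rpow_add_of_nonneg _ _ (by linarith) (by simp)]
        push_cast
        rw [ENNReal.coe_rpow_of_nonneg _ (by linarith)]
        congr 2
        ring

end XElliptic

/-! ### Energy estimates for differences of solutions -/

theorem primitive_congr {b c : ℝ → ℝ} {s : ℝ} (h : ∀ x, |x| ≤ |s| → b x = c x) :
    primitive b s = primitive c s := by
  refine intervalIntegral.integral_congr fun x hx => h x ?_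
  have := abs_sub_left_of_mem_uIcc hx
  simpa using this

theorem trunc_mem_Icc {k : ℝ} (hk : 0 ≤ k) (s : ℝ) : trunc k s ∈ Icc (-k) k :=
  abs_le.1 (abs_trunc_le hk s)

theorem Continuous.exists_abs_comp_trunc_le {b : ℝ → ℝ} (hb : Continuous b) {k : ℝ} (hk : 0 ≤ k) :
    ∃ M, 0 ≤ M ∧ ∀ s, |b (trunc k s)| ≤ M := by
  obtain ⟨M, hM⟩ := (isCompact_Icc (a := -k) (b := k)).exists_bound_of_continuousOn hb.continuousOn
  exact ⟨M, (norm_nonneg _).trans (hM _ (trunc_mem_Icc hk 0)), fun s => hM _ (trunc_mem_Icc hk s)⟩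

theorem continuous_primitive_of_continuous {b : ℝ → ℝ} (hb : Continuous b) :
    Continuous (primitive b) :=
  continuous_iff_continuousAt.2 fun s => (hasDerivAt_primitive hb s).continuousAt

/-- The energy estimates satisfied by the differences `w` of solutions of an elliptic equation,
with gradient `W` and datum `h`. -/
structure EnergyEstimate {α F : Type*} [MeasurableSpace α] [NormedAddCommGroup F] (μ : Measure α)
    (σ : ℝ) (K : ℝ≥0) (h w : α → ℝ) (W : α → F) : Prop where
  memLp : MemLp h 1 μ
  meas : AEStronglyMeasurable w μ
  meas_grad : AEStronglyMeasurable W μ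
  energy : ∀ k : ℝ, 0 < k → ∀ b : ℝ → ℝ, Continuous b → (∀ s, 0 ≤ b s) →
    ∫⁻ x, ENNReal.ofReal ((Ioo (-k) k).indicator b (w x)) * ‖W x‖ₑ ^ 2 ∂μ ≤
      K * ∫⁻ x, ‖h x‖ₑ * ‖primitive b (trunc k (w x))‖ₑ ∂μ
  sobolev : ∀ k : ℝ, 0 < k → ∀ b : ℝ → ℝ, Continuous b → (∀ s, 0 ≤ b s) →
    ∫⁻ x, ‖primitive (fun s => √(b s)) (trunc k (w x))‖ₑ ^ (2 * σ) ∂μ ≤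
      (K * ∫⁻ x, ‖h x‖ₑ * ‖primitive b (trunc k (w x))‖ₑ ∂μ) ^ σ

namespace EnergyEstimate

variable {α F : Type*} [MeasurableSpace α] [NormedAddCommGroup F] {μ : Measure α}
  {σ : ℝ} {K : ℝ≥0} {h w : α → ℝ} {W : α → F}

/-- The test function B(T_k ·) is bounded and continuous, so replacing hₙ by h costs M‖hₙ - h‖₁ and
the rest converges by domination. Only convergent majorants are produced, which is all that the
Fatou arguments need. -/
theorem tendsto_lintegral {hn wn : ℕ → α → ℝ} (hh : MemLp h 1 μ)
    (hhn : ∀ n, AEStronglyMeasurable (hn n) μ) (hwn : ∀ n, AEStronglyMeasurable (wn n) μ)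
    (hlim : Tendsto (fun n => eLpNorm (hn n - h) 1 μ) atTop (𝓝 0))
    (hw : ∀ᵐ x ∂μ, Tendsto (fun n => wn n x) atTop (𝓝 (w x)))
    {k : ℝ} (hk : 0 < k) {b : ℝ → ℝ} (hb : Continuous b) :
    ∃ a : ℕ → ℝ≥0∞, Tendsto a atTop
      (𝓝 (∫⁻ x, ‖h x‖ₑ * ‖primitive b (trunc k (w x))‖ₑ ∂μ)) ∧
      ∀ n, ∫⁻ x, ‖hn n x‖ₑ * ‖primitive b (trunc k (wn n x))‖ₑ ∂μ ≤ a n := by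
  have hH := continuous_primitive_of_continuous hb
  obtain ⟨M, hM0, hM⟩ := hH.exists_abs_comp_trunc_le hk.le
  have hM' : ∀ s, ‖primitive b (trunc k s)‖ₑ ≤ ENNReal.ofReal M := fun s => by
    rw [← ofReal_norm]
    exact ENNReal.ofReal_le_ofReal (hM s)
  have hc : Continuous fun s => primitive b (trunc k s) := hH.comp (continuous_trunc k)
  refine ⟨fun n => eLpNorm (hn n - h) 1 μ * ENNReal.ofReal M +
    ∫⁻ x, ‖h x‖ₑ * ‖primitive b (trunc k (wn n x))‖ₑ ∂μ, ?_, fun n => ?_⟩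
  · rw [← zero_add (∫⁻ x, ‖h x‖ₑ * ‖primitive b (trunc k (w x))‖ₑ ∂μ)]
    refine Tendsto.add ?_ ?_
    · have := ENNReal.Tendsto.mul_const hlim (b := ENNReal.ofReal M)
        (Or.inr ENNReal.ofReal_ne_top)
      rwa [zero_mul] at this
    · refine tendsto_lintegral_of_dominated_convergence' (fun x => ‖h x‖ₑ * ENNReal.ofReal M)
        (fun n => hh.1.enorm.mul (hc.comp_aestronglyMeasurable (hwn n)).enorm)
        (fun n => Eventually.of_forall fun x => by dsimp only; gcongr; exact hM' _) ?_ ?_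
      · rw [lintegral_mul_const' _ _ ENNReal.ofReal_ne_top, ← eLpNorm_one_eq_lintegral_enorm]
        exact ENNReal.mul_ne_top hh.2.ne ENNReal.ofReal_ne_top
      · filter_upwards [hw] with x hx
        refine ENNReal.Tendsto.const_mul ?_ (Or.inr enorm_ne_top)
        exact ((continuous_enorm.comp hc).tendsto (w x)).comp hx
  · dsimp only
    rw [eLpNorm_one_eq_lintegral_enorm, ← lintegral_mul_const' _ _ ENNReal.ofReal_ne_top,
      ← lintegral_add_left' (((hhn n).sub hh.1).enorm.mul_const _)]
    refine lintegral_mono fun x => ?_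
    calc ‖hn n x‖ₑ * ‖primitive b (trunc k (wn n x))‖ₑ
        ≤ (‖hn n x - h x‖ₑ + ‖h x‖ₑ) * ‖primitive b (trunc k (wn n x))‖ₑ := by
          gcongr
          simpa using enorm_add_le (hn n x - h x) (h x)
      _ ≤ _ := by
          rw [add_mul]
          gcongr
          · exact le_rfl
          · exact hM' _

/-- The energy estimates pass to the limit. -/
theorem of_tendsto (hσ : 0 ≤ σ) {hn wn : ℕ → α → ℝ} {Wn : ℕ → α → F}
    (H : ∀ n, EnergyEstimate μ σ K (hn n) (wn n) (Wn n)) (hh : MemLp h 1 μ)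
    (hlim : Tendsto (fun n => eLpNorm (hn n - h) 1 μ) atTop (𝓝 0))
    (hw : ∀ᵐ x ∂μ, Tendsto (fun n => wn n x) atTop (𝓝 (w x)))
    (hW : ∀ᵐ x ∂μ, Tendsto (fun n => Wn n x) atTop (𝓝 (W x))) :
    EnergyEstimate μ σ K h w W where
  memLp := hh
  meas := aestronglyMeasurable_of_tendsto_ae atTop (fun n => (H n).meas) hw
  meas_grad := aestronglyMeasurable_of_tendsto_ae atTop (fun n => (H n).meas_grad) hW
  energy k hk b hb hb0 := by
    obtain ⟨a, ha, hle⟩ := tendsto_lintegral hh (fun n => (H n).memLp.1) (fun n => (H n).meas)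
      hlim hw hk hb
    have hfin : (K : ℝ≥0∞) ≠ ⊤ := ENNReal.coe_ne_top
    rw [← (ENNReal.Tendsto.const_mul ha (Or.inr hfin)).liminf_eq]
    refine le_trans (lintegral_mono_ae ?_) ((lintegral_liminf_le' (fun n => ?_)).trans
      (liminf_le_liminf (Eventually.of_forall fun n => ((H n).energy k hk b hb hb0).trans
        (mul_le_mul_right (hle n) _))))
    · filter_upwards [hw, hW] with x hx hx'
      -- Inside the open interval wₙ(x) eventually stays there and the integrands converge; outside,
      -- the limit integrand is 0. This lower semicontinuity is why the interval is open.
      by_cases hxk : w x ∈ Ioo (-k) k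
      · refine le_of_eq (Tendsto.liminf_eq ?_).symm
        have e : ∀ᶠ n in atTop, wn n x ∈ Ioo (-k) k := hx.eventually_mem (isOpen_Ioo.mem_nhds hxk)
        rw [indicator_of_mem hxk]
        have h1 : Tendsto (fun n => ENNReal.ofReal (b (wn n x)) * ‖Wn n x‖ₑ ^ 2) atTop
            (𝓝 (ENNReal.ofReal (b (w x)) * ‖W x‖ₑ ^ 2)) := by
          refine ENNReal.Tendsto.mul (ENNReal.tendsto_ofReal ((hb.tendsto _).comp hx))
            (Or.inr (by finiteness)) ?_ (Or.inr ENNReal.ofReal_ne_top)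
          exact ((ENNReal.continuous_pow 2).tendsto _).comp ((continuous_enorm.tendsto _).comp hx')
        refine h1.congr' ?_
        filter_upwards [e] with n hn
        rw [indicator_of_mem hn]
      · rw [indicator_of_notMem hxk]
        simp
    · exact ((hb.measurable.indicator measurableSet_Ioo).comp_aemeasurable
        (H n).meas.aemeasurable).ennreal_ofReal.mul ((H n).meas_grad.enorm.pow_const 2)
  sobolev k hk b hb hb0 := by
    obtain ⟨a, ha, hle⟩ := tendsto_lintegral hh (fun n => (H n).memLp.1) (fun n => (H n).meas)
      hlim hw hk hb
    have hfin : (K : ℝ≥0∞) ≠ ⊤ := ENNReal.coe_ne_top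
    have hc : Continuous fun s => primitive (fun s => √(b s)) (trunc k s) :=
      (continuous_primitive_of_continuous hb.sqrt).comp (continuous_trunc k)
    rw [← (((ENNReal.continuous_rpow_const (y := σ)).tendsto _).comp
      (ENNReal.Tendsto.const_mul ha (Or.inr hfin))).liminf_eq]
    refine le_trans (lintegral_mono_ae ?_) ((lintegral_liminf_le' (fun n => ?_)).trans
      (liminf_le_liminf (Eventually.of_forall fun n => ((H n).sobolev k hk b hb hb0).trans
        (ENNReal.rpow_le_rpow (mul_le_mul_right (hle n) _) hσ))))
    · filter_upwards [hw] with x hx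
      refine le_of_eq (Tendsto.liminf_eq ?_).symm
      exact ((ENNReal.continuous_rpow_const.comp (continuous_enorm.comp hc)).tendsto _).comp hx
    · exact ((hc.comp_aestronglyMeasurable (H n).meas).enorm).pow_const _

end EnergyEstimate

namespace XElliptic

variable {N m : ℕ} {X : Fin m → E N → E N} {Ω : Set (E N)} {Q α : ℝ}
  {A : E N → Matrix (Fin m) (Fin m) ℝ} {f g u v : E N → ℝ} {U V : E N → E m}

/-- `u` is a weak solution of `X^*(A X u) = f` and `U = X u`. -/
def IsWeakSolutionWith (X : Fin m → E N → E N) (Ω : Set (E N))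
    (A : E N → Matrix (Fin m) (Fin m) ℝ) (f u : E N → ℝ) (U : E N → E m) : Prop :=
  MemW0 X Ω 2 u U ∧ ∀ (v : E N → ℝ) (V : E N → E m), MemW0 X Ω 2 v V →
    Integrable (fun x => (A x *ᵥ (U x).ofLp) ⬝ᵥ (V x).ofLp) (volume.restrict Ω) ∧
      ∫ x in Ω, (A x *ᵥ (U x).ofLp) ⬝ᵥ (V x).ofLp = ∫ x in Ω, f x * v x

/-- b itself may be unbounded, but b ∘ T_k is bounded and continuous, so the chain rule applies to
it at T_k u; on the range of T_k it has the same primitive as b. -/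
theorem MemW0.primitive_trunc (hX : ∀ j, Continuous (X j)) {p : ℝ≥0∞} (hp : 1 ≤ p) (hp' : p ≠ ⊤)
    {k : ℝ} (hk : 0 < k) {b : ℝ → ℝ} (hb : Continuous b) (hu : MemW0 X Ω p u U) :
    MemW0 X Ω p (fun x => primitive b (trunc k (u x)))
      (fun x => (Ioo (-k) k).indicator b (u x) • U x) := by
  obtain ⟨M, -, hM⟩ := hb.exists_abs_comp_trunc_le hk.le
  have h1 := (hu.truncate hX hp hp' hk).comp_continuous hX hp hp' (hb.comp (continuous_trunc k)) hM
  have e1 : (primitive (b ∘ trunc k) ∘ fun x => trunc k (u x)) =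
      fun x => primitive b (trunc k (u x)) := by
    funext x
    refine primitive_congr fun y hy => ?_
    rw [Function.comp_apply, trunc_eq_self (hy.trans (abs_trunc_le hk.le _))]
  have e2 : (fun x => (b ∘ trunc k) (trunc k (u x)) •
      (Ioo (-k) k).indicator (1 : ℝ → ℝ) (u x) • U x) =
      fun x => (Ioo (-k) k).indicator b (u x) • U x := by
    funext x
    by_cases hx : u x ∈ Ioo (-k) k
    · have h2 : |u x| ≤ k := (abs_lt.2 hx).le
      rw [indicator_of_mem hx, indicator_of_mem hx, Function.comp_apply, trunc_eq_self h2,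
        trunc_eq_self h2, Pi.one_apply, one_smul]
    · simp [indicator_of_notMem hx]
  rwa [e1, e2] at h1

/-- Subtract the two weak formulations with test function B(T_k w), whose gradient is b(w)1_{|w|<k}
W; coercivity bounds the left side below by α. For the second estimate, the gradient of the
primitive of √b has square b(w)1_{|w|<k}|W|², so the Sobolev inequality applies to it directly. -/
theorem IsAdmissible.exists_energyEstimate (hN : 2 ≤ N) (hX : IsAdmissible X Ω Q) (hα : 0 < α) :
    ∃ K : ℝ≥0, ∀ (A : E N → Matrix (Fin m) (Fin m) ℝ) (f g u v : E N → ℝ) (U V : E N → E m),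
      IsElliptic Ω α A → MemLp f 1 (volume.restrict Ω) → MemLp g 1 (volume.restrict Ω) →
      IsWeakSolutionWith X Ω A f u U → IsWeakSolutionWith X Ω A g v V →
      EnergyEstimate (volume.restrict Ω) (Q / (Q - 2)) K (f - g) (u - v) (U - V) := by
  obtain ⟨S, hS⟩ := hX.exists_sobolev hN
  have hQ := hX.two_lt
  set σ := Q / (Q - 2) with hσ
  have hσ0 : 0 < σ := div_pos (by linarith) (by linarith)
  have h2σ : 2 * Q / (Q - 2) = 2 * σ := by rw [hσ]; ring
  -- One constant for both families: 1/α serves the energy, S^{1/σ}/α the Sobolev estimate after it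
  -- is taken inside the power σ.
  refine ⟨(1 + S ^ (1 / σ)) * (α.toNNReal)⁻¹, fun A f g u v U V hA hf hg hu hv => ?_⟩
  set μ := volume.restrict Ω
  have hw : MemW0 X Ω 2 (u - v) (U - V) := hu.1.sub hX.continuous_field one_le_two hv.1
  have hαc : (α.toNNReal : ℝ≥0∞) = ENNReal.ofReal α := rfl
  have hα0 : (α.toNNReal : ℝ≥0) ≠ 0 := by simpa using hα
  have key : ∀ k : ℝ, 0 < k → ∀ b : ℝ → ℝ, Continuous b → (∀ s, 0 ≤ b s) →
      ∫⁻ x, ENNReal.ofReal ((Ioo (-k) k).indicator b ((u - v) x)) * ‖(U - V) x‖ₑ ^ 2 ∂μ ≤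
        ((α.toNNReal)⁻¹ : ℝ≥0) *
          ∫⁻ x, ‖(f - g) x‖ₑ * ‖primitive b (trunc k ((u - v) x))‖ₑ ∂μ := by
    intro k hk b hb hb0
    obtain ⟨M, hM0, hM⟩ := (continuous_primitive_of_continuous hb).exists_abs_comp_trunc_le hk.le
    have hφ := hw.primitive_trunc hX.continuous_field one_le_two ENNReal.ofNat_ne_top hk hb
    obtain ⟨i1, e1⟩ := hu.2 _ _ hφ
    obtain ⟨i2, e2⟩ := hv.2 _ _ hφ
    -- Because the test function is bounded, L¹ data make the right-hand sides genuine integrals, so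
    -- they may be subtracted.
    have hint : ∀ {f : E N → ℝ}, MemLp f 1 μ →
        Integrable (fun x => f x * primitive b (trunc k ((u - v) x))) μ := fun hf =>
      (memLp_one_iff_integrable.1 hf).mul_bdd (c := M) hφ.1.1 (Eventually.of_forall fun x => hM _)
    have e3 : ∫ x, ((A x *ᵥ (U x).ofLp) ⬝ᵥ ((Ioo (-k) k).indicator b ((u - v) x) • (U - V) x).ofLp -
        (A x *ᵥ (V x).ofLp) ⬝ᵥ ((Ioo (-k) k).indicator b ((u - v) x) • (U - V) x).ofLp) ∂μ =
        ∫ x, (f - g) x * primitive b (trunc k ((u - v) x)) ∂μ := by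
      rw [integral_sub i1 i2, e1, e2, ← integral_sub (hint hf) (hint hg)]
      simp only [Pi.sub_apply, sub_mul]
    obtain ⟨-, β, -, hell⟩ := hA
    have hpt : ∀ᵐ x ∂μ, α * ((Ioo (-k) k).indicator b ((u - v) x) * ‖(U - V) x‖ ^ 2) ≤
        (A x *ᵥ (U x).ofLp) ⬝ᵥ ((Ioo (-k) k).indicator b ((u - v) x) • (U - V) x).ofLp -
        (A x *ᵥ (V x).ofLp) ⬝ᵥ ((Ioo (-k) k).indicator b ((u - v) x) • (U - V) x).ofLp := by
      filter_upwards [hell] with x hx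
      have h1 := (hx ((U - V) x).ofLp).1
      have h2 : ((U - V) x).ofLp ⬝ᵥ ((U - V) x).ofLp = ‖(U - V) x‖ ^ 2 := by
        rw [EuclideanSpace.real_norm_sq_eq]
        simp [dotProduct, sq]
      have h3 : 0 ≤ (Ioo (-k) k).indicator b ((u - v) x) := indicator_nonneg (fun s _ => hb0 s) _
      rw [← sub_dotProduct, ← Matrix.mulVec_sub, WithLp.ofLp_smul, dotProduct_smul, smul_eq_mul]
      rw [h2] at h1
      have h4 := mul_le_mul_of_nonneg_left h1 h3
      calc _ = (Ioo (-k) k).indicator b ((u - v) x) * (α * ‖(U - V) x‖ ^ 2) := by ring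
        _ ≤ _ := h4
    have hnn : 0 ≤ᵐ[μ] fun x =>
        (A x *ᵥ (U x).ofLp) ⬝ᵥ ((Ioo (-k) k).indicator b ((u - v) x) • (U - V) x).ofLp -
        (A x *ᵥ (V x).ofLp) ⬝ᵥ ((Ioo (-k) k).indicator b ((u - v) x) • (U - V) x).ofLp := by
      filter_upwards [hpt] with x hx
      refine le_trans ?_ hx
      have h3 : 0 ≤ (Ioo (-k) k).indicator b ((u - v) x) := indicator_nonneg (fun s _ => hb0 s) _
      positivity
    have main : ENNReal.ofReal α *
        ∫⁻ x, ENNReal.ofReal ((Ioo (-k) k).indicator b ((u - v) x)) * ‖(U - V) x‖ₑ ^ 2 ∂μ ≤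
        ∫⁻ x, ‖(f - g) x‖ₑ * ‖primitive b (trunc k ((u - v) x))‖ₑ ∂μ := by
      rw [← lintegral_const_mul' _ _ ENNReal.ofReal_ne_top]
      calc _ ≤ ∫⁻ x, ENNReal.ofReal
            ((A x *ᵥ (U x).ofLp) ⬝ᵥ ((Ioo (-k) k).indicator b ((u - v) x) • (U - V) x).ofLp -
            (A x *ᵥ (V x).ofLp) ⬝ᵥ ((Ioo (-k) k).indicator b ((u - v) x) • (U - V) x).ofLp) ∂μ := by
            refine lintegral_mono_ae ?_
            filter_upwards [hpt] with x hx
            refine le_trans (le_of_eq ?_) (ENNReal.ofReal_le_ofReal hx)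
            rw [ENNReal.ofReal_mul hα.le, ENNReal.ofReal_mul (indicator_nonneg (fun s _ => hb0 s) _),
              ENNReal.ofReal_pow (norm_nonneg _), ofReal_norm]
        _ = ENNReal.ofReal (∫ x, (f - g) x * primitive b (trunc k ((u - v) x)) ∂μ) := by
            rw [← e3]
            exact (ofReal_integral_eq_lintegral_ofReal (i1.sub i2) hnn).symm
        _ ≤ ∫⁻ x, ‖(f - g) x * primitive b (trunc k ((u - v) x))‖ₑ ∂μ :=
            ((ENNReal.ofReal_le_ofReal (le_abs_self _)).trans
              (by rw [← Real.norm_eq_abs, ofReal_norm])).trans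
              (enorm_integral_le_lintegral_enorm _)
        _ = _ := by simp only [enorm_mul]
    rw [ENNReal.coe_inv hα0, hαc]
    rwa [← ENNReal.div_eq_inv_mul, ENNReal.le_div_iff_mul_le (by simp [hα]) (by simp), mul_comm]
  refine ⟨hf.sub hg, hw.1.1, hw.2.1.1, fun k hk b hb hb0 => (key k hk b hb hb0).trans ?_,
    fun k hk b hb hb0 => ?_⟩
  · gcongr
    exact le_mul_of_one_le_left zero_le (by simp)
  · have h1 := hS _ _ (hw.primitive_trunc hX.continuous_field one_le_two ENNReal.ofNat_ne_top hk
      hb.sqrt)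
    rw [h2σ] at h1
    refine h1.trans ?_
    have h3 : eLpNorm (fun x => (Ioo (-k) k).indicator (fun s => √(b s)) ((u - v) x) • (U - V) x) 2
        μ ^ (2 * σ) = (∫⁻ x, ENNReal.ofReal ((Ioo (-k) k).indicator b ((u - v) x)) *
          ‖(U - V) x‖ₑ ^ 2 ∂μ) ^ σ := by
      rw [eLpNorm_eq_lintegral_rpow_enorm_toReal two_ne_zero ENNReal.ofNat_ne_top,
        ← ENNReal.rpow_mul]
      congr 1
      · refine lintegral_congr fun x => ?_
        rw [ENNReal.toReal_ofNat, ENNReal.rpow_two, enorm_smul, mul_pow]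
        congr 1
        by_cases hx : (u - v) x ∈ Ioo (-k) k
        · rw [indicator_of_mem hx, indicator_of_mem hx, ← ofReal_norm, ← ENNReal.ofReal_pow
            (norm_nonneg _), Real.norm_of_nonneg (Real.sqrt_nonneg _), Real.sq_sqrt (hb0 _)]
        · rw [indicator_of_notMem hx, indicator_of_notMem hx]
          simp
      · simp
    rw [h3]
    calc _ ≤ (S : ℝ≥0∞) * (((α.toNNReal)⁻¹ : ℝ≥0) *
          ∫⁻ x, ‖(f - g) x‖ₑ * ‖primitive b (trunc k ((u - v) x))‖ₑ ∂μ) ^ σ := by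
          gcongr
          exact key k hk b hb hb0
      _ = ((S ^ (1 / σ) * (α.toNNReal)⁻¹ : ℝ≥0) *
          ∫⁻ x, ‖(f - g) x‖ₑ * ‖primitive b (trunc k ((u - v) x))‖ₑ ∂μ) ^ σ := by
          rw [ENNReal.coe_mul, mul_assoc, ENNReal.mul_rpow_of_nonneg (S ^ (1 / σ) : ℝ≥0) _ hσ0.le,
            ENNReal.coe_rpow_of_nonneg _ (by positivity), ← ENNReal.rpow_mul,
            one_div_mul_cancel hσ0.ne', ENNReal.rpow_one]
      _ ≤ _ := by
          gcongr
          exact le_add_of_nonneg_left zero_le_one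

end XElliptic

/-! ### Scaling and the Marcinkiewicz estimates -/

theorem trunc_mul {c : ℝ} (hc : 0 < c) (k s : ℝ) : trunc k (c * s) = c * trunc (k / c) s := by
  have h : k = c * (k / c) := by field_simp
  unfold trunc
  rw [mul_max_of_nonneg _ _ hc.le, mul_min_of_nonneg _ _ hc.le, mul_neg, ← h]

theorem primitive_mul (b : ℝ → ℝ) (c s : ℝ) :
    primitive b (c * s) = c * primitive (fun x => b (c * x)) s := by
  unfold primitive
  have := intervalIntegral.smul_integral_comp_mul_left b c (a := 0) (b := s)
  rw [mul_zero] at this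
  exact this.symm

/-- Allows normalising by the norm of the datum even if it vanishes: divide by any ε > 0 above it,
then let ε decrease to it. -/
theorem ENNReal.le_mul_of_forall_ofReal {x e : ℝ≥0∞} {C : ℝ≥0} (he : e ≠ ⊤)
    (H : ∀ ε : ℝ, 0 < ε → e ≤ ENNReal.ofReal ε → x ≤ C * ENNReal.ofReal ε) : x ≤ C * e := by
  have h1 : Tendsto (fun n : ℕ => C * ENNReal.ofReal (e.toReal + 1 / ((n : ℝ) + 1))) atTop
      (𝓝 (C * ENNReal.ofReal (e.toReal + 0))) :=
    ENNReal.Tendsto.const_mul (ENNReal.tendsto_ofReal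
      (tendsto_one_div_add_atTop_nhds_zero_nat.const_add _)) (Or.inr ENNReal.coe_ne_top)
  rw [add_zero, ENNReal.ofReal_toReal he] at h1
  refine ge_of_tendsto' h1 fun n => H _ (by positivity) ?_
  rw [← ENNReal.ofReal_toReal he]
  refine ENNReal.ofReal_le_ofReal ?_
  rw [ENNReal.ofReal_toReal he]
  have : (0 : ℝ) < 1 / ((n : ℝ) + 1) := by positivity
  linarith

/-- A function in weak `L^a`, `1 < a`, over a finite measure space is integrable. -/
theorem MeasureTheory.lintegral_enorm_le_of_weak {α F : Type*} [MeasurableSpace α]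
    [NormedAddCommGroup F] {μ : Measure α} {W : α → F} (hW : AEStronglyMeasurable W μ) {a : ℝ}
    (ha : 1 < a) {C : ℝ≥0∞} (h : ∀ t : ℝ, 0 < t → μ {x | t ≤ ‖W x‖} ≤ C * ENNReal.ofReal (t ^ (-a))) :
    ∫⁻ x, ‖W x‖ₑ ∂μ ≤ μ univ + C * ENNReal.ofReal (1 / (a - 1)) := by
  have h1 := lintegral_eq_lintegral_meas_le μ (f := fun x => ‖W x‖)
    (Eventually.of_forall fun x => norm_nonneg _) hW.norm.aemeasurable
  simp only [ofReal_norm] at h1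
  rw [h1, ← Ioc_union_Ioi_eq_Ioi zero_le_one]
  refine (lintegral_union_le _ _ _).trans (add_le_add ?_ ?_)
  · calc ∫⁻ t in Ioc (0 : ℝ) 1, μ {x | t ≤ ‖W x‖} ≤ ∫⁻ t in Ioc (0 : ℝ) 1, μ univ :=
        lintegral_mono fun t => measure_mono (subset_univ _)
      _ = μ univ := by simp
  · calc ∫⁻ t in Ioi (1 : ℝ), μ {x | t ≤ ‖W x‖}
        ≤ ∫⁻ t in Ioi (1 : ℝ), C * ENNReal.ofReal (t ^ (-a)) :=
          setLIntegral_mono_ae' measurableSet_Ioi (Eventually.of_forall fun t ht =>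
            h t (one_pos.trans ht))
      _ = C * ∫⁻ t in Ioi (1 : ℝ), ENNReal.ofReal (t ^ (-a)) :=
          lintegral_const_mul _ (by fun_prop)
      _ = C * ENNReal.ofReal (∫ t in Ioi (1 : ℝ), t ^ (-a)) := by
          rw [ofReal_integral_eq_lintegral_ofReal
            (integrableOn_Ioi_rpow_of_lt (by linarith) one_pos)]
          exact (ae_restrict_iff' measurableSet_Ioi).2 (Eventually.of_forall fun t ht =>
            Real.rpow_nonneg (one_pos.trans ht).le _)
      _ = _ := by
          rw [integral_Ioi_rpow_of_lt (by linarith) one_pos, Real.one_rpow]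
          congr 2
          rw [neg_div, ← div_neg]
          congr 1
          ring

theorem Set.setOf_le_norm_eq_smul {α F : Type*} [NormedAddCommGroup F] [NormedSpace ℝ F]
    {c : ℝ} (hc : 0 < c) (t : ℝ) (G : α → F) :
    {x | t ≤ ‖G x‖} = {x | c⁻¹ * t ≤ ‖(c⁻¹ • G) x‖} := by
  ext x
  have : 0 < c⁻¹ := inv_pos.2 hc
  rw [mem_ofPred_eq, mem_ofPred_eq, Pi.smul_apply, norm_smul, Real.norm_of_nonneg this.le,
    mul_le_mul_iff_right₀ this]

namespace EnergyEstimate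

variable {α F : Type*} [MeasurableSpace α] [NormedAddCommGroup F]
  {μ : Measure α} {σ : ℝ} {K : ℝ≥0} {h w : α → ℝ} {W : α → F}

theorem primitive_one (s : ℝ) : primitive (fun _ => 1) s = s := by simp [primitive]

theorem lintegral_trunc_le (hh : eLpNorm h 1 μ ≤ 1) {k : ℝ} (hk : 0 < k) :
    ∫⁻ x, ‖h x‖ₑ * ‖primitive (fun _ => 1) (trunc k (w x))‖ₑ ∂μ ≤ ENNReal.ofReal k := by
  calc _ ≤ ∫⁻ x, ‖h x‖ₑ * ENNReal.ofReal k ∂μ := by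
        refine lintegral_mono fun x => ?_
        gcongr
        rw [primitive_one, ← ofReal_norm]
        exact ENNReal.ofReal_le_ofReal (abs_trunc_le hk.le _)
    _ = eLpNorm h 1 μ * ENNReal.ofReal k := by
        rw [lintegral_mul_const' _ _ ENNReal.ofReal_ne_top, eLpNorm_one_eq_lintegral_enorm]
    _ ≤ _ := mul_le_of_le_one_left zero_le hh

/-- With b = 1 the right-hand side is at most (Kk)^σ, while |T_k w| = k where |w| ≥ k; Chebyshev
leaves K^σ k^σ / k^{2σ}. -/
theorem measure_le_of_le_one (hσ : 0 < σ) (H : EnergyEstimate μ σ K h w W)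
    (hh : eLpNorm h 1 μ ≤ 1) {k : ℝ} (hk : 0 < k) :
    μ {x | k ≤ |w x|} ≤ (K : ℝ≥0∞) ^ σ * ENNReal.ofReal (k ^ (-σ)) := by
  have h1 := (H.sobolev k hk (fun _ => 1) continuous_const (by simp)).trans
    (ENNReal.rpow_le_rpow (mul_le_mul_right (lintegral_trunc_le hh hk) _) hσ.le)
  simp only [Real.sqrt_one, primitive_one] at h1
  have h2 : ENNReal.ofReal k ^ (2 * σ) * μ {x | k ≤ |w x|} ≤
      ∫⁻ x, ‖trunc k (w x)‖ₑ ^ (2 * σ) ∂μ := by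
    refine le_trans ?_ (mul_meas_ge_le_lintegral₀
      (((continuous_trunc k).comp_aestronglyMeasurable H.meas).enorm.pow_const _) (ENNReal.ofReal k ^ (2 * σ)))
    gcongr
    rename_i x
    intro hx
    gcongr
    rw [← ofReal_norm, Real.norm_eq_abs, abs_trunc hk.le, min_eq_right hx]
  have hk0 : ENNReal.ofReal k ^ (2 * σ) ≠ 0 := by
    simp [hk, ENNReal.rpow_eq_zero_iff]
  have hk1 : ENNReal.ofReal k ^ (2 * σ) ≠ ⊤ := by finiteness
  have h3 := h2.trans h1
  rw [mul_comm, ← ENNReal.le_div_iff_mul_le (Or.inl hk0) (Or.inl hk1)] at h3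
  refine h3.trans (le_of_eq ?_)
  rw [ENNReal.mul_rpow_of_nonneg _ _ hσ.le, mul_div_assoc, ENNReal.ofReal_rpow_of_pos hk,
    ENNReal.ofReal_rpow_of_pos hk, ← ENNReal.ofReal_div_of_pos (by positivity),
    ← Real.rpow_sub hk]
  congr 3
  ring

theorem measure_grad_le_of_le_one (hσ : 0 < σ) (H : EnergyEstimate μ σ K h w W)
    (hh : eLpNorm h 1 μ ≤ 1) {t : ℝ} (ht : 0 < t) :
    μ {x | t ≤ ‖W x‖} ≤
      ((K : ℝ≥0∞) ^ σ + K) * ENNReal.ofReal (t ^ (-(2 * σ / (σ + 1)))) := by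
  -- Balances the two pieces: k^{-σ} from the set |w| ≥ k, and k/t² from the energy on |w| < k.
  set k : ℝ := t ^ (2 / (σ + 1)) with hkdef
  have hk : 0 < k := by positivity
  have h1 := H.measure_le_of_le_one hσ hh hk
  have e1 : k ^ (-σ) = t ^ (-(2 * σ / (σ + 1))) := by
    rw [hkdef, ← Real.rpow_mul ht.le]; congr 1; ring
  have e2 : k / t ^ 2 = t ^ (-(2 * σ / (σ + 1))) := by
    rw [hkdef, ← Real.rpow_natCast, ← Real.rpow_sub ht]
    congr 1; field_simp; push_cast; ring
  have h2 := (H.energy k hk (fun _ => 1) continuous_const (by simp)).trans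
    (mul_le_mul_right (lintegral_trunc_le hh hk) _)
  have hmeas : AEMeasurable (fun x => ENNReal.ofReal ((Ioo (-k) k).indicator (fun _ => (1 : ℝ)) (w x)) *
      ‖W x‖ₑ ^ 2) μ :=
    ((measurable_const.indicator measurableSet_Ioo).comp_aemeasurable
      H.meas.aemeasurable).ennreal_ofReal.mul (H.meas_grad.enorm.pow_const 2)
  have h3 : ENNReal.ofReal (t ^ 2) * μ {x | |w x| < k ∧ t ≤ ‖W x‖} ≤ K * ENNReal.ofReal k := by
    refine le_trans ?_ ((mul_meas_ge_le_lintegral₀ hmeas (ENNReal.ofReal (t ^ 2))).trans h2)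
    gcongr
    rename_i x
    rintro ⟨hx, hx'⟩
    rw [indicator_of_mem (show w x ∈ Ioo (-k) k from abs_lt.1 hx), ENNReal.ofReal_one,
      one_mul, ENNReal.ofReal_pow ht.le, ← ofReal_norm]
    gcongr
  have ht0 : ENNReal.ofReal (t ^ 2) ≠ 0 := by simp; positivity
  rw [mul_comm, ← ENNReal.le_div_iff_mul_le (Or.inl ht0) (Or.inl ENNReal.ofReal_ne_top),
    mul_div_assoc, ← ENNReal.ofReal_div_of_pos (by positivity), e2] at h3
  rw [e1] at h1
  calc μ {x | t ≤ ‖W x‖} ≤ μ ({x | k ≤ |w x|} ∪ {x | |w x| < k ∧ t ≤ ‖W x‖}) := by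
        refine measure_mono fun x hx => ?_
        rcases le_or_gt k |w x| with h | h
        · exact Or.inl h
        · exact Or.inr ⟨h, hx⟩
    _ ≤ _ := (measure_union_le _ _).trans (add_le_add h1 h3)
    _ = _ := by rw [add_mul]

section scaling

variable [NormedSpace ℝ F]

/-- Replace b by b(c·) and k by k/c: both sides of the energy estimate acquire c², and both sides of
the Sobolev estimate c^{2σ}. -/
theorem const_smul (hσ : 0 ≤ σ) (H : EnergyEstimate μ σ K h w W) {c : ℝ} (hc : 0 < c) :
    EnergyEstimate μ σ K (c • h) (c • w) (c • W) := by
  have hcc : ‖c‖ₑ ≠ ⊤ := enorm_ne_top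
  have hR : ∀ k b, ∫⁻ x, ‖(c • h) x‖ₑ * ‖primitive b (trunc k ((c • w) x))‖ₑ ∂μ =
      ‖c‖ₑ ^ 2 * ∫⁻ x, ‖h x‖ₑ * ‖primitive (fun s => b (c * s)) (trunc (k / c) (w x))‖ₑ ∂μ := by
    intro k b
    rw [← lintegral_const_mul' _ _ (by finiteness)]
    refine lintegral_congr fun x => ?_
    simp only [Pi.smul_apply, smul_eq_mul, enorm_mul, trunc_mul hc, primitive_mul]
    ring
  refine ⟨H.memLp.const_smul c, H.meas.const_smul c, H.meas_grad.const_smul c,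
    fun k hk b hb hb0 => ?_, fun k hk b hb hb0 => ?_⟩
  · have h1 := H.energy (k / c) (by positivity) (fun s => b (c * s)) (by fun_prop) fun s => hb0 _
    rw [hR]
    calc _ = ‖c‖ₑ ^ 2 * ∫⁻ x, ENNReal.ofReal ((Ioo (-(k / c)) (k / c)).indicator
          (fun s => b (c * s)) (w x)) * ‖W x‖ₑ ^ 2 ∂μ := by
          rw [← lintegral_const_mul' _ _ (by finiteness)]
          refine lintegral_congr fun x => ?_
          have e : (Ioo (-k) k).indicator b ((c • w) x) =
              (Ioo (-(k / c)) (k / c)).indicator (fun s => b (c * s)) (w x) := by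
            have hiff : (c • w) x ∈ Ioo (-k) k ↔ w x ∈ Ioo (-(k / c)) (k / c) := by
              rw [mem_Ioo, mem_Ioo, ← abs_lt, ← abs_lt, Pi.smul_apply, smul_eq_mul, abs_mul,
                abs_of_pos hc, lt_div_iff₀' hc]
            by_cases hx : w x ∈ Ioo (-(k / c)) (k / c)
            · rw [indicator_of_mem hx, indicator_of_mem (hiff.2 hx)]
              rfl
            · rw [indicator_of_notMem hx, indicator_of_notMem (mt hiff.1 hx)]
          rw [e, Pi.smul_apply, enorm_smul]
          ring
      _ ≤ _ := by
          rw [mul_left_comm]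
          gcongr
  · have h1 := H.sobolev (k / c) (by positivity) (fun s => b (c * s)) (by fun_prop) fun s => hb0 _
    rw [hR]
    calc _ = (‖c‖ₑ ^ 2) ^ σ * ∫⁻ x, ‖primitive (fun s => √(b (c * s)))
          (trunc (k / c) (w x))‖ₑ ^ (2 * σ) ∂μ := by
          rw [← lintegral_const_mul' _ _ (by finiteness)]
          refine lintegral_congr fun x => ?_
          simp only [Pi.smul_apply, smul_eq_mul, trunc_mul hc, primitive_mul, enorm_mul]
          rw [ENNReal.mul_rpow_of_nonneg _ _ (by positivity), ← ENNReal.rpow_natCast,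
            ← ENNReal.rpow_mul]
          norm_num
      _ ≤ _ := by
          rw [mul_left_comm, ENNReal.mul_rpow_of_nonneg _ _ hσ]
          gcongr

theorem exists_const_smul (hσ : 0 ≤ σ) (H : EnergyEstimate μ σ K h w W) {p : ℝ≥0∞} {ε : ℝ}
    (hε : 0 < ε) (hp : eLpNorm h p μ ≤ ENNReal.ofReal ε) :
    EnergyEstimate μ σ K (ε⁻¹ • h) (ε⁻¹ • w) (ε⁻¹ • W) ∧ eLpNorm (ε⁻¹ • h) p μ ≤ 1 := by
  refine ⟨H.const_smul hσ (inv_pos.2 hε), ?_⟩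
  rw [eLpNorm_const_smul, Real.enorm_eq_ofReal (inv_pos.2 hε).le]
  calc _ ≤ ENNReal.ofReal ε⁻¹ * ENNReal.ofReal ε := by gcongr
    _ = 1 := by rw [← ENNReal.ofReal_mul (inv_pos.2 hε).le, inv_mul_cancel₀ hε.ne', ENNReal.ofReal_one]

/-- Marcinkiewicz estimate for the solution. -/
theorem measure_le (hσ : 0 < σ) (H : EnergyEstimate μ σ K h w W) {ε : ℝ} (hε : 0 < ε)
    (hh : eLpNorm h 1 μ ≤ ENNReal.ofReal ε) {t : ℝ} (ht : 0 < t) :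
    μ {x | t ≤ ‖w x‖} ≤ (K : ℝ≥0∞) ^ σ * ENNReal.ofReal ((ε / t) ^ σ) := by
  obtain ⟨H', hh'⟩ := H.exists_const_smul hσ.le hε hh
  rw [setOf_le_norm_eq_smul hε]
  refine (H'.measure_le_of_le_one hσ hh' (by positivity)).trans (le_of_eq ?_)
  rw [Real.rpow_neg (by positivity), ← Real.inv_rpow (by positivity)]
  congr 3
  field_simp

/-- Marcinkiewicz estimate for the gradient. -/
theorem measure_grad_le (hσ : 0 < σ) (H : EnergyEstimate μ σ K h w W) {ε : ℝ} (hε : 0 < ε)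
    (hh : eLpNorm h 1 μ ≤ ENNReal.ofReal ε) {t : ℝ} (ht : 0 < t) :
    μ {x | t ≤ ‖W x‖} ≤
      ((K : ℝ≥0∞) ^ σ + K) * ENNReal.ofReal ((ε / t) ^ (2 * σ / (σ + 1))) := by
  obtain ⟨H', hh'⟩ := H.exists_const_smul hσ.le hε hh
  rw [setOf_le_norm_eq_smul hε]
  refine (H'.measure_grad_le_of_le_one hσ hh' (by positivity)).trans (le_of_eq ?_)
  rw [Real.rpow_neg (by positivity), ← Real.inv_rpow (by positivity)]
  congr 3
  field_simp

/-- The weak gradient exponent 2σ/(σ+1) exceeds 1, so over a finite measure it gives an L¹ bound,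
made linear in the datum by scaling. Applied to differences of approximations, it makes their
gradients Cauchy in L¹. -/
theorem exists_eLpNorm_grad_one_le [IsFiniteMeasure μ] (hσ : 1 < σ) (K : ℝ≥0) :
    ∃ C : ℝ≥0, ∀ (h w : α → ℝ) (W : α → F), EnergyEstimate μ σ K h w W →
      eLpNorm W 1 μ ≤ C * eLpNorm h 1 μ := by
  have ha : 1 < 2 * σ / (σ + 1) := by rw [lt_div_iff₀ (by linarith)]; linarith
  set D : ℝ≥0∞ := μ univ + ((K : ℝ≥0∞) ^ σ + K) * ENNReal.ofReal (1 / (2 * σ / (σ + 1) - 1))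
  have hD : D ≠ ⊤ := by
    have : (K : ℝ≥0∞) ^ σ ≠ ⊤ := ENNReal.rpow_ne_top_of_nonneg (by linarith) ENNReal.coe_ne_top
    finiteness
  refine ⟨D.toNNReal, fun h w W H => ?_⟩
  refine ENNReal.le_mul_of_forall_ofReal H.memLp.2.ne fun ε hε hh => ?_
  obtain ⟨H', hh'⟩ := H.exists_const_smul (by linarith) hε hh
  have h1 := lintegral_enorm_le_of_weak H'.meas_grad ha
    fun t ht => H'.measure_grad_le_of_le_one (by linarith) hh' ht
  rw [← eLpNorm_one_eq_lintegral_enorm, eLpNorm_const_smul, Real.enorm_eq_ofReal (by positivity),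
    ENNReal.ofReal_inv_of_pos hε, mul_comm, ← div_eq_mul_inv,
    ENNReal.div_le_iff (by simpa using hε) ENNReal.ofReal_ne_top] at h1
  rwa [ENNReal.coe_toNNReal hD]

end scaling

end EnergyEstimate

/-! ### Moment estimates by power test functions -/

/-- Absorption of a sublinear power. When j > 1 both terms are at most a multiple of j^κ, which is
divided out; finiteness of j is essential. -/
theorem ENNReal.le_rpow_of_le_mul_rpow_add {j A B : ℝ≥0∞} {κ : ℝ} (hj : j ≠ ⊤) (hκ0 : 0 ≤ κ)
    (hκ : κ < 1) (h : j ≤ A * j ^ κ + B) : j ≤ (1 + A + B) ^ (1 / (1 - κ)) := by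
  have hκ' : 0 < 1 - κ := by linarith
  rcases le_or_gt j 1 with hj1 | hj1
  · refine hj1.trans (ENNReal.one_le_rpow ?_ (by positivity))
    rw [add_assoc]
    exact le_self_add
  · have h0 : j ≠ 0 := (one_pos.trans hj1).ne'
    have h1 : 1 ≤ j ^ κ := by simpa using ENNReal.rpow_le_rpow hj1.le hκ0
    have h2 : j ≤ (1 + A + B) * j ^ κ := by
      calc j ≤ A * j ^ κ + B := h
        _ ≤ A * j ^ κ + B * j ^ κ := by gcongr; exact le_mul_of_one_le_right zero_le h1
        _ ≤ (1 + A + B) * j ^ κ := by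
          rw [← add_mul, add_assoc 1]
          exact mul_le_mul' le_add_self le_rfl
    have h3 : j ^ κ ≠ 0 := (one_pos.trans_le h1).ne'
    have h4 : j ^ κ ≠ ⊤ := ENNReal.rpow_ne_top_of_nonneg hκ0 hj
    have h5 : j ^ (1 - κ) ≤ 1 + A + B := by
      rw [ENNReal.rpow_sub _ _ h0 hj, ENNReal.rpow_one]
      exact ENNReal.div_le_of_le_mul h2
    calc j = (j ^ (1 - κ)) ^ (1 / (1 - κ)) := by
          rw [← ENNReal.rpow_mul, mul_one_div_cancel hκ'.ne', ENNReal.rpow_one]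
      _ ≤ _ := ENNReal.rpow_le_rpow h5 (by positivity)

theorem abs_primitive_of_even {b : ℝ → ℝ} (hb : ∀ s, b (-s) = b s) (s : ℝ) :
    |primitive b s| = |primitive b (|s|)| := by
  rcases abs_choice s with h | h
  · rw [h]
  · have := primitive_mul b (-1) s
    simp only [neg_mul, one_mul, hb] at this
    rw [h, this, abs_neg]

theorem abs_primitive_one_add_rpow {a : ℝ} (ha : 0 < a) (s : ℝ) :
    |primitive (fun x => (1 + |x|) ^ (a - 1)) s| = ((1 + |s|) ^ a - 1) / a := by
  rw [abs_primitive_of_even (by simp)]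
  have hs := abs_nonneg s
  set t := |s|
  have h1 : primitive (fun x => (1 + |x|) ^ (a - 1)) t = ((1 + t) ^ a - 1) / a := by
    unfold primitive
    have h2 : ∫ x in (0 : ℝ)..t, (1 + |x|) ^ (a - 1) = ∫ x in (0 : ℝ)..t, (1 + x) ^ (a - 1) := by
      refine intervalIntegral.integral_congr fun x hx => ?_
      rw [uIcc_of_le hs] at hx
      simp only [abs_of_nonneg hx.1]
    have hd : ∀ x ∈ uIcc 0 t, HasDerivAt (fun x => (1 + x) ^ a / a) ((1 + x) ^ (a - 1)) x := by
      intro x hx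
      rw [uIcc_of_le hs] at hx
      have h3 := (((hasDerivAt_id x).const_add 1).rpow_const (p := a)
        (Or.inl (by simp only [id]; linarith [hx.1]))).div_const a
      refine h3.congr_deriv ?_
      simp only [id]
      field_simp
    have hc : ContinuousOn (fun x : ℝ => (1 + x) ^ (a - 1)) (uIcc 0 t) := by
      rw [uIcc_of_le hs]
      exact ContinuousOn.rpow_const (by fun_prop) fun x hx => Or.inl (by linarith [hx.1])
    rw [h2, intervalIntegral.integral_eq_sub_of_hasDerivAt hd hc.intervalIntegrable]
    simp [sub_div]
  rw [h1, abs_of_nonneg]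
  refine div_nonneg (sub_nonneg.2 (Real.one_le_rpow (by linarith) ha.le)) ha.le

theorem Continuous.one_add_abs_rpow (a : ℝ) : Continuous fun x : ℝ => (1 + |x|) ^ a :=
  (by fun_prop : Continuous fun x : ℝ => 1 + |x|).rpow_const fun x =>
    Or.inl (by have := abs_nonneg x; positivity)

namespace EnergyEstimate

variable {α F : Type*} [MeasurableSpace α] [NormedAddCommGroup F]
  {μ : Measure α} {σ : ℝ} {K : ℝ≥0} {h w : α → ℝ} {W : α → F}

/-- For b = (1+|s|)^{2γ-2} the test function is of size (1+|s|)^{2γ-1}; the relation between γ and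
p' is chosen so that Hölder turns its p'-th power into the moment of order 2σγ estimated by the
Sobolev inequality. -/
theorem lintegral_rpow_le (H : EnergyEstimate μ σ K h w W) {γ p p' : ℝ} (hγ : 1 / 2 < γ)
    (hp : p.HolderConjugate p') (hp' : (2 * γ - 1) * p' = 2 * σ * γ)
    (hh : eLpNorm h (ENNReal.ofReal p) μ ≤ 1) (k : ℝ) :
    ∫⁻ x, ‖h x‖ₑ * ‖primitive (fun s => (1 + |s|) ^ ((2 * γ - 1) - 1)) (trunc k (w x))‖ₑ ∂μ ≤
      ENNReal.ofReal (1 / (2 * γ - 1)) *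
        (∫⁻ x, ENNReal.ofReal ((1 + |trunc k (w x)|) ^ (2 * σ * γ)) ∂μ) ^ (1 / p') := by
  have hγ' : 0 < 2 * γ - 1 := by linarith
  have hmT : AEMeasurable (fun x => trunc k (w x)) μ :=
    ((continuous_trunc k).comp_aestronglyMeasurable H.meas).aemeasurable
  have hpow : ∀ a : ℝ, AEMeasurable (fun x => ENNReal.ofReal ((1 + |trunc k (w x)|) ^ a)) μ := fun a =>
    ((Continuous.one_add_abs_rpow a).measurable.comp_aemeasurable hmT).ennreal_ofReal
  calc _ ≤ ∫⁻ x, ENNReal.ofReal (1 / (2 * γ - 1)) *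
        (‖h x‖ₑ * ENNReal.ofReal ((1 + |trunc k (w x)|) ^ (2 * γ - 1))) ∂μ := by
        refine lintegral_mono fun x => ?_
        rw [mul_left_comm]
        gcongr
        rw [← ofReal_norm, Real.norm_eq_abs, abs_primitive_one_add_rpow hγ',
          ← ENNReal.ofReal_mul (by positivity)]
        refine ENNReal.ofReal_le_ofReal ?_
        rw [one_div_mul_eq_div]
        gcongr
        linarith
    _ = ENNReal.ofReal (1 / (2 * γ - 1)) *
        ∫⁻ x, (fun x => ‖h x‖ₑ) x * ENNReal.ofReal ((1 + |trunc k (w x)|) ^ (2 * γ - 1)) ∂μ :=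
        lintegral_const_mul' _ _ ENNReal.ofReal_ne_top
    _ ≤ _ := by
        gcongr
        refine (ENNReal.lintegral_mul_le_Lp_mul_Lq μ hp H.memLp.1.enorm (hpow _)).trans ?_
        have e1 : (∫⁻ x, ‖h x‖ₑ ^ p ∂μ) ^ (1 / p) = eLpNorm h (ENNReal.ofReal p) μ := by
          rw [eLpNorm_eq_lintegral_rpow_enorm_toReal (by simpa using hp.pos) ENNReal.ofReal_ne_top,
            ENNReal.toReal_ofReal hp.nonneg]
        rw [e1]
        refine (mul_le_of_le_one_left zero_le hh).trans (le_of_eq ?_)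
        congr 1
        refine lintegral_congr fun x => ?_
        have : 0 < 1 + |trunc k (w x)| := by positivity
        rw [ENNReal.ofReal_rpow_of_pos (by positivity), ← Real.rpow_mul this.le, hp']

/-- The primitive of √b is comparable to (1+|s|)^γ, so its L^{2σ} bound controls the moment J of
order 2σγ and yields J ≤ A J^{σ/p'} + B. Here σ/p' = 1 - 1/(2γ) < 1 and J is absorbed. Truncation
makes J finite beforehand, while the resulting bound does not depend on k. -/
theorem moment_trunc_le [IsFiniteMeasure μ] (hσ : 1 < σ) (H : EnergyEstimate μ σ K h w W)
    {γ p p' : ℝ} (hγ : 1 / 2 < γ)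
    (hp : p.HolderConjugate p') (hp' : (2 * γ - 1) * p' = 2 * σ * γ)
    (hh : eLpNorm h (ENNReal.ofReal p) μ ≤ 1) {k : ℝ} (hk : 0 < k) :
    ∫⁻ x, ENNReal.ofReal ((1 + |trunc k (w x)|) ^ (2 * σ * γ)) ∂μ ≤
      (1 + 2 ^ (2 * σ - 1) * (ENNReal.ofReal γ ^ (2 * σ) *
        (K * ENNReal.ofReal (1 / (2 * γ - 1))) ^ σ) + 2 ^ (2 * σ - 1) * μ univ) ^ (2 * γ) := by
  have hγ' : 0 < 2 * γ - 1 := by linarith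
  set J := ∫⁻ x, ENNReal.ofReal ((1 + |trunc k (w x)|) ^ (2 * σ * γ)) ∂μ with hJ
  have hJtop : J ≠ ⊤ := by
    refine ne_top_of_le_ne_top ?_ (lintegral_mono (g := fun _ =>
      ENNReal.ofReal ((1 + k) ^ (2 * σ * γ))) fun x => ?_)
    · rw [lintegral_const]
      finiteness
    · refine ENNReal.ofReal_le_ofReal (Real.rpow_le_rpow (by positivity) ?_ (by positivity))
      linarith [abs_trunc_le hk.le (w x)]
  have hb0 : ∀ s : ℝ, (0 : ℝ) ≤ (1 + |s|) ^ ((2 * γ - 1) - 1) := fun s => by positivity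
  have h1 := (H.sobolev k hk _ (Continuous.one_add_abs_rpow _) hb0).trans (ENNReal.rpow_le_rpow
    (mul_le_mul_right (H.lintegral_rpow_le hγ hp hp' hh k) _) (by linarith))
  have hsqrt : (fun s : ℝ => √((1 + |s|) ^ ((2 * γ - 1) - 1))) = fun s => (1 + |s|) ^ (γ - 1) := by
    funext s
    have : 0 ≤ 1 + |s| := by positivity
    rw [Real.sqrt_eq_rpow, ← Real.rpow_mul this]
    congr 1; ring
  rw [hsqrt, ← hJ] at h1
  have hpt : ∀ x, ENNReal.ofReal ((1 + |trunc k (w x)|) ^ (2 * σ * γ)) ≤ 2 ^ (2 * σ - 1) *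
      (ENNReal.ofReal γ ^ (2 * σ) *
        ‖primitive (fun s => (1 + |s|) ^ (γ - 1)) (trunc k (w x))‖ₑ ^ (2 * σ)) +
      2 ^ (2 * σ - 1) := by
    intro x
    have h0 : 0 < 1 + |trunc k (w x)| := by positivity
    have h2 : (1 + |trunc k (w x)|) ^ (2 * σ * γ) =
        (γ * |primitive (fun s => (1 + |s|) ^ (γ - 1)) (trunc k (w x))| + 1) ^ (2 * σ) := by
      rw [abs_primitive_one_add_rpow (by linarith), mul_div_cancel₀ _ (by linarith),
        sub_add_cancel, ← Real.rpow_mul h0.le]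
      congr 1; ring
    rw [h2, ← ENNReal.ofReal_rpow_of_nonneg (by positivity) (by linarith),
      ENNReal.ofReal_add (by positivity) zero_le_one, ENNReal.ofReal_mul (by linarith),
      ENNReal.ofReal_one, ← Real.norm_eq_abs, ofReal_norm]
    refine (ENNReal.rpow_add_le_mul_rpow_add_rpow _ _ (by linarith)).trans (le_of_eq ?_)
    rw [mul_add, ENNReal.one_rpow, mul_one, ENNReal.mul_rpow_of_nonneg _ _ (by linarith)]
  have hκ : 1 / p' * σ = 1 - 1 / (2 * γ) := by
    have hp0 : p' ≠ 0 := hp.symm.pos.ne'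
    have : 1 / p' = (2 * γ - 1) / (2 * σ * γ) := by
      rw [← hp']; field_simp
    rw [this]; field_simp
  have h3 : J ≤ 2 ^ (2 * σ - 1) * (ENNReal.ofReal γ ^ (2 * σ) *
        (K * ENNReal.ofReal (1 / (2 * γ - 1))) ^ σ) * J ^ (1 - 1 / (2 * γ)) +
        2 ^ (2 * σ - 1) * μ univ := by
    calc J ≤ ∫⁻ x, (2 ^ (2 * σ - 1) * (ENNReal.ofReal γ ^ (2 * σ) *
          ‖primitive (fun s => (1 + |s|) ^ (γ - 1)) (trunc k (w x))‖ₑ ^ (2 * σ)) +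
          2 ^ (2 * σ - 1)) ∂μ := lintegral_mono hpt
      _ = 2 ^ (2 * σ - 1) * (ENNReal.ofReal γ ^ (2 * σ) *
          ∫⁻ x, ‖primitive (fun s => (1 + |s|) ^ (γ - 1)) (trunc k (w x))‖ₑ ^ (2 * σ) ∂μ) +
          2 ^ (2 * σ - 1) * μ univ := by
        have c1 : (2 : ℝ≥0∞) ^ (2 * σ - 1) ≠ ⊤ :=
          ENNReal.rpow_ne_top_of_nonneg (by linarith) (by simp)
        have c2 : ENNReal.ofReal γ ^ (2 * σ) ≠ ⊤ :=
          ENNReal.rpow_ne_top_of_nonneg (by linarith) (by simp)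
        rw [lintegral_add_right _ measurable_const, lintegral_const_mul' _ _ c1,
          lintegral_const_mul' _ _ c2, lintegral_const]
      _ ≤ 2 ^ (2 * σ - 1) * (ENNReal.ofReal γ ^ (2 * σ) *
          (K * (ENNReal.ofReal (1 / (2 * γ - 1)) * J ^ (1 / p'))) ^ σ) +
          2 ^ (2 * σ - 1) * μ univ := by gcongr
      _ = _ := by
        rw [← mul_assoc (K : ℝ≥0∞), ENNReal.mul_rpow_of_nonneg _ (J ^ (1 / p')) (by linarith),
          ← ENNReal.rpow_mul, hκ]
        ring
  have hγ1 : 1 / (2 * γ) < 1 := by rw [div_lt_one (by linarith)]; linarith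
  have h4 := ENNReal.le_rpow_of_le_mul_rpow_add hJtop (by linarith)
    (by have : 0 < 1 / (2 * γ) := by positivity
        linarith) h3
  rwa [sub_sub_cancel, one_div_one_div] at h4

/-- Moment estimates for data in `L^p`. -/
theorem exists_moment_le [IsFiniteMeasure μ] (hσ : 1 < σ) (K : ℝ≥0) {γ p p' : ℝ} (hγ : 1 / 2 < γ)
    (hp : p.HolderConjugate p') (hp' : (2 * γ - 1) * p' = 2 * σ * γ) :
    ∃ D : ℝ≥0∞, D ≠ ⊤ ∧ ∀ (h w : α → ℝ) (W : α → F), EnergyEstimate μ σ K h w W →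
      eLpNorm h (ENNReal.ofReal p) μ ≤ 1 →
      ∫⁻ x, ENNReal.ofReal ((1 + |w x|) ^ (2 * σ * γ)) ∂μ ≤ D ∧
      ∫⁻ x, ENNReal.ofReal ((1 + |w x|) ^ (2 * γ - 2)) * ‖W x‖ₑ ^ 2 ∂μ ≤ D := by
  have hγ' : 0 < 2 * γ - 1 := by linarith
  set D₁ : ℝ≥0∞ := (1 + 2 ^ (2 * σ - 1) * (ENNReal.ofReal γ ^ (2 * σ) *
        (K * ENNReal.ofReal (1 / (2 * γ - 1))) ^ σ) + 2 ^ (2 * σ - 1) * μ univ) ^ (2 * γ) with hD₁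
  set D₂ : ℝ≥0∞ := K * (ENNReal.ofReal (1 / (2 * γ - 1)) * D₁ ^ (1 / p')) with hD₂
  have hD1 : D₁ ≠ ⊤ := by
    refine ENNReal.rpow_ne_top_of_nonneg (by linarith) ?_
    have c1 : (2 : ℝ≥0∞) ^ (2 * σ - 1) ≠ ⊤ :=
      ENNReal.rpow_ne_top_of_nonneg (by linarith) (by simp)
    have c2 : ENNReal.ofReal γ ^ (2 * σ) ≠ ⊤ :=
      ENNReal.rpow_ne_top_of_nonneg (by linarith) (by simp)
    have c3 : (K * ENNReal.ofReal (1 / (2 * γ - 1))) ^ σ ≠ ⊤ :=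
      ENNReal.rpow_ne_top_of_nonneg (by linarith) (by finiteness)
    finiteness
  have hD2 : D₂ ≠ ⊤ := by
    have : D₁ ^ (1 / p') ≠ ⊤ := ENNReal.rpow_ne_top_of_nonneg (one_div_nonneg.2 hp.symm.nonneg) hD1
    finiteness
  refine ⟨D₁ + D₂, ENNReal.add_ne_top.2 ⟨hD1, hD2⟩, fun h w W H hh => ?_⟩
  have hJ : ∀ n : ℕ, ∫⁻ x, ENNReal.ofReal ((1 + |trunc (n + 1) (w x)|) ^ (2 * σ * γ)) ∂μ ≤ D₁ :=
    fun n => H.moment_trunc_le hσ hγ hp hp' hh (by positivity)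
  constructor
  -- Fatou as the truncation level grows; at each point the truncated integrand is eventually the
  -- full one.
  · refine le_trans (lintegral_mono fun x => ?_) ((lintegral_liminf_le' (f := fun (n : ℕ) x =>
      ENNReal.ofReal ((1 + |trunc (n + 1) (w x)|) ^ (2 * σ * γ))) fun n => ?_).trans
      ((liminf_le_of_frequently_le' (f := atTop) (Frequently.of_forall hJ)).trans le_self_add))
    · refine le_of_eq (Tendsto.liminf_eq (tendsto_const_nhds.congr' ?_)).symm
      obtain ⟨n₀, hn₀⟩ := exists_nat_gt |w x|
      filter_upwards [eventually_ge_atTop n₀] with n hn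
      have : (n₀ : ℝ) ≤ n := by exact_mod_cast hn
      rw [trunc_eq_self (by linarith)]
    · exact ((Continuous.one_add_abs_rpow _).comp (continuous_trunc _)).measurable.comp_aemeasurable
        H.meas.aemeasurable |>.ennreal_ofReal
  · have hb0 : ∀ s : ℝ, (0 : ℝ) ≤ (1 + |s|) ^ ((2 * γ - 1) - 1) := fun s => by positivity
    have e : 2 * γ - 2 = (2 * γ - 1) - 1 := by ring
    have hE : ∀ n : ℕ, ∫⁻ x, ENNReal.ofReal ((Ioo (-((n : ℝ) + 1)) (n + 1)).indicator
        (fun s => (1 + |s|) ^ ((2 * γ - 1) - 1)) (w x)) * ‖W x‖ₑ ^ 2 ∂μ ≤ D₂ := by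
      intro n
      refine (H.energy (n + 1) (by positivity) _ (Continuous.one_add_abs_rpow _) hb0).trans ?_
      exact mul_le_mul' le_rfl ((H.lintegral_rpow_le hγ hp hp' hh (n + 1)).trans
        (mul_le_mul' le_rfl (ENNReal.rpow_le_rpow (hJ n) (one_div_nonneg.2 hp.symm.nonneg))))
    refine le_trans (lintegral_mono fun x => ?_) ((lintegral_liminf_le' (f := fun (n : ℕ) x =>
      ENNReal.ofReal ((Ioo (-((n : ℝ) + 1)) (n + 1)).indicator
        (fun s => (1 + |s|) ^ ((2 * γ - 1) - 1)) (w x)) * ‖W x‖ₑ ^ 2) fun n => ?_).trans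
      ((liminf_le_of_frequently_le' (f := atTop) (Frequently.of_forall hE)).trans le_add_self))
    · refine le_of_eq (Tendsto.liminf_eq (tendsto_const_nhds.congr' ?_)).symm
      obtain ⟨n₀, hn₀⟩ := exists_nat_gt |w x|
      filter_upwards [eventually_ge_atTop n₀] with n hn
      have : (n₀ : ℝ) ≤ n := by exact_mod_cast hn
      rw [indicator_of_mem (show w x ∈ Ioo (-((n : ℝ) + 1)) (n + 1) from
        abs_lt.1 (by linarith)), e]
    · exact (((Continuous.one_add_abs_rpow _).measurable.indicator
        measurableSet_Ioo).comp_aemeasurable H.meas.aemeasurable).ennreal_ofReal.mul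
        (H.meas_grad.enorm.pow_const 2)

variable [NormedSpace ℝ F]

theorem eLpNorm_le_mul_of_le_one {G : Type*} [NormedAddCommGroup G] [NormedSpace ℝ G] {p q : ℝ≥0∞}
    {g : α → G} (hh : eLpNorm h p μ ≠ ⊤) {C : ℝ≥0}
    (hC : ∀ ε : ℝ, 0 < ε → eLpNorm h p μ ≤ ENNReal.ofReal ε → eLpNorm (ε⁻¹ • g) q μ ≤ C) :
    eLpNorm g q μ ≤ C * eLpNorm h p μ := by
  refine ENNReal.le_mul_of_forall_ofReal hh fun ε hε hle => ?_
  have h1 := hC ε hε hle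
  rwa [eLpNorm_const_smul, Real.enorm_eq_ofReal (by positivity), ENNReal.ofReal_inv_of_pos hε,
    mul_comm, ← div_eq_mul_inv, ENNReal.div_le_iff (by simpa using hε) ENNReal.ofReal_ne_top] at h1

/-- The `L^{2σγ}` estimate. -/
theorem exists_eLpNorm_le [IsFiniteMeasure μ] (hσ : 1 < σ) (K : ℝ≥0) {γ p p' : ℝ}
    (hγ : 1 / 2 < γ) (hp : p.HolderConjugate p') (hp' : (2 * γ - 1) * p' = 2 * σ * γ) :
    ∃ C : ℝ≥0, ∀ (h w : α → ℝ) (W : α → F), EnergyEstimate μ σ K h w W →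
      MemLp h (ENNReal.ofReal p) μ →
      eLpNorm w (ENNReal.ofReal (2 * σ * γ)) μ ≤ C * eLpNorm h (ENNReal.ofReal p) μ := by
  obtain ⟨D, hD, HD⟩ := exists_moment_le (F := F) (μ := μ) hσ K hγ hp hp'
  have hr : 0 < 2 * σ * γ := by positivity
  refine ⟨(D ^ (1 / (2 * σ * γ))).toNNReal, fun h w W H hh =>
    eLpNorm_le_mul_of_le_one hh.2.ne fun ε hε hle => ?_⟩
  obtain ⟨H', hh'⟩ := H.exists_const_smul (by linarith) hε hle
  rw [ENNReal.coe_toNNReal (ENNReal.rpow_ne_top_of_nonneg (by positivity) hD),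
    eLpNorm_eq_lintegral_rpow_enorm_toReal (by simpa using hr) ENNReal.ofReal_ne_top,
    ENNReal.toReal_ofReal hr.le]
  gcongr
  refine le_trans (lintegral_mono fun x => ?_) (HD _ _ _ H' hh').1
  rw [← ENNReal.ofReal_rpow_of_nonneg (by positivity) hr.le, ← ofReal_norm, Real.norm_eq_abs]
  gcongr
  linarith

/-- The energy estimate for the gradient, for data in `L^{2_*}`. -/
theorem exists_eLpNorm_grad_two_le [IsFiniteMeasure μ] (hσ : 1 < σ) (K : ℝ≥0) {p : ℝ}
    (hp : p.HolderConjugate (2 * σ)) :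
    ∃ C : ℝ≥0, ∀ (h w : α → ℝ) (W : α → F), EnergyEstimate μ σ K h w W →
      MemLp h (ENNReal.ofReal p) μ →
      eLpNorm W 2 μ ≤ C * eLpNorm h (ENNReal.ofReal p) μ := by
  -- At γ = 1 the weight (1+|w|)^{2γ-2} is 1 and the relation on exponents becomes p' = 2σ.
  obtain ⟨D, hD, HD⟩ := exists_moment_le (F := F) (μ := μ) (γ := 1) hσ K (by norm_num) hp (by ring)
  refine ⟨(D ^ (1 / (2 : ℝ))).toNNReal, fun h w W H hh =>
    eLpNorm_le_mul_of_le_one hh.2.ne fun ε hε hle => ?_⟩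
  obtain ⟨H', hh'⟩ := H.exists_const_smul (by linarith) hε hle
  rw [ENNReal.coe_toNNReal (ENNReal.rpow_ne_top_of_nonneg (by positivity) hD),
    eLpNorm_eq_lintegral_rpow_enorm_toReal two_ne_zero ENNReal.ofNat_ne_top, ENNReal.toReal_ofNat]
  gcongr
  have := (HD _ _ _ H' hh').2
  simpa using this

/-- The estimate for the gradient for data in `L^p`, below the energy space. -/
theorem exists_eLpNorm_grad_le [IsFiniteMeasure μ] (hσ : 1 < σ) (K : ℝ≥0) {γ p p' q : ℝ}
    (hγ : 1 / 2 < γ) (hp : p.HolderConjugate p') (hp' : (2 * γ - 1) * p' = 2 * σ * γ)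
    (hq0 : 0 < q) (hq2 : q < 2) (hq : (1 - γ) * q = 2 * σ * γ * (1 - q / 2)) :
    ∃ C : ℝ≥0, ∀ (h w : α → ℝ) (W : α → F), EnergyEstimate μ σ K h w W →
      MemLp h (ENNReal.ofReal p) μ →
      eLpNorm W (ENNReal.ofReal q) μ ≤ C * eLpNorm h (ENNReal.ofReal p) μ := by
  obtain ⟨D, hD, HD⟩ := exists_moment_le (F := F) (μ := μ) hσ K hγ hp hp'
  refine ⟨(D ^ (1 / q)).toNNReal, fun h w W H hh =>
    eLpNorm_le_mul_of_le_one hh.2.ne fun ε hε hle => ?_⟩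
  obtain ⟨H', hh'⟩ := H.exists_const_smul (by linarith) hε hle
  obtain ⟨h1, h2⟩ := HD _ _ _ H' hh'
  rw [ENNReal.coe_toNNReal (ENNReal.rpow_ne_top_of_nonneg (by positivity) hD),
    eLpNorm_eq_lintegral_rpow_enorm_toReal (by simpa using hq0) ENNReal.ofReal_ne_top,
    ENNReal.toReal_ofReal hq0.le]
  gcongr
  set w' := ε⁻¹ • w
  set W' := ε⁻¹ • W
  have hpow : ∀ a : ℝ, AEMeasurable (fun x => ENNReal.ofReal ((1 + |w' x|) ^ a)) μ := fun a =>
    ((Continuous.one_add_abs_rpow a).measurable.comp_aemeasurable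
      H'.meas.aemeasurable).ennreal_ofReal
  -- Hölder between the weighted energy and the moment of order 2σγ; hypothesis `hq` says precisely
  -- that the powers of 1+|w'| cancel.
  calc ∫⁻ x, ‖W' x‖ₑ ^ q ∂μ
      = ∫⁻ x, (ENNReal.ofReal ((1 + |w' x|) ^ (2 * γ - 2)) * ‖W' x‖ₑ ^ 2) ^ (q / 2) *
          ENNReal.ofReal ((1 + |w' x|) ^ (2 * σ * γ)) ^ (1 - q / 2) ∂μ := by
        refine lintegral_congr fun x => ?_
        have h0 : 0 < 1 + |w' x| := by positivity
        rw [ENNReal.mul_rpow_of_nonneg _ _ (by positivity), ENNReal.ofReal_rpow_of_pos (by positivity),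
          ENNReal.ofReal_rpow_of_pos (by positivity), mul_right_comm,
          ← ENNReal.ofReal_mul (by positivity), ← Real.rpow_mul h0.le, ← Real.rpow_mul h0.le,
          ← Real.rpow_add h0, ← hq, ← ENNReal.rpow_natCast, ← ENNReal.rpow_mul]
        have e1 : (2 * γ - 2) * (q / 2) + (1 - γ) * q = 0 := by ring
        have e2 : ((2 : ℕ) : ℝ) * (q / 2) = q := by push_cast; ring
        rw [e1, e2, Real.rpow_zero, ENNReal.ofReal_one, one_mul]
    _ ≤ (∫⁻ x, ENNReal.ofReal ((1 + |w' x|) ^ (2 * γ - 2)) * ‖W' x‖ₑ ^ 2 ∂μ) ^ (q / 2) *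
          (∫⁻ x, ENNReal.ofReal ((1 + |w' x|) ^ (2 * σ * γ)) ∂μ) ^ (1 - q / 2) :=
        ENNReal.lintegral_mul_norm_pow_le ((hpow _).mul (H'.meas_grad.enorm.pow_const 2)) (hpow _)
          (by positivity) (by linarith) (by ring)
    _ ≤ D ^ (q / 2) * D ^ (1 - q / 2) := by
        gcongr
        linarith
    _ = D := by
        rw [← ENNReal.rpow_add_of_nonneg _ _ (by positivity) (by linarith)]
        simp

end EnergyEstimate

/-! ### Stampacchia's method and the L^∞ estimate -/

/-- Stampacchia's iteration lemma. -/
theorem exists_eq_zero_of_antitone {c V a β : ℝ} (hc : 0 ≤ c) (hV : 0 ≤ V) (ha : 0 < a)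
    (hβ : 1 < β) : ∃ d : ℝ, 0 ≤ d ∧ ∀ φ : ℝ → ℝ, Antitone φ → (∀ k, 0 ≤ φ k) → φ 0 ≤ V →
      (∀ k, 0 ≤ k → ∀ δ, 0 < δ → φ (k + δ) * δ ^ a ≤ c * φ k ^ β) → φ d = 0 := by
  -- Steps δ₀ lⁿ are to halve the bound (V+1)2^{-n} at each stage. l^a = 2^{-(β-1)} matches the gain
  -- from the power β, and δ₀^a = D ≥ 2c(V+1)^{β-1} supplies the factor 1/2; the levels then stay
  -- below δ₀/(1-l).
  set l : ℝ := 2 ^ (-(β - 1) / a) with hl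
  have hl0 : 0 < l := by positivity
  have hl1 : l < 1 := Real.rpow_lt_one_of_one_lt_of_neg one_lt_two
    (div_neg_of_neg_of_pos (by linarith) ha)
  set D : ℝ := 2 * c * (V + 1) ^ (β - 1) + 1 with hD
  have hD0 : 0 < D := by positivity
  set δ₀ : ℝ := D ^ (1 / a) with hδ₀
  have hδ : 0 < δ₀ := by positivity
  refine ⟨δ₀ * (1 - l)⁻¹, mul_nonneg hδ.le (inv_nonneg.2 (by linarith)), fun φ hφ h0 hφV H => ?_⟩
  have hstep : ∀ n : ℕ, φ (δ₀ * ∑ i ∈ Finset.range n, l ^ i) ≤ (V + 1) * (1 / 2) ^ n := by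
    intro n
    induction n with
    | zero => simpa using hφV.trans (by linarith)
    | succ n ih =>
      have h1 := H (δ₀ * ∑ i ∈ Finset.range n, l ^ i) (by positivity) (δ₀ * l ^ n) (by positivity)
      rw [← mul_add, ← Finset.sum_range_succ] at h1
      set M : ℝ := (2 : ℝ) ^ (-(β - 1)) with hM
      have hM0 : 0 < M := by positivity
      have e1 : (δ₀ * l ^ n) ^ a = D * M ^ n := by
        rw [Real.mul_rpow hδ.le (by positivity), hδ₀, ← Real.rpow_mul hD0.le,
          one_div_mul_cancel ha.ne', Real.rpow_one, ← Real.rpow_natCast l,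
          ← Real.rpow_mul hl0.le, mul_comm (n : ℝ), Real.rpow_mul hl0.le, Real.rpow_natCast, hl,
          ← Real.rpow_mul (by norm_num), div_mul_cancel₀ _ ha.ne']
      have e2 : ((V + 1) * (1 / 2) ^ n) ^ β =
          (V + 1) * (V + 1) ^ (β - 1) * ((1 / 2) ^ n * M ^ n) := by
        have h3 : ∀ x : ℝ, 0 < x → x ^ β = x * x ^ (β - 1) := fun x hx => by
          rw [← Real.rpow_one_add' hx.le (by linarith)]; congr 1; ring
        rw [Real.mul_rpow (by positivity) (by positivity), h3 _ (by positivity),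
          h3 ((1 / 2) ^ n) (by positivity), hM, Real.rpow_neg (by norm_num),
          ← Real.inv_rpow (by norm_num), ← Real.rpow_natCast (1 / 2), ← Real.rpow_natCast (_ ^ _),
          ← Real.rpow_mul (by norm_num), ← Real.rpow_mul (by norm_num), mul_comm (n : ℝ),
          one_div]
      have h2 : φ (δ₀ * ∑ i ∈ Finset.range n, l ^ i) ^ β ≤ ((V + 1) * (1 / 2) ^ n) ^ β :=
        Real.rpow_le_rpow (h0 _) ih (by linarith)
      have h3 := h1.trans (mul_le_mul_of_nonneg_left h2 hc)
      rw [e1, e2] at h3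
      have h4 : c * (V + 1) ^ (β - 1) ≤ D / 2 := by rw [hD]; linarith
      have h5 : φ (δ₀ * ∑ i ∈ Finset.range (n + 1), l ^ i) * (D * M ^ n) ≤
          ((V + 1) * (1 / 2) ^ (n + 1)) * (D * M ^ n) := by
        refine h3.trans ?_
        have h6 : 0 ≤ (V + 1) * ((1 / 2) ^ n * M ^ n) := by positivity
        have h7 := mul_le_mul_of_nonneg_right h4 h6
        calc _ = c * (V + 1) ^ (β - 1) * ((V + 1) * ((1 / 2) ^ n * M ^ n)) := by ring
          _ ≤ _ := h7
          _ = _ := by rw [pow_succ]; ring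
      exact le_of_mul_le_mul_right h5 (by positivity)
  have hle : ∀ n : ℕ, φ (δ₀ * (1 - l)⁻¹) ≤ (V + 1) * (1 / 2) ^ n := fun n => by
    refine (hφ (mul_le_mul_of_nonneg_left ?_ hδ.le)).trans (hstep n)
    rw [← tsum_geometric_of_lt_one hl0.le hl1]
    exact (summable_geometric_of_lt_one hl0.le hl1).sum_le_tsum _ fun i _ => by positivity
  have hlim : Tendsto (fun n : ℕ => (V + 1) * (1 / 2 : ℝ) ^ n) atTop (𝓝 ((V + 1) * 0)) :=
    (tendsto_pow_atTop_nhds_zero_of_lt_one (by norm_num) (by norm_num)).const_mul _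
  rw [mul_zero] at hlim
  exact le_antisymm (ge_of_tendsto' hlim hle) (h0 _)

theorem primitive_nonneg_of_nonneg {b : ℝ → ℝ} (hb : ∀ s, 0 ≤ b s) {s : ℝ} (hs : 0 ≤ s) :
    0 ≤ primitive b s := intervalIntegral.integral_nonneg hs fun x _ => hb x

theorem sq_le_abs_primitive_sub {k : ℝ} (hk : 0 ≤ k) (s : ℝ) :
    max (|s| - k) 0 ^ 2 / 2 ≤ |primitive (fun x => max (|x| - k) 0) s| := by
  rw [abs_primitive_of_even (by simp)]
  have hs := abs_nonneg s
  set t := |s|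
  have hb : Continuous fun x : ℝ => max (|x| - k) 0 := by fun_prop
  have hb0 : ∀ x : ℝ, 0 ≤ max (|x| - k) 0 := fun x => le_max_right _ _
  rw [abs_of_nonneg (primitive_nonneg_of_nonneg hb0 hs)]
  rcases le_total t k with h | h
  · rw [max_eq_right (by linarith)]
    simpa using primitive_nonneg_of_nonneg hb0 hs
  · rw [max_eq_left (by linarith)]
    unfold primitive
    rw [← intervalIntegral.integral_add_adjacent_intervals (hb.intervalIntegrable 0 k)
      (hb.intervalIntegrable k t)]
    have h1 : 0 ≤ ∫ x in (0 : ℝ)..k, max (|x| - k) 0 := primitive_nonneg_of_nonneg hb0 hk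
    have h2 : ∫ x in k..t, max (|x| - k) 0 = ∫ x in k..t, (x - k) := by
      refine intervalIntegral.integral_congr fun x hx => ?_
      rw [uIcc_of_le h] at hx
      rw [abs_of_nonneg (hk.trans hx.1), max_eq_left (by linarith [hx.1])]
    rw [h2, intervalIntegral.integral_comp_sub_right (fun x => x) k, integral_id]
    rw [sub_self]
    linarith

theorem abs_primitive_sub_sq_le {k : ℝ} (hk : 0 ≤ k) (s : ℝ) :
    |primitive (fun x => max (|x| - k) 0 ^ 2) s| ≤ max (|s| - k) 0 ^ 3 := by
  rw [abs_primitive_of_even (by simp)]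
  have hs := abs_nonneg s
  set t := |s|
  have hb : Continuous fun x : ℝ => max (|x| - k) 0 ^ 2 := by fun_prop
  have hz : ∀ t, 0 ≤ t → t ≤ k → ∫ x in (0 : ℝ)..t, max (|x| - k) 0 ^ 2 = 0 := by
    intro t ht htk
    rw [intervalIntegral.integral_congr (g := fun _ => 0)]
    · simp
    · intro x hx
      rw [uIcc_of_le ht] at hx
      simp only
      rw [abs_of_nonneg hx.1, max_eq_right (by linarith [hx.2])]
      simp
  unfold primitive
  rcases le_total t k with h | h
  · rw [hz t hs h, abs_zero]
    positivity
  · rw [← intervalIntegral.integral_add_adjacent_intervals (hb.intervalIntegrable 0 k)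
      (hb.intervalIntegrable k t), hz k hk le_rfl, zero_add, max_eq_left (by linarith)]
    have h1 := intervalIntegral.norm_integral_le_of_norm_le_const (a := k) (b := t)
      (f := fun x => max (|x| - k) 0 ^ 2) (C := (t - k) ^ 2) fun x hx => by
        rw [uIoc_of_le h] at hx
        rw [Real.norm_of_nonneg (by positivity), abs_of_nonneg (hk.trans hx.1.le),
          max_eq_left (by linarith [hx.1])]
        have : 0 ≤ x - k := by linarith [hx.1]
        gcongr
        exact hx.2
    rw [abs_of_nonneg (by linarith : 0 ≤ t - k)] at h1
    calc _ ≤ (t - k) ^ 2 * (t - k) := h1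
      _ = _ := by ring

namespace EnergyEstimate

variable {α F : Type*} [MeasurableSpace α] [NormedAddCommGroup F]
  {μ : Measure α} {σ : ℝ} {K : ℝ≥0} {h w : α → ℝ} {W : α → F}

/-- Continuity of b rules out the indicator of |s| > k, so b = (|s|-k)₊² is used. With G =
(|T_{k+δ}w| - k)₊, the primitive of √b is at least G²/2 in modulus and that of b at most G³. The
quantity estimated is thus Y = ∫G^{4σ} against ∫|h|G³. Hölder on the set |w| > k gives Y ≤ C
Φ^{σ/p'-3/4} Y^{3/4}, and absorption gives the claim, as G = δ where |w| > k+δ. -/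
theorem level_set_le [IsFiniteMeasure μ] (hσ : 1 < σ) (H : EnergyEstimate μ σ K h w W) {p p' : ℝ}
    (hp : p.HolderConjugate p') (hp' : p' < σ) (hh : eLpNorm h (ENNReal.ofReal p) μ ≤ 1) {k δ : ℝ}
    (hk : 0 ≤ k) (hδ : 0 < δ) :
    ENNReal.ofReal δ ^ (4 * σ) * μ {x | k + δ < |w x|} ≤
      ((4 * K : ℝ≥0∞) ^ σ) ^ (4 : ℝ) * μ {x | k < |w x|} ^ (4 * (σ / p') - 3) := by
  have hp0 : 0 < p' := hp.symm.pos
  have hkδ : 0 < k + δ := by linarith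
  have hGc : Continuous fun s : ℝ => max (|trunc (k + δ) s| - k) 0 := by
    have := continuous_trunc (k + δ)
    fun_prop
  set G : α → ℝ := fun x => max (|trunc (k + δ) (w x)| - k) 0 with hG
  have hG0 : ∀ x, 0 ≤ G x := fun x => le_max_right _ _
  have hGδ : ∀ x, G x ≤ δ := fun x =>
    max_le (by linarith [abs_trunc_le hkδ.le (w x)]) hδ.le
  have hGm : AEMeasurable (fun x => ENNReal.ofReal (G x)) μ :=
    (hGc.measurable.comp_aemeasurable H.meas.aemeasurable).ennreal_ofReal
  set Y := ∫⁻ x, ENNReal.ofReal (G x) ^ (4 * σ) ∂μ with hY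
  have hYtop : Y ≠ ⊤ := by
    refine ne_top_of_le_ne_top ?_ (lintegral_mono (g := fun _ => ENNReal.ofReal δ ^ (4 * σ))
      fun x => ENNReal.rpow_le_rpow (ENNReal.ofReal_le_ofReal (hGδ x)) (by linarith))
    rw [lintegral_const]
    exact ENNReal.mul_ne_top (ENNReal.rpow_ne_top_of_nonneg (by linarith) ENNReal.ofReal_ne_top)
      (measure_ne_top _ _)
  have h1 : ENNReal.ofReal δ ^ (4 * σ) * μ {x | k + δ < |w x|} ≤ Y := by
    refine le_trans ?_ (mul_meas_ge_le_lintegral₀ (hGm.pow_const _) (ENNReal.ofReal δ ^ (4 * σ)))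
    gcongr
    rename_i x
    intro hx
    have : G x = δ := by
      rw [hG]
      simp only
      rw [abs_trunc hkδ.le, min_eq_right hx.le, add_sub_cancel_left, max_eq_left hδ.le]
    rw [this]
  set Φ := μ {x | k < |w x|} with hΦ
  have hΦtop : Φ ≠ ⊤ := measure_ne_top _ _
  -- The Hölder weight taking G^{3p'} to a power of G^{4σ}; it is below 1 because p' < σ.
  set θ := 3 * p' / (4 * σ) with hθ
  have hθ0 : 0 < θ := by positivity
  have hθ1 : θ < 1 := by rw [hθ, div_lt_one (by linarith)]; linarith
  have hset : NullMeasurableSet {x | k < |w x|} μ :=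
    nullMeasurableSet_lt aemeasurable_const H.meas.aemeasurable.norm
  have h2 : ∫⁻ x, ENNReal.ofReal (G x) ^ (3 * p') ∂μ ≤ Y ^ θ * Φ ^ (1 - θ) := by
    calc ∫⁻ x, ENNReal.ofReal (G x) ^ (3 * p') ∂μ
        ≤ ∫⁻ x, (ENNReal.ofReal (G x) ^ (4 * σ)) ^ θ *
            ({x | k < |w x|}.indicator (1 : α → ℝ≥0∞) x) ^ (1 - θ) ∂μ := by
          refine lintegral_mono fun x => ?_
          rw [← ENNReal.rpow_mul, hθ, mul_div_cancel₀ _ (by linarith)]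
          by_cases hx : k < |w x|
          · rw [indicator_of_mem (show x ∈ {x | k < |w x|} from hx)]
            simp
          · have : G x = 0 := by
              push Not at hx
              exact max_eq_right (by linarith [abs_trunc_le_abs hkδ.le (w x)])
            rw [this, ENNReal.ofReal_zero, ENNReal.zero_rpow_of_pos (by linarith)]
            exact zero_le
      _ ≤ _ := ENNReal.lintegral_mul_norm_pow_le (hGm.pow_const _)
            (aemeasurable_one.indicator₀ hset) hθ0.le (by linarith) (by ring)
      _ = _ := by rw [← Pi.one_def, lintegral_indicator_one₀ hset]
  have h3 : ∫⁻ x, ‖h x‖ₑ * ‖primitive (fun s => max (|s| - k) 0 ^ 2) (trunc (k + δ) (w x))‖ₑ ∂μ ≤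
      (Y ^ θ * Φ ^ (1 - θ)) ^ (1 / p') := by
    calc _ ≤ ∫⁻ x, ((fun x => ‖h x‖ₑ) * fun x => ENNReal.ofReal (G x) ^ (3 : ℝ)) x ∂μ := by
          refine lintegral_mono fun x => ?_
          simp only [Pi.mul_apply]
          gcongr
          rw [← ofReal_norm, Real.norm_eq_abs, ENNReal.ofReal_rpow_of_nonneg (hG0 x) (by norm_num)]
          refine ENNReal.ofReal_le_ofReal ((abs_primitive_sub_sq_le hk _).trans (le_of_eq ?_))
          norm_cast
      _ ≤ _ := ENNReal.lintegral_mul_le_Lp_mul_Lq μ hp H.memLp.1.enorm (hGm.pow_const _)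
      _ = eLpNorm h (ENNReal.ofReal p) μ * (∫⁻ x, ENNReal.ofReal (G x) ^ (3 * p') ∂μ) ^ (1 / p') := by
          rw [eLpNorm_eq_lintegral_rpow_enorm_toReal (by simpa using hp.pos) ENNReal.ofReal_ne_top,
            ENNReal.toReal_ofReal hp.nonneg]
          simp only [ENNReal.rpow_mul]
      _ ≤ 1 * (Y ^ θ * Φ ^ (1 - θ)) ^ (1 / p') := by gcongr
      _ = _ := one_mul _
  have h4 := (H.sobolev (k + δ) hkδ (fun s => max (|s| - k) 0 ^ 2) (by fun_prop)
    fun s => sq_nonneg _).trans (ENNReal.rpow_le_rpow (mul_le_mul_right h3 _) (by linarith))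
  have hsq : (fun s : ℝ => √(max (|s| - k) 0 ^ 2)) = fun s => max (|s| - k) 0 :=
    funext fun s => Real.sqrt_sq (le_max_right _ _)
  rw [hsq] at h4
  have h5 : Y ≤ 4 ^ σ *
      ∫⁻ x, ‖primitive (fun s => max (|s| - k) 0) (trunc (k + δ) (w x))‖ₑ ^ (2 * σ) ∂μ := by
    rw [← lintegral_const_mul' _ _ (ENNReal.rpow_ne_top_of_nonneg (by linarith) (by simp))]
    refine lintegral_mono fun x => ?_
    have e4 : (4 : ℝ≥0∞) ^ σ = 2 ^ (2 * σ) := by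
      rw [ENNReal.rpow_mul, ENNReal.rpow_two]; norm_num
    have e5 : ENNReal.ofReal (G x) ^ (4 * σ) = (ENNReal.ofReal (G x ^ 2)) ^ (2 * σ) := by
      rw [ENNReal.ofReal_pow (hG0 x), ← ENNReal.rpow_natCast, ← ENNReal.rpow_mul]
      congr 1; push_cast; ring
    rw [e4, e5, ← ENNReal.mul_rpow_of_nonneg _ _ (by linarith)]
    refine ENNReal.rpow_le_rpow ?_ (by linarith)
    have e6 : (2 : ℝ≥0∞) = ENNReal.ofReal 2 := by simp
    rw [← ofReal_norm, e6, ← ENNReal.ofReal_mul (by norm_num), Real.norm_eq_abs]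
    refine ENNReal.ofReal_le_ofReal ?_
    have := sq_le_abs_primitive_sub hk (trunc (k + δ) (w x))
    change G x ^ 2 / 2 ≤ _ at this
    linarith
  have h6 : Y ≤ (4 * K : ℝ≥0∞) ^ σ * Φ ^ (σ / p' - 3 / 4) * Y ^ (3 / 4 : ℝ) := by
    refine (h5.trans (mul_le_mul_right h4 _)).trans (le_of_eq ?_)
    have e7 : θ * (1 / p') * σ = 3 / 4 := by rw [hθ]; field_simp
    have e8 : (1 - θ) * (1 / p') * σ = σ / p' - 3 / 4 := by rw [← e7]; ring
    have e9 : ((Y ^ θ * Φ ^ (1 - θ)) ^ (1 / p')) ^ σ = Y ^ (3 / 4 : ℝ) * Φ ^ (σ / p' - 3 / 4) := by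
      rw [← ENNReal.rpow_mul, ENNReal.mul_rpow_of_nonneg _ _ (by positivity), ← ENNReal.rpow_mul,
        ← ENNReal.rpow_mul, ← mul_assoc, e7, ← mul_assoc, e8]
    rw [ENNReal.mul_rpow_of_nonneg (K : ℝ≥0∞) _ (by linarith), e9,
      ENNReal.mul_rpow_of_nonneg _ _ (by linarith)]
    ring
  refine h1.trans ?_
  rcases eq_or_ne Y 0 with hY0 | hY0
  · rw [hY0]; exact zero_le
  have h7 : Y ^ (1 / 4 : ℝ) ≤ (4 * K : ℝ≥0∞) ^ σ * Φ ^ (σ / p' - 3 / 4) := by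
    rw [show (1 / 4 : ℝ) = 1 - 3 / 4 by norm_num, ENNReal.rpow_sub _ _ hY0 hYtop, ENNReal.rpow_one]
    exact ENNReal.div_le_of_le_mul h6
  calc Y = (Y ^ (1 / 4 : ℝ)) ^ (4 : ℝ) := by rw [← ENNReal.rpow_mul]; norm_num
    _ ≤ ((4 * K : ℝ≥0∞) ^ σ * Φ ^ (σ / p' - 3 / 4)) ^ (4 : ℝ) :=
        ENNReal.rpow_le_rpow h7 (by norm_num)
    _ = _ := by
        rw [ENNReal.mul_rpow_of_nonneg _ _ (by norm_num), ← ENNReal.rpow_mul Φ]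
        congr 2; ring

/-- The `L^∞` estimate. -/
theorem exists_eLpNorm_top_le [NormedSpace ℝ F] [IsFiniteMeasure μ] (hσ : 1 < σ) (K : ℝ≥0)
    {p p' : ℝ} (hp : p.HolderConjugate p') (hp' : p' < σ) :
    ∃ C : ℝ≥0, ∀ (h w : α → ℝ) (W : α → F), EnergyEstimate μ σ K h w W →
      MemLp h (ENNReal.ofReal p) μ → eLpNorm w ⊤ μ ≤ C * eLpNorm h (ENNReal.ofReal p) μ := by
  have hp0 : 0 < p' := hp.symm.pos
  -- The superlinear exponent of the iteration; for σ = Q/(Q-2), the condition p' < σ is p > Q/2.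
  have hβ : 1 < 4 * (σ / p') - 3 := by
    have : 1 < σ / p' := by rwa [one_lt_div hp0]
    linarith
  set c : ℝ≥0∞ := ((4 * K : ℝ≥0∞) ^ σ) ^ (4 : ℝ)
  have hc : c ≠ ⊤ := ENNReal.rpow_ne_top_of_nonneg (by norm_num)
    (ENNReal.rpow_ne_top_of_nonneg (by linarith) (by finiteness))
  obtain ⟨d, hd, Hd⟩ := exists_eq_zero_of_antitone (c := c.toReal) (V := μ.real univ) (a := 4 * σ)
    ENNReal.toReal_nonneg measureReal_nonneg (by linarith) hβ
  refine ⟨d.toNNReal, fun h w W H hh => eLpNorm_le_mul_of_le_one hh.2.ne fun ε hε hle => ?_⟩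
  obtain ⟨H', hh'⟩ := H.exists_const_smul (by linarith) hε hle
  have h0 := Hd (fun k => μ.real {x | k < |(ε⁻¹ • w) x|})
    (fun k l hkl => measureReal_mono fun x hx => hkl.trans_lt hx) (fun k => measureReal_nonneg)
    (measureReal_mono (subset_univ _)) fun k hk δ hδ => by
      have h1 := ENNReal.toReal_mono (ENNReal.mul_ne_top hc
        (ENNReal.rpow_ne_top_of_nonneg (by linarith) (measure_ne_top _ _)))
        (H'.level_set_le hσ hp hp' hh' hk hδ)
      rw [ENNReal.toReal_mul, ENNReal.toReal_mul, ← ENNReal.toReal_rpow,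
        ← ENNReal.toReal_rpow (μ _), ENNReal.toReal_ofReal hδ.le, mul_comm] at h1
      exact h1
  have h1 : μ {x | d < |(ε⁻¹ • w) x|} = 0 := by
    rwa [measureReal_eq_zero_iff] at h0
  rw [eLpNorm_exponent_top]
  refine eLpNormEssSup_le_of_ae_bound ?_
  rw [ae_iff]
  simpa using h1

end EnergyEstimate

/-! ### Gradients of solutions found by approximation -/

theorem MeasureTheory.exists_tendsto_eLpNorm_of_cauchy {α F : Type*} [MeasurableSpace α]
    {μ : Measure α} [NormedAddCommGroup F] [CompleteSpace F] {p : ℝ≥0∞} [Fact (1 ≤ p)]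
    {f : ℕ → α → F} (hf : ∀ n, MemLp (f n) p μ) {a : ℕ → ℝ≥0∞} (ha : Tendsto a atTop (𝓝 0))
    (h : ∀ n m, eLpNorm (f n - f m) p μ ≤ a n + a m) :
    ∃ g, MemLp g p μ ∧ Tendsto (fun n => eLpNorm (f n - g) p μ) atTop (𝓝 0) := by
  have hC : CauchySeq fun n => (hf n).toLp := by
    refine EMetric.cauchySeq_iff.2 fun ε hε => ?_
    obtain ⟨n₀, hn₀⟩ := eventually_atTop.1 (ha.eventually_lt_const (ENNReal.half_pos hε.ne'))
    refine ⟨n₀, fun m hm n hn => ?_⟩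
    rw [Lp.edist_toLp_toLp]
    calc _ ≤ a m + a n := h m n
      _ < ε / 2 + ε / 2 := ENNReal.add_lt_add (hn₀ m hm) (hn₀ n hn)
      _ = ε := ENNReal.add_halves ε
  obtain ⟨g, hg⟩ := cauchySeq_tendsto_of_complete hC
  refine ⟨g, Lp.memLp g, ?_⟩
  rw [← Lp.toLp_coeFn g (Lp.memLp g)] at hg
  exact (Lp.tendsto_Lp_iff_tendsto_eLpNorm'' _ hf _ (Lp.memLp g)).1 hg

/-- Interpolation between convergence in L¹ and boundedness in L²; it upgrades the L¹ convergence of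
truncated gradients to L^q with q < 2. -/
theorem MeasureTheory.tendsto_eLpNorm_of_bounded {α F : Type*} [MeasurableSpace α]
    {μ : Measure α} [NormedAddCommGroup F] {f : ℕ → α → F} (hf : ∀ n, AEStronglyMeasurable (f n) μ)
    {M : ℝ≥0∞} (hM : M ≠ ⊤) (h2 : ∀ n, eLpNorm (f n) 2 μ ≤ M)
    (h1 : Tendsto (fun n => eLpNorm (f n) 1 μ) atTop (𝓝 0)) {q : ℝ} (hq : 1 ≤ q) (hq2 : q < 2) :
    Tendsto (fun n => eLpNorm (f n) (ENNReal.ofReal q) μ) atTop (𝓝 0) := by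
  have hq0 : 0 < q := by linarith
  have hle : ∀ n, eLpNorm (f n) (ENNReal.ofReal q) μ ≤
      (eLpNorm (f n) 1 μ ^ (2 - q) * (M ^ (2 : ℝ)) ^ (q - 1)) ^ (1 / q) := by
    intro n
    rw [eLpNorm_eq_lintegral_rpow_enorm_toReal (by simpa using hq0) ENNReal.ofReal_ne_top,
      ENNReal.toReal_ofReal hq0.le]
    gcongr
    have h3 : ∫⁻ x, ‖f n x‖ₑ ^ (2 : ℝ) ∂μ ≤ M ^ (2 : ℝ) := by
      refine le_trans (le_of_eq ?_) (ENNReal.rpow_le_rpow (h2 n) zero_le_two)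
      rw [eLpNorm_eq_lintegral_rpow_enorm_toReal two_ne_zero ENNReal.ofNat_ne_top,
        ← ENNReal.rpow_mul]
      simp
    calc ∫⁻ x, ‖f n x‖ₑ ^ q ∂μ = ∫⁻ x, ‖f n x‖ₑ ^ (2 - q) * (‖f n x‖ₑ ^ (2 : ℝ)) ^ (q - 1) ∂μ := by
          refine lintegral_congr fun x => ?_
          rw [← ENNReal.rpow_mul, ← ENNReal.rpow_add_of_nonneg _ _ (by linarith) (by linarith)]
          congr 1; ring
      _ ≤ (∫⁻ x, ‖f n x‖ₑ ∂μ) ^ (2 - q) * (∫⁻ x, ‖f n x‖ₑ ^ (2 : ℝ) ∂μ) ^ (q - 1) :=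
          ENNReal.lintegral_mul_norm_pow_le (hf n).enorm ((hf n).enorm.pow_const _) (by linarith)
            (by linarith) (by ring)
      _ ≤ _ := by
          rw [eLpNorm_one_eq_lintegral_enorm]
          gcongr
  refine tendsto_of_tendsto_of_tendsto_of_le_of_le tendsto_const_nhds ?_ (fun _ => zero_le) hle
  have e : (0 : ℝ≥0∞) = (0 ^ (2 - q) * (M ^ (2 : ℝ)) ^ (q - 1)) ^ (1 / q) := by
    rw [ENNReal.zero_rpow_of_pos (by linarith), zero_mul, ENNReal.zero_rpow_of_pos (by positivity)]
  rw [e]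
  refine (ENNReal.continuous_rpow_const.tendsto _).comp (ENNReal.Tendsto.mul_const
    ((ENNReal.continuous_rpow_const.tendsto _).comp h1) (Or.inr ?_))
  exact ENNReal.rpow_ne_top_of_nonneg (by linarith) (ENNReal.rpow_ne_top_of_nonneg (by norm_num) hM)

namespace EnergyEstimate

variable {α F : Type*} [MeasurableSpace α] [NormedAddCommGroup F] [NormedSpace ℝ F]
  {μ : Measure α} {σ : ℝ} {K : ℝ≥0} {h w : α → ℝ} {W : α → F}

/-- The energy on a sublevel set of `w`. -/
theorem eLpNorm_smul_le (H : EnergyEstimate μ σ K h w W) {k : ℝ} (hk : 0 < k) {c : ℝ → ℝ}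
    (hc : ∀ s, |c s| ≤ (Ioo (-k) k).indicator 1 s) :
    eLpNorm (fun x => c (w x) • W x) 2 μ ≤
      (K * (eLpNorm h 1 μ * ENNReal.ofReal k)) ^ (1 / 2 : ℝ) := by
  rw [eLpNorm_eq_lintegral_rpow_enorm_toReal two_ne_zero ENNReal.ofNat_ne_top, ENNReal.toReal_ofNat]
  gcongr
  calc ∫⁻ x, ‖c (w x) • W x‖ₑ ^ (2 : ℝ) ∂μ
      ≤ ∫⁻ x, ENNReal.ofReal ((Ioo (-k) k).indicator (fun _ => (1 : ℝ)) (w x)) * ‖W x‖ₑ ^ 2 ∂μ := by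
        refine lintegral_mono fun x => ?_
        rw [enorm_smul, ENNReal.rpow_two, mul_pow]
        gcongr
        have h1 := hc (w x)
        rw [← ofReal_norm, Real.norm_eq_abs, ← ENNReal.ofReal_pow (abs_nonneg _)]
        refine ENNReal.ofReal_le_ofReal ?_
        by_cases hx : w x ∈ Ioo (-k) k
        · rw [indicator_of_mem hx] at h1 ⊢
          exact pow_le_one₀ (abs_nonneg _) h1
        · rw [indicator_of_notMem hx] at h1 ⊢
          have := le_antisymm h1 (abs_nonneg _)
          rw [this]; norm_num
    _ ≤ K * ∫⁻ x, ‖h x‖ₑ * ‖primitive (fun _ => 1) (trunc k (w x))‖ₑ ∂μ :=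
        H.energy k hk (fun _ => 1) continuous_const (by simp)
    _ ≤ _ := by
        gcongr
        rw [eLpNorm_one_eq_lintegral_enorm, ← lintegral_mul_const' _ _ ENNReal.ofReal_ne_top]
        refine lintegral_mono fun x => ?_
        gcongr
        rw [primitive_one, ← ofReal_norm]
        exact ENNReal.ofReal_le_ofReal (abs_trunc_le hk.le _)

end EnergyEstimate

namespace XElliptic

variable {N m : ℕ} {X : Fin m → E N → E N} {Ω : Set (E N)} {Q α : ℝ}
  {A : E N → Matrix (Fin m) (Fin m) ℝ} {f g u v : E N → ℝ} {U V : E N → E m}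

/-- `u` is a solution found by approximation with datum `f`, and `U = X u`. -/
def IsApproxSolutionWith (X : Fin m → E N → E N) (Ω : Set (E N))
    (A : E N → Matrix (Fin m) (Fin m) ℝ) (f u : E N → ℝ) (U : E N → E m) : Prop :=
  MemLp u 1 (volume.restrict Ω) ∧ MemLp U 1 (volume.restrict Ω) ∧
    ∃ (fn un : ℕ → E N → ℝ) (Un : ℕ → E N → E m),
    (∀ n, MemLp (fn n) 1 (volume.restrict Ω) ∧ IsWeakSolutionWith X Ω A (fn n) (un n) (Un n)) ∧
    Tendsto (fun n => eLpNorm (fn n - f) 1 (volume.restrict Ω)) atTop (𝓝 0) ∧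
    Tendsto (fun n => eLpNorm (un n - u) 1 (volume.restrict Ω)) atTop (𝓝 0) ∧
    Tendsto (fun n => eLpNorm (Un n - U) 1 (volume.restrict Ω)) atTop (𝓝 0)

theorem IsAdmissible.isFiniteMeasure (hX : IsAdmissible X Ω Q) :
    IsFiniteMeasure (volume.restrict Ω) := ⟨by simpa using hX.volume_lt_top⟩

theorem one_lt_twoLowerStar (hQ : 2 < Q) : 1 < twoLowerStar Q := by
  rw [twoLowerStar, lt_div_iff₀ (by linarith)]
  linarith

/-- By linearity the L¹ gradient estimate applies to differences of approximating solutions, so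
their gradients are Cauchy along with the data. The definition demands convergence of the solutions
only. -/
theorem IsApproxSolution.exists_grad (hN : 2 ≤ N) (hX : IsAdmissible X Ω Q) (hα : 0 < α)
    (hA : IsElliptic Ω α A) (hf : MemLp f 1 (volume.restrict Ω))
    (hu : IsApproxSolution X Ω Q A f u) : ∃ U, IsApproxSolutionWith X Ω A f u U := by
  have := hX.isFiniteMeasure
  obtain ⟨K, HK⟩ := hX.exists_energyEstimate (m := m) hN hα
  have hσ : 1 < Q / (Q - 2) := by
    have := hX.two_lt
    rw [one_lt_div (by linarith)]; linarith
  obtain ⟨C, HC⟩ := EnergyEstimate.exists_eLpNorm_grad_one_le (F := E m) (μ := volume.restrict Ω) hσ K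
  obtain ⟨hu1, fn, un, hn, h1, h2⟩ := hu
  choose Un hUn using fun n => (hn n).2
  have hfn : ∀ n, MemLp (fn n) 1 (volume.restrict Ω) := fun n =>
    (hn n).1.mono_exponent (by
      rw [← ENNReal.ofReal_one]
      exact ENNReal.ofReal_le_ofReal (one_lt_twoLowerStar hX.two_lt).le)
  have hU1 : ∀ n, MemLp (Un n) 1 (volume.restrict Ω) := fun n =>
    (hUn n).1.2.1.mono_exponent one_le_two
  have ha := ENNReal.Tendsto.const_mul (a := (C : ℝ≥0∞)) h1 (Or.inr ENNReal.coe_ne_top)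
  rw [mul_zero] at ha
  obtain ⟨U, hU, hlim⟩ := exists_tendsto_eLpNorm_of_cauchy hU1 ha fun n k => by
    refine (HC _ _ _ (HK A _ _ _ _ _ _ hA (hfn n) (hfn k) (hUn n) (hUn k))).trans ?_
    rw [← mul_add]
    gcongr
    rw [show fn n - fn k = (fn n - f) - (fn k - f) by abel]
    exact eLpNorm_sub_le ((hfn n).1.sub hf.1) ((hfn k).1.sub hf.1) le_rfl
  exact ⟨U, hu1, hU, fn, un, Un, fun n => ⟨hfn n, hUn n⟩, h1, h2, hlim⟩

theorem IsApproxSolutionWith.memW0 (hX : IsAdmissible X Ω Q)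
    (hu : IsApproxSolutionWith X Ω A f u U) : MemW0 X Ω 1 u U := by
  obtain ⟨hu1, hU1, fn, un, Un, hn, -, h2, h3⟩ := hu
  exact MemW0.of_tendsto hX.continuous_field le_rfl (fun n => (hn n).2.1.mono_exponent
    hX.continuous_field hX.volume_lt_top le_rfl one_le_two) hu1 hU1 h2 h3

/-- Differences of solutions found by approximation. -/
theorem IsApproxSolutionWith.exists_seq {K : ℝ≥0} (hX : IsAdmissible X Ω Q)
    (hA : IsElliptic Ω α A)
    (HK : ∀ (A : E N → Matrix (Fin m) (Fin m) ℝ) (f g u v : E N → ℝ) (U V : E N → E m),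
      IsElliptic Ω α A → MemLp f 1 (volume.restrict Ω) → MemLp g 1 (volume.restrict Ω) →
      IsWeakSolutionWith X Ω A f u U → IsWeakSolutionWith X Ω A g v V →
      EnergyEstimate (volume.restrict Ω) (Q / (Q - 2)) K (f - g) (u - v) (U - V))
    (hf : MemLp f 1 (volume.restrict Ω)) (hg : MemLp g 1 (volume.restrict Ω))
    (hu : IsApproxSolutionWith X Ω A f u U) (hv : IsApproxSolutionWith X Ω A g v V) :
    ∃ (hn wn : ℕ → E N → ℝ) (Wn : ℕ → E N → E m),
      (∀ n, EnergyEstimate (volume.restrict Ω) (Q / (Q - 2)) K (hn n) (wn n) (Wn n)) ∧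
      (∀ n, MemW0 X Ω 2 (wn n) (Wn n)) ∧
      Tendsto (fun n => eLpNorm (hn n - (f - g)) 1 (volume.restrict Ω)) atTop (𝓝 0) ∧
      Tendsto (fun n => eLpNorm (Wn n - (U - V)) 1 (volume.restrict Ω)) atTop (𝓝 0) ∧
      (∀ᵐ x ∂(volume.restrict Ω), Tendsto (fun n => wn n x) atTop (𝓝 ((u - v) x))) ∧
      (∀ᵐ x ∂(volume.restrict Ω), Tendsto (fun n => Wn n x) atTop (𝓝 ((U - V) x))) := by
  obtain ⟨hu1, hU1, fn, un, Un, hn, h1, h2, h3⟩ := hu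
  obtain ⟨hv1, hV1, gn, vn, Vn, hn', h1', h2', h3'⟩ := hv
  have hsub : ∀ {F : Type} [NormedAddCommGroup F] {a b : ℕ → E N → F} {c d : E N → F},
      (∀ n, AEStronglyMeasurable (a n - c) (volume.restrict Ω)) →
      (∀ n, AEStronglyMeasurable (b n - d) (volume.restrict Ω)) →
      Tendsto (fun n => eLpNorm (a n - c) 1 (volume.restrict Ω)) atTop (𝓝 0) →
      Tendsto (fun n => eLpNorm (b n - d) 1 (volume.restrict Ω)) atTop (𝓝 0) →
      Tendsto (fun n => eLpNorm ((a n - b n) - (c - d)) 1 (volume.restrict Ω)) atTop (𝓝 0) := by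
    intro F _ a b c d ha hb hac hbd
    have h := hac.add hbd
    rw [add_zero] at h
    refine tendsto_of_tendsto_of_tendsto_of_le_of_le tendsto_const_nhds h (fun _ => zero_le)
      fun n => ?_
    rw [sub_sub_sub_comm]
    exact eLpNorm_sub_le (ha n) (hb n) le_rfl
  have k1 := hsub (fun n => (hn n).1.1.sub hf.1) (fun n => (hn' n).1.1.sub hg.1) h1 h1'
  have k2 := hsub (fun n => (hn n).2.1.1.1.sub hu1.1) (fun n => (hn' n).2.1.1.1.sub hv1.1) h2 h2'
  have k3 := hsub (fun n => (hn n).2.1.2.1.1.sub hU1.1) (fun n => (hn' n).2.1.2.1.1.sub hV1.1) h3 h3'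
  -- Two successive extractions: one for the functions, a further one for the gradients.
  obtain ⟨ns, hns, hae⟩ := (tendstoInMeasure_of_tendsto_eLpNorm one_ne_zero
    (fun n => (hn n).2.1.1.1.sub (hn' n).2.1.1.1) (hu1.1.sub hv1.1) k2).exists_seq_tendsto_ae
  have k3' := k3.comp hns.tendsto_atTop
  obtain ⟨ms, hms, hae'⟩ := (tendstoInMeasure_of_tendsto_eLpNorm one_ne_zero
    (fun n => (hn (ns n)).2.1.2.1.1.sub (hn' (ns n)).2.1.2.1.1) (hU1.1.sub hV1.1)
    k3').exists_seq_tendsto_ae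
  refine ⟨fun n => fn (ns (ms n)) - gn (ns (ms n)), fun n => un (ns (ms n)) - vn (ns (ms n)),
    fun n => Un (ns (ms n)) - Vn (ns (ms n)), fun n => HK A _ _ _ _ _ _ hA (hn _).1 (hn' _).1
      (hn _).2 (hn' _).2, fun n => (hn _).2.1.sub hX.continuous_field one_le_two (hn' _).2.1,
    k1.comp (hns.comp hms).tendsto_atTop, k3.comp (hns.comp hms).tendsto_atTop, ?_, hae'⟩
  filter_upwards [hae] with x hx
  exact hx.comp hms.tendsto_atTop

/-- A limit of functions satisfying uniform energy estimates belongs to `W₀^{1,q}`, `q < 2`, as soon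
as it has the right integrability. -/
theorem MemW0.of_energyEstimate {K : ℝ≥0} {σ : ℝ} (hX : IsAdmissible X Ω Q) (hσ : 0 ≤ σ)
    {h w : E N → ℝ} {W : E N → E m} {hn wn : ℕ → E N → ℝ} {Wn : ℕ → E N → E m}
    (hh : MemLp h 1 (volume.restrict Ω))
    (H : ∀ n, EnergyEstimate (volume.restrict Ω) σ K (hn n) (wn n) (Wn n))
    (hmem : ∀ n, MemW0 X Ω 2 (wn n) (Wn n))
    (h1 : Tendsto (fun n => eLpNorm (hn n - h) 1 (volume.restrict Ω)) atTop (𝓝 0))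
    (h2 : Tendsto (fun n => eLpNorm (Wn n - W) 1 (volume.restrict Ω)) atTop (𝓝 0))
    (hw : ∀ᵐ x ∂(volume.restrict Ω), Tendsto (fun n => wn n x) atTop (𝓝 (w x)))
    (hW : ∀ᵐ x ∂(volume.restrict Ω), Tendsto (fun n => Wn n x) atTop (𝓝 (W x)))
    (hW1 : MemLp W 1 (volume.restrict Ω)) {q : ℝ} (hq : 1 ≤ q) (hq2 : q < 2)
    (hwq : MemLp w (ENNReal.ofReal q) (volume.restrict Ω))
    (hWq : MemLp W (ENNReal.ofReal q) (volume.restrict Ω)) :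
    MemW0 X Ω (ENNReal.ofReal q) w W := by
  have := hX.isFiniteMeasure
  set μ := volume.restrict Ω
  have hq1 : 1 ≤ ENNReal.ofReal q := by simpa using hq
  have hq2' : ENNReal.ofReal q ≤ 2 := by
    have := ENNReal.ofReal_le_ofReal hq2.le
    simpa using this
  have H0 := EnergyEstimate.of_tendsto hσ H hh h1 hw hW
  -- Cut-offs equal to 1 on [-j,j] and 0 outside (-(j+1),j+1). The limit is double: n → ∞ at fixed
  -- j, where truncated gradients are bounded in L², then j → ∞ by domination from the assumed L^q
  -- integrability. As b_j vanishes at the truncation level, the indicator disappears and b_j(wₙ)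
  -- converges a.e.
  let b : ℕ → ℝ → ℝ := fun j s => max 0 (min 1 ((j + 1 : ℝ) - |s|))
  have hbc : ∀ j, Continuous (b j) := fun j => by fun_prop
  have hb0 : ∀ j s, 0 ≤ b j s := fun j s => le_max_left _ _
  have hb1 : ∀ j s, |b j s| ≤ 1 := fun j s => by
    rw [abs_of_nonneg (hb0 j s)]
    exact max_le zero_le_one (min_le_left _ _)
  have hbI : ∀ j : ℕ, (Ioo (-(j + 1 : ℝ)) (j + 1)).indicator (b j) = b j := by
    intro j
    refine indicator_eq_self.2 fun s hs => ?_
    by_contra hns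
    rw [mem_Ioo, ← abs_lt, not_lt] at hns
    refine hs (max_eq_left ((min_le_right _ _).trans (by linarith)))
  have hbI' : ∀ (j : ℕ) s, |b j s| ≤ (Ioo (-(j + 1 : ℝ)) (j + 1)).indicator 1 s := by
    intro j s
    by_cases hs : s ∈ Ioo (-(j + 1 : ℝ)) (j + 1)
    · rw [indicator_of_mem hs]; exact hb1 j s
    · rw [indicator_of_notMem hs, ← hbI j, indicator_of_notMem hs, abs_zero]
  have hstep : ∀ j : ℕ, MemW0 X Ω (ENNReal.ofReal q)
      (fun x => primitive (b j) (trunc (j + 1) (w x))) (fun x => b j (w x) • W x) := by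
    intro j
    have hj : (0 : ℝ) < j + 1 := by positivity
    have hc : Continuous fun s => primitive (b j) (trunc (j + 1) s) :=
      (continuous_primitive_of_continuous (hbc j)).comp (continuous_trunc _)
    obtain ⟨M, hM0, hM⟩ :=
      (continuous_primitive_of_continuous (hbc j)).exists_abs_comp_trunc_le hj.le
    have hn1 : ∀ n, MemW0 X Ω (ENNReal.ofReal q)
        (fun x => primitive (b j) (trunc (j + 1) (wn n x))) (fun x => b j (wn n x) • Wn n x) := by
      intro n
      have h3 := (hmem n).primitive_trunc hX.continuous_field one_le_two ENNReal.ofNat_ne_top hj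
        (hbc j)
      rw [hbI] at h3
      exact h3.mono_exponent hX.continuous_field hX.volume_lt_top hq1 hq2'
    have hm2 : MemLp (fun x => b j (w x) • W x) 2 μ := by
      refine ⟨((hbc j).comp_aestronglyMeasurable H0.meas).smul H0.meas_grad,
        (H0.eLpNorm_smul_le hj (hbI' j)).trans_lt ?_⟩
      exact ENNReal.rpow_lt_top_of_nonneg (by norm_num) (ENNReal.mul_ne_top ENNReal.coe_ne_top
        (ENNReal.mul_ne_top hh.2.ne ENNReal.ofReal_ne_top))
    have hmw : MemLp (fun x => primitive (b j) (trunc (j + 1) (w x))) (ENNReal.ofReal q) μ :=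
      MemLp.of_bound (hc.comp_aestronglyMeasurable H0.meas) M (Eventually.of_forall fun x => hM _)
    refine MemW0.of_tendsto hX.continuous_field hq1 hn1 hmw (hm2.mono_exponent hq2') ?_ ?_
    · refine tendsto_eLpNorm_zero_of_dominated ENNReal.ofReal_ne_top
        (fun n => (hn1 n).1.1.sub hmw.1) (memLp_const (2 * M))
        (fun n => Eventually.of_forall fun x => ?_) ?_
      · have h3 := hM (wn n x)
        have h4 := hM (w x)
        simp only [Pi.sub_apply, Real.norm_eq_abs]
        exact (abs_sub _ _).trans (by linarith)
      · filter_upwards [hw] with x hx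
        have := ((hc.tendsto (w x)).comp hx).sub_const (primitive (b j) (trunc (j + 1) (w x)))
        rw [sub_self] at this
        exact this
    · have hsup : ∃ B : ℝ≥0∞, B ≠ ⊤ ∧ ∀ᶠ n in atTop, eLpNorm (hn n) 1 μ ≤ B := by
        refine ⟨1 + eLpNorm h 1 μ, ENNReal.add_ne_top.2 ⟨ENNReal.one_ne_top, hh.2.ne⟩, ?_⟩
        filter_upwards [h1.eventually_lt_const one_pos] with n hn3
        have h4 := eLpNorm_add_le ((H n).memLp.1.sub hh.1) hh.1 (p := 1) le_rfl
        rw [sub_add_cancel] at h4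
        exact h4.trans (by gcongr)
      obtain ⟨B, hB, hev⟩ := hsup
      obtain ⟨n₀, hn₀⟩ := eventually_atTop.1 hev
      have hKB : ∀ {e : ℝ≥0∞}, e ≠ ⊤ → (K * (e * ENNReal.ofReal (j + 1))) ^ (1 / 2 : ℝ) ≠ ⊤ :=
        fun he => ENNReal.rpow_ne_top_of_nonneg (by norm_num) (ENNReal.mul_ne_top ENNReal.coe_ne_top
          (ENNReal.mul_ne_top he ENNReal.ofReal_ne_top))
      have hmn : ∀ n, AEStronglyMeasurable ((fun x => b j (wn n x) • Wn n x) -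
          fun x => b j (w x) • W x) μ := fun n => (hn1 n).2.1.1.sub hm2.1
      -- The norms ‖hₙ‖₁ are controlled only from n₀ on, so the sequence is shifted to have a
      -- uniform energy bound.
      rw [← tendsto_add_atTop_iff_nat n₀]
      refine tendsto_eLpNorm_of_bounded (fun n => hmn _) (ENNReal.add_ne_top.2 ⟨hKB hB, hKB hh.2.ne⟩)
        (fun n => ?_) ?_ hq hq2
      · refine (eLpNorm_sub_le (hn1 _).2.1.1 hm2.1 one_le_two).trans (add_le_add
          (((H _).eLpNorm_smul_le hj (hbI' j)).trans ?_) (H0.eLpNorm_smul_le hj (hbI' j)))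
        gcongr
        exact hn₀ _ (by omega)
      · refine (tendsto_add_atTop_iff_nat (f := fun n => eLpNorm ((fun x => b j (wn n x) • Wn n x) -
          fun x => b j (w x) • W x) 1 μ) n₀).2 ?_
        have h3 : Tendsto (fun n => eLpNorm (fun x => (b j (wn n x) - b j (w x)) • W x) 1 μ) atTop
            (𝓝 0) := by
          refine tendsto_eLpNorm_zero_of_dominated ENNReal.one_ne_top (fun n => ?_)
            (hW1.norm.const_mul 2) (fun n => Eventually.of_forall fun x => ?_) ?_
          · exact (((hbc j).comp_aestronglyMeasurable (H n).meas).sub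
              ((hbc j).comp_aestronglyMeasurable H0.meas)).smul hW1.1
          · rw [norm_smul]
            refine mul_le_mul_of_nonneg_right ?_ (norm_nonneg _)
            exact (abs_sub _ _).trans (by linarith [hb1 j (wn n x), hb1 j (w x)])
          · filter_upwards [hw] with x hx
            have := ((((hbc j).tendsto (w x)).comp hx).sub_const (b j (w x))).smul_const (W x)
            simpa using this
        have h4 := h2.add h3
        rw [add_zero] at h4
        refine tendsto_of_tendsto_of_tendsto_of_le_of_le tendsto_const_nhds h4 (fun _ => zero_le)
          fun n => ?_
        -- The first piece is controlled by L¹ convergence of the gradients; the second has the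
        -- fixed factor W and tends to 0 by domination.
        have e : ((fun x => b j (wn n x) • Wn n x) - fun x => b j (w x) • W x) =
            (fun x => b j (wn n x) • (Wn n - W) x) + fun x => (b j (wn n x) - b j (w x)) • W x := by
          ext1 x
          simp only [Pi.sub_apply, Pi.add_apply, smul_sub, sub_smul]
          abel
        rw [e]
        have m1 := (hbc j).comp_aestronglyMeasurable (H n).meas
        refine (eLpNorm_add_le (m1.smul ((H n).meas_grad.sub hW1.1)) ((m1.sub
          ((hbc j).comp_aestronglyMeasurable H0.meas)).smul hW1.1) le_rfl).trans
          (add_le_add_left (eLpNorm_mono fun x => ?_) _)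
        rw [Pi.smul_apply', norm_smul]
        exact mul_le_of_le_one_left (norm_nonneg _) (hb1 j _)
  have hb_ev : ∀ s : ℝ, ∀ᶠ j in atTop, ∀ y : ℝ, |y| ≤ |s| → b j y = 1 := by
    intro s
    obtain ⟨n₀, hn₀⟩ := exists_nat_gt |s|
    filter_upwards [eventually_ge_atTop n₀] with j hj y hy
    have : (n₀ : ℝ) ≤ j := by exact_mod_cast hj
    simp only [b]
    rw [min_eq_left (by linarith), max_eq_right zero_le_one]
  refine MemW0.of_tendsto hX.continuous_field hq1 hstep hwq hWq ?_ ?_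
  · refine tendsto_eLpNorm_zero_of_dominated ENNReal.ofReal_ne_top
      (fun j => (hstep j).1.1.sub hwq.1) (hwq.norm.const_mul 2)
      (fun j => Eventually.of_forall fun x => ?_) (Eventually.of_forall fun x => ?_)
    · have h3 := abs_primitive_le (hbc j).measurable (hb1 j) (trunc (j + 1) (w x))
      have h4 := abs_trunc_le_abs (k := (j : ℝ) + 1) (by positivity) (w x)
      simp only [Pi.sub_apply, Real.norm_eq_abs]
      exact (abs_sub _ _).trans (by linarith)
    · refine tendsto_const_nhds.congr' ?_
      obtain ⟨n₀, hn₀⟩ := exists_nat_gt |w x|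
      filter_upwards [hb_ev (w x), eventually_ge_atTop n₀] with j hj hj'
      have : (n₀ : ℝ) ≤ j := by exact_mod_cast hj'
      rw [Pi.sub_apply, trunc_eq_self (by linarith), primitive_congr (c := fun _ => 1) hj,
        EnergyEstimate.primitive_one, sub_self]
  · refine tendsto_eLpNorm_zero_of_dominated ENNReal.ofReal_ne_top
      (fun j => (hstep j).2.1.1.sub hWq.1) (hWq.norm.const_mul 2)
      (fun j => Eventually.of_forall fun x => ?_) (Eventually.of_forall fun x => ?_)
    · rw [Pi.sub_apply]
      refine (norm_sub_le _ _).trans ?_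
      rw [norm_smul, two_mul]
      exact add_le_add_left (mul_le_of_le_one_left (norm_nonneg _) (hb1 j _)) _
    · refine tendsto_const_nhds.congr' ?_
      filter_upwards [hb_ev (w x)] with j hj
      rw [Pi.sub_apply, hj _ le_rfl, one_smul, sub_self]

end XElliptic

/-! ### Stability in each range of p -/

namespace XElliptic

variable {N m : ℕ} {X : Fin m → E N → E N} {Ω : Set (E N)} {Q α : ℝ} {p : ℝ≥0∞}

theorem marcinkiewiczNorm_le {F : Type*} [NormedAddCommGroup F] {w : E N → F} {a : ℝ} (ha : 0 < a)
    {D : ℝ≥0} {e : ℝ≥0∞} (he : e ≠ ⊤)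
    (h : ∀ ε : ℝ, 0 < ε → e ≤ ENNReal.ofReal ε → ∀ t : ℝ, 0 < t →
      volume.restrict Ω {x | t ≤ ‖w x‖} ≤ D * ENNReal.ofReal ((ε / t) ^ a)) :
    marcinkiewiczNorm Ω a w ≤ (D ^ (1 / a) : ℝ≥0) * e := by
  refine ENNReal.le_mul_of_forall_ofReal he fun ε hε hle => ?_
  have h1 : sInf {C : ℝ≥0∞ | ∀ t : ℝ, 0 < t →
      (volume.restrict Ω) {x | t ≤ ‖w x‖} ≤ C / ENNReal.ofReal (t ^ a)} ≤
      D * ENNReal.ofReal (ε ^ a) := by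
    refine sInf_le fun t ht => (h ε hε hle t ht).trans (le_of_eq ?_)
    rw [mul_div_assoc, ← ENNReal.ofReal_div_of_pos (by positivity), Real.div_rpow hε.le ht.le]
  rw [marcinkiewiczNorm]
  calc _ ≤ (D * ENNReal.ofReal (ε ^ a)) ^ (1 / a) := ENNReal.rpow_le_rpow h1 (by positivity)
    _ = _ := by
      rw [ENNReal.mul_rpow_of_nonneg _ _ (by positivity), ENNReal.coe_rpow_of_nonneg _ (by positivity),
        ENNReal.ofReal_rpow_of_nonneg (by positivity) (by positivity), ← Real.rpow_mul hε.le,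
        mul_one_div_cancel ha.ne', Real.rpow_one]

theorem one_lt_div_sub_two (hQ : 2 < Q) : 1 < Q / (Q - 2) := by
  rw [one_lt_div (by linarith)]
  linarith

theorem one_lt_ofReal_twoLowerStar (hQ : 2 < Q) : 1 < ENNReal.ofReal (twoLowerStar Q) := by
  rw [← ENNReal.ofReal_one]
  exact ENNReal.ofReal_lt_ofReal_iff_of_nonneg zero_le_one |>.2 (one_lt_twoLowerStar hQ)

/-- The energy estimate for weak solutions. -/
theorem exists_grad_two_le (hN : 2 ≤ N) (hX : IsAdmissible X Ω Q) (hα : 0 < α)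
    (hp : ENNReal.ofReal (twoLowerStar Q) ≤ p) :
    ∃ K C : ℝ≥0, ∀ A : E N → Matrix (Fin m) (Fin m) ℝ, IsElliptic Ω α A → ∀ f g u v : E N → ℝ,
      MemLp f p (volume.restrict Ω) → MemLp g p (volume.restrict Ω) →
      IsWeakSolution X Ω A f u → IsWeakSolution X Ω A g v →
      ∃ W, EnergyEstimate (volume.restrict Ω) (Q / (Q - 2)) K (f - g) (u - v) W ∧
        MemW0 X Ω 2 (u - v) W ∧
        eLpNorm W 2 (volume.restrict Ω) ≤ C * eLpNorm (f - g) p (volume.restrict Ω) := by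
  have := hX.isFiniteMeasure
  have hQ := hX.two_lt
  have h1p : 1 ≤ p := (one_lt_ofReal_twoLowerStar hQ).le.trans hp
  obtain ⟨K, HK⟩ := hX.exists_energyEstimate (m := m) hN hα
  have hconj : (twoLowerStar Q).HolderConjugate (2 * (Q / (Q - 2))) := by
    refine Real.holderConjugate_iff.2 ⟨one_lt_twoLowerStar hQ, ?_⟩
    have : Q - 2 ≠ 0 := by linarith
    have : Q + 2 ≠ 0 := by linarith
    have : Q ≠ 0 := by linarith
    rw [twoLowerStar]
    field_simp
    ring
  obtain ⟨C, HC⟩ := EnergyEstimate.exists_eLpNorm_grad_two_le (F := E m) (μ := volume.restrict Ω)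
    (one_lt_div_sub_two hQ) K hconj
  obtain ⟨C', HC'⟩ := exists_eLpNorm_le_of_exponent_le (volume.restrict Ω)
    (one_lt_ofReal_twoLowerStar hQ).le hp
  refine ⟨K, C * C', fun A hA f g u v hf hg hu hv => ?_⟩
  obtain ⟨U, hU⟩ := hu
  obtain ⟨V, hV⟩ := hv
  have H := HK A f g u v U V hA (hf.mono_exponent h1p) (hg.mono_exponent h1p) hU hV
  refine ⟨U - V, H, hU.1.sub hX.continuous_field one_le_two hV.1,
    (HC _ _ _ H ((hf.sub hg).mono_exponent hp)).trans ?_⟩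
  rw [ENNReal.coe_mul, mul_assoc]
  gcongr
  exact HC' _ (hf.sub hg).1

theorem exists_stability_of_gt (hN : 2 ≤ N) (hX : IsAdmissible X Ω Q) (hα : 0 < α)
    (hp : ENNReal.ofReal (Q / 2) < p) :
    ∃ C : ℝ≥0, ∀ A : E N → Matrix (Fin m) (Fin m) ℝ, IsElliptic Ω α A → ∀ f g u v : E N → ℝ,
      MemLp f p (volume.restrict Ω) → MemLp g p (volume.restrict Ω) →
      IsSolution X Ω Q A p f u → IsSolution X Ω Q A p g v →
      eLpNorm (u - v) ⊤ (volume.restrict Ω) ≤ C * eLpNorm (f - g) p (volume.restrict Ω) ∧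
      ∃ W, MemW0 X Ω 2 (u - v) W ∧
        eLpNorm W 2 (volume.restrict Ω) ≤ C * eLpNorm (f - g) p (volume.restrict Ω) := by
  have := hX.isFiniteMeasure
  have hQ := hX.two_lt
  have hp2 : ENNReal.ofReal (twoLowerStar Q) ≤ p := by
    refine le_trans (ENNReal.ofReal_le_ofReal ?_) hp.le
    rw [twoLowerStar, div_le_div_iff₀ (by linarith) (by norm_num)]
    nlinarith
  -- A finite exponent above Q/2 is enough, and it covers p = ∞ since Ω has finite measure.
  obtain ⟨s, hs, hsp⟩ : ∃ s : ℝ, Q / 2 < s ∧ ENNReal.ofReal s ≤ p := by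
    obtain ⟨s, hs, hsp⟩ := ENNReal.lt_iff_exists_nnreal_btwn.1 hp
    rw [ENNReal.ofReal_lt_coe_iff (by linarith)] at hs
    exact ⟨s, hs, by simpa using hsp.le⟩
  obtain ⟨K, C, H⟩ := exists_grad_two_le (m := m) hN hX hα hp2
  have hs1 : 1 < s := by linarith
  have hconj := Real.HolderConjugate.conjExponent hs1
  obtain ⟨C₁, H₁⟩ := EnergyEstimate.exists_eLpNorm_top_le (F := E m) (μ := volume.restrict Ω)
    (one_lt_div_sub_two hQ) K hconj (by
      rw [Real.conjExponent, div_lt_div_iff₀ (by linarith) (by linarith)]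
      linarith)
  have h1s : 1 ≤ ENNReal.ofReal s := by simpa using hs1.le
  obtain ⟨C₂, H₂⟩ := exists_eLpNorm_le_of_exponent_le (volume.restrict Ω) h1s hsp
  refine ⟨C₁ * C₂ + C, fun A hA f g u v hf hg hu hv => ?_⟩
  obtain ⟨W, hW, hWm, hWle⟩ := H A hA f g u v hf hg (hu.1 hp2) (hv.1 hp2)
  refine ⟨(H₁ _ _ _ hW ((hf.sub hg).mono_exponent hsp)).trans ?_, W, hWm, hWle.trans ?_⟩
  · rw [ENNReal.coe_add, ENNReal.coe_mul, add_mul, mul_assoc]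
    exact le_add_of_le_of_nonneg (mul_le_mul' le_rfl (H₂ _ (hf.sub hg).1)) zero_le
  · gcongr
    simp

/-- γ is the solution of 2σγ = q** with σ = Q/(Q-2). Then γ > 1/2 means q > 1, and q < Q/2 keeps the
denominators positive. The last identity is the cancellation needed in the Hölder step for the
gradient in L^{q*}. -/
theorem starStar_exponent {q : ℝ} (hQ : 2 < Q) (hq : 1 < q) (hqQ : q < Q / 2) :
    ∃ γ p', 1 / 2 < γ ∧ q.HolderConjugate p' ∧
      (2 * γ - 1) * p' = 2 * (Q / (Q - 2)) * γ ∧ 2 * (Q / (Q - 2)) * γ = starStar Q q ∧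
      (1 - γ) * star Q q = 2 * (Q / (Q - 2)) * γ * (1 - star Q q / 2) := by
  have h1 : 0 < Q - 2 * q := by linarith
  have h2 : 0 < Q - 2 := by linarith
  have h3 : 0 < q - 1 := by linarith
  have h4 : 0 < Q - q := by linarith
  refine ⟨q * (Q - 2) / (2 * (Q - 2 * q)), q.conjExponent, ?_,
    Real.HolderConjugate.conjExponent hq, ?_, ?_, ?_⟩
  · rw [div_lt_div_iff₀ (by norm_num) (by positivity)]
    nlinarith
  · rw [Real.conjExponent]
    field_simp
    ring
  · rw [starStar]
    field_simp
  · have e1 : 1 - q * (Q - 2) / (2 * (Q - 2 * q)) =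
        (2 * Q - 2 * q - q * Q) / (2 * (Q - 2 * q)) := by
      rw [eq_div_iff (by positivity), sub_mul, div_mul_cancel₀ _ (by positivity)]
      ring
    have e2 : 1 - q * Q / (Q - q) / 2 = (2 * Q - 2 * q - q * Q) / (2 * (Q - q)) := by
      field_simp
    rw [star, e1, e2]
    field_simp

theorem exists_stability_of_mem_Ico (hN : 2 ≤ N) (hX : IsAdmissible X Ω Q) (hα : 0 < α)
    (hp2 : ENNReal.ofReal (twoLowerStar Q) ≤ p) (hp : p < ENNReal.ofReal (Q / 2)) :
    ∃ C : ℝ≥0, ∀ A : E N → Matrix (Fin m) (Fin m) ℝ, IsElliptic Ω α A → ∀ f g u v : E N → ℝ,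
      MemLp f p (volume.restrict Ω) → MemLp g p (volume.restrict Ω) →
      IsSolution X Ω Q A p f u → IsSolution X Ω Q A p g v →
      eLpNorm (u - v) (ENNReal.ofReal (starStar Q p.toReal)) (volume.restrict Ω) ≤
        C * eLpNorm (f - g) p (volume.restrict Ω) ∧
      ∃ W, MemW0 X Ω 2 (u - v) W ∧
        eLpNorm W 2 (volume.restrict Ω) ≤ C * eLpNorm (f - g) p (volume.restrict Ω) := by
  have := hX.isFiniteMeasure
  have hQ := hX.two_lt
  have hptop : p ≠ ⊤ := hp.ne_top
  have h1 : 1 < p.toReal := by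
    have := (one_lt_ofReal_twoLowerStar hQ).trans_le hp2
    rwa [← ENNReal.toReal_one, ENNReal.toReal_lt_toReal ENNReal.one_ne_top hptop]
  have h2 : p.toReal < Q / 2 := (ENNReal.lt_ofReal_iff_toReal_lt hptop).1 hp
  obtain ⟨K, C, H⟩ := exists_grad_two_le (m := m) hN hX hα hp2
  obtain ⟨γ, p', hγ, hconj, e1, e2, -⟩ := starStar_exponent hQ h1 h2
  obtain ⟨C₁, H₁⟩ := EnergyEstimate.exists_eLpNorm_le (F := E m) (μ := volume.restrict Ω)
    (one_lt_div_sub_two hQ) K hγ hconj e1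
  rw [e2, ENNReal.ofReal_toReal hptop] at H₁
  refine ⟨C₁ + C, fun A hA f g u v hf hg hu hv => ?_⟩
  obtain ⟨W, hW, hWm, hWle⟩ := H A hA f g u v hf hg (hu.1 hp2) (hv.1 hp2)
  refine ⟨(H₁ _ _ _ hW (hf.sub hg)).trans ?_, W, hWm, hWle.trans ?_⟩ <;>
  · gcongr
    simp

theorem exists_stability_of_mem_Ioo (hN : 2 ≤ N) (hX : IsAdmissible X Ω Q) (hα : 0 < α)
    (hp1 : 1 < p) (hp : p < ENNReal.ofReal (twoLowerStar Q)) :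
    ∃ C : ℝ≥0, ∀ A : E N → Matrix (Fin m) (Fin m) ℝ, IsElliptic Ω α A → ∀ f g u v : E N → ℝ,
      MemLp f p (volume.restrict Ω) → MemLp g p (volume.restrict Ω) →
      IsSolution X Ω Q A p f u → IsSolution X Ω Q A p g v →
      ∃ W, MemW0 X Ω (ENNReal.ofReal (star Q p.toReal)) (u - v) W ∧
        eLpNorm W (ENNReal.ofReal (star Q p.toReal)) (volume.restrict Ω) ≤
          C * eLpNorm (f - g) p (volume.restrict Ω) := by
  have := hX.isFiniteMeasure
  have hQ := hX.two_lt
  have hptop : p ≠ ⊤ := hp.ne_top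
  have h1 : 1 < p.toReal := by
    rwa [← ENNReal.toReal_one, ENNReal.toReal_lt_toReal ENNReal.one_ne_top hptop]
  have h2 : p.toReal < twoLowerStar Q := (ENNReal.lt_ofReal_iff_toReal_lt hptop).1 hp
  rw [twoLowerStar, lt_div_iff₀ (by linarith)] at h2
  have h3 : p.toReal < Q / 2 := by nlinarith
  have hq1 : 1 ≤ star Q p.toReal := by
    rw [star, le_div_iff₀ (by linarith)]
    nlinarith
  have hq2 : star Q p.toReal < 2 := by
    rw [star, div_lt_iff₀ (by linarith)]
    linarith
  -- The limit u - v is known in L^{p**}; this places it in L^{p*}, as membership in W₀^{1,p*}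
  -- requires.
  have hqr : star Q p.toReal ≤ starStar Q p.toReal := by
    rw [star, starStar]
    gcongr
    · linarith
    · linarith
  obtain ⟨K, HK⟩ := hX.exists_energyEstimate (m := m) hN hα
  obtain ⟨γ, p', hγ, hconj, e1, e2, e3⟩ := starStar_exponent hQ h1 h3
  obtain ⟨C₁, H₁⟩ := EnergyEstimate.exists_eLpNorm_le (F := E m) (μ := volume.restrict Ω)
    (one_lt_div_sub_two hQ) K hγ hconj e1
  obtain ⟨C, H⟩ := EnergyEstimate.exists_eLpNorm_grad_le (F := E m) (μ := volume.restrict Ω)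
    (one_lt_div_sub_two hQ) K hγ hconj e1 (by linarith) hq2 e3
  rw [e2, ENNReal.ofReal_toReal hptop] at H₁
  rw [ENNReal.ofReal_toReal hptop] at H
  refine ⟨C, fun A hA f g u v hf hg hu hv => ?_⟩
  have hf1 := hf.mono_exponent hp1.le
  have hg1 := hg.mono_exponent hp1.le
  obtain ⟨U, hU⟩ := (hu.2 hp).exists_grad hN hX hα hA hf1
  obtain ⟨V, hV⟩ := (hv.2 hp).exists_grad hN hX hα hA hg1
  obtain ⟨hn, wn, Wn, k1, k2, k3, k4, k5, k6⟩ := hU.exists_seq hX hA HK hf1 hg1 hV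
  have hσ0 : 0 ≤ Q / (Q - 2) := (one_pos.trans (one_lt_div_sub_two hQ)).le
  have hE := EnergyEstimate.of_tendsto hσ0 k1 (hf1.sub hg1) k3 k5 k6
  have hle := H _ _ _ hE (hf.sub hg)
  have hfin : ∀ c : ℝ≥0, c * eLpNorm (f - g) p (volume.restrict Ω) < ⊤ := fun c =>
    ENNReal.mul_lt_top ENNReal.coe_lt_top (hf.sub hg).2
  have hwr : MemLp (u - v) (ENNReal.ofReal (starStar Q p.toReal)) (volume.restrict Ω) :=
    ⟨hE.meas, (H₁ _ _ _ hE (hf.sub hg)).trans_lt (hfin _)⟩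
  exact ⟨U - V, MemW0.of_energyEstimate hX hσ0 (hf1.sub hg1) k1 k2 k3 k4 k5 k6
    (hU.2.1.sub hV.2.1) hq1 hq2 (hwr.mono_exponent (ENNReal.ofReal_le_ofReal hqr))
    ⟨hE.meas_grad, hle.trans_lt (hfin _)⟩, hle⟩

theorem exists_stability_one (hN : 2 ≤ N) (hX : IsAdmissible X Ω Q) (hα : 0 < α) :
    ∃ C : ℝ≥0, ∀ A : E N → Matrix (Fin m) (Fin m) ℝ, IsElliptic Ω α A → ∀ f g u v : E N → ℝ,
      MemLp f 1 (volume.restrict Ω) → MemLp g 1 (volume.restrict Ω) →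
      IsSolution X Ω Q A 1 f u → IsSolution X Ω Q A 1 g v →
      marcinkiewiczNorm Ω (starStar Q 1) (u - v) ≤ C * eLpNorm (f - g) 1 (volume.restrict Ω) ∧
      ∃ U V, MemW0 X Ω 1 u U ∧ MemW0 X Ω 1 v V ∧
        marcinkiewiczNorm Ω (star Q 1) (U - V) ≤ C * eLpNorm (f - g) 1 (volume.restrict Ω) := by
  have hQ := hX.two_lt
  have hp := one_lt_ofReal_twoLowerStar hQ
  have hσ := one_lt_div_sub_two hQ
  have hσ0 : 0 < Q / (Q - 2) := one_pos.trans hσ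
  have e1 : starStar Q 1 = Q / (Q - 2) := by rw [starStar]; ring
  have e2 : star Q 1 = 2 * (Q / (Q - 2)) / (Q / (Q - 2) + 1) := by
    have h1 : Q - 2 ≠ 0 := by linarith
    have h2 : Q - 1 ≠ 0 := by linarith
    have h3 : Q / (Q - 2) + 1 = 2 * (Q - 1) / (Q - 2) := by field_simp; ring
    rw [star, h3]
    field_simp
  obtain ⟨K, HK⟩ := hX.exists_energyEstimate (m := m) hN hα
  refine ⟨(K ^ (Q / (Q - 2))) ^ (1 / (Q / (Q - 2))) +
    (K ^ (Q / (Q - 2)) + K) ^ (1 / (2 * (Q / (Q - 2)) / (Q / (Q - 2) + 1))),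
    fun A hA f g u v hf hg hu hv => ?_⟩
  obtain ⟨U, hU⟩ := (hu.2 hp).exists_grad hN hX hα hA hf
  obtain ⟨V, hV⟩ := (hv.2 hp).exists_grad hN hX hα hA hg
  obtain ⟨hn, wn, Wn, k1, k2, k3, k4, k5, k6⟩ := hU.exists_seq hX hA HK hf hg hV
  have hE := EnergyEstimate.of_tendsto hσ0.le k1 (hf.sub hg) k3 k5 k6
  have hfin := (hf.sub hg).2.ne
  rw [e1, e2]
  refine ⟨(marcinkiewiczNorm_le hσ0 hfin fun ε hε hle t ht => ?_).trans
    (mul_le_mul' (ENNReal.coe_le_coe.2 le_self_add) le_rfl), U, V, hU.memW0 hX, hV.memW0 hX,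
    (marcinkiewiczNorm_le (by positivity) hfin fun ε hε hle t ht => ?_).trans
    (mul_le_mul' (ENNReal.coe_le_coe.2 le_add_self) le_rfl)⟩
  · rw [ENNReal.coe_rpow_of_nonneg _ hσ0.le]
    exact hE.measure_le hσ0 hε hle ht
  · rw [ENNReal.coe_add, ENNReal.coe_rpow_of_nonneg _ hσ0.le]
    exact hE.measure_grad_le hσ0 hε hle ht

end XElliptic

theorem corollary7p1 {N m : ℕ} (hN : 2 ≤ N)
    (X : Fin m → XElliptic.E N → XElliptic.E N) (Ω : Set (XElliptic.E N)) (Q : ℝ)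
    (hX : XElliptic.IsAdmissible X Ω Q)
    (p : ℝ≥0∞) (hp : 1 ≤ p) (α : ℝ) (hα : 0 < α) :
    ∃ C : ℝ≥0, ∀ A : XElliptic.E N → Matrix (Fin m) (Fin m) ℝ, XElliptic.IsElliptic Ω α A →
      ∀ f g u v : XElliptic.E N → ℝ,
        MemLp f p (volume.restrict Ω) → MemLp g p (volume.restrict Ω) →
        XElliptic.IsSolution X Ω Q A p f u → XElliptic.IsSolution X Ω Q A p g v →
        (ENNReal.ofReal (Q / 2) < p →
          eLpNorm (u - v) (⊤ : ℝ≥0∞) (volume.restrict Ω) ≤ C * eLpNorm (f - g) p (volume.restrict Ω) ∧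
          ∃ W, XElliptic.MemW0 X Ω 2 (u - v) W ∧
            eLpNorm W 2 (volume.restrict Ω) ≤ C * eLpNorm (f - g) p (volume.restrict Ω)) ∧
        (ENNReal.ofReal (2 * Q / (Q + 2)) ≤ p → p < ENNReal.ofReal (Q / 2) →
          eLpNorm (u - v) (ENNReal.ofReal (XElliptic.starStar Q p.toReal)) (volume.restrict Ω) ≤
            C * eLpNorm (f - g) p (volume.restrict Ω) ∧
          ∃ W, XElliptic.MemW0 X Ω 2 (u - v) W ∧
            eLpNorm W 2 (volume.restrict Ω) ≤ C * eLpNorm (f - g) p (volume.restrict Ω)) ∧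
        (1 < p → p < ENNReal.ofReal (2 * Q / (Q + 2)) →
          ∃ W, XElliptic.MemW0 X Ω (ENNReal.ofReal (XElliptic.star Q p.toReal)) (u - v) W ∧
            eLpNorm W (ENNReal.ofReal (XElliptic.star Q p.toReal)) (volume.restrict Ω) ≤
              C * eLpNorm (f - g) p (volume.restrict Ω)) ∧
        (p = 1 →
          XElliptic.marcinkiewiczNorm Ω (XElliptic.starStar Q 1) (u - v) ≤
            C * eLpNorm (f - g) 1 (volume.restrict Ω) ∧
          ∃ U V, XElliptic.MemW0 X Ω 1 u U ∧ XElliptic.MemW0 X Ω 1 v V ∧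
            XElliptic.marcinkiewiczNorm Ω (XElliptic.star Q 1) (U - V) ≤
              C * eLpNorm (f - g) 1 (volume.restrict Ω)) := by

  -- The constant must precede the hypotheses on the range of p. Each range supplies its own
  -- constant, 0 if the range does not contain p, and the sum serves all.
  have hex : ∀ {P : Prop} {R : ℝ≥0 → Prop}, (P → ∃ C, R C) → ∃ C, P → R C := fun {P R} h => by
    by_cases hP : P
    · exact (h hP).imp fun C hC _ => hC
    · exact ⟨0, fun h => absurd h hP⟩
  obtain ⟨C₁, H₁⟩ := hex fun h => XElliptic.exists_stability_of_gt (m := m) (p := p) hN hX hα h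
  obtain ⟨C₂, H₂⟩ := hex fun h : ENNReal.ofReal (XElliptic.twoLowerStar Q) ≤ p ∧
    p < ENNReal.ofReal (Q / 2) => XElliptic.exists_stability_of_mem_Ico (m := m) hN hX hα h.1 h.2
  obtain ⟨C₃, H₃⟩ := hex fun h : 1 < p ∧ p < ENNReal.ofReal (XElliptic.twoLowerStar Q) =>
    XElliptic.exists_stability_of_mem_Ioo (m := m) hN hX hα h.1 h.2
  obtain ⟨C₄, H₄⟩ := XElliptic.exists_stability_one (m := m) hN hX hα
  set C := C₁ + C₂ + C₃ + C₄ with hC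
  have c₁ : C₁ ≤ C := le_self_add.trans (le_self_add.trans le_self_add)
  have c₂ : C₂ ≤ C := le_add_self.trans (le_self_add.trans le_self_add)
  have c₃ : C₃ ≤ C := le_add_self.trans le_self_add
  have c₄ : C₄ ≤ C := le_add_self
  have hmul : ∀ {c : ℝ≥0} {e : ℝ≥0∞}, c ≤ C → c * e ≤ C * e := fun h =>
    mul_le_mul' (ENNReal.coe_le_coe.2 h) le_rfl
  refine ⟨C, fun A hA f g u v hf hg hu hv => ⟨fun h => ?_, fun h h' => ?_, fun h h' => ?_, ?_⟩⟩
  · obtain ⟨h1, W, h2, h3⟩ := H₁ h A hA f g u v hf hg hu hv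
    exact ⟨h1.trans (hmul c₁), W, h2, h3.trans (hmul c₁)⟩
  · obtain ⟨h1, W, h2, h3⟩ := H₂ ⟨h, h'⟩ A hA f g u v hf hg hu hv
    exact ⟨h1.trans (hmul c₂), W, h2, h3.trans (hmul c₂)⟩
  · obtain ⟨W, h2, h3⟩ := H₃ ⟨h, h'⟩ A hA f g u v hf hg hu hv
    exact ⟨W, h2, h3.trans (hmul c₃)⟩
  · rintro rfl
    obtain ⟨h1, U, V, h2, h3, h4⟩ := H₄ A hA f g u v hf hg hu hv
    exact ⟨h1.trans (hmul c₄), U, V, h2, h3, h4.trans (hmul c₄)⟩
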